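/- **Setting.** Let $d\ge 1$, $r\ge1$, and let $f:\mathbb R\to\mathbb R$ have order of smoothness $r$: $f\in C^{2r}(-2a,2a)$ for some $a>0$, $f^{(2\ell-1)}(0)=0$ for $1\le \ell<r$, and $f^{(2r-1)}(0)\ne0$. Put $f_k=f^{(k)}(0)/k!$, $K(\mathbf x,\mathbf y)=f(\|\mathbf x-\mathbf y\|_2)$ on $\mathbb R^d$. For $\mathbf x_1,\dots,\mathbf x_n\in\mathbb R^d$ put $$\mathbf K_\varepsilon=[f(\varepsilon\|\mathbf x_i-\mathbf x_j\|_2)]_{i,j=1}^n,\qquad \mathbf D_{(k)}=[\|\mathbf x_i-\mathbf x_j\|_2^k]_{i,j=1}^n .$$ Let $\mathbb P_k$, $\mathbb H_k$ be the sets of multi-indices $\alpha\in\mathbb Z_+^d$ with $|\alpha|\le k$, resp. $|\alpha|=k$ ($\mathbb P_{-1}=\emptyset$), ordered by a linear order in which $|\alpha|<|\beta|$ implies $\alpha\prec\beta$; let $M(k,d)=\sum_{\alpha\in\mathbb P_k}|\alpha|$. Let $\mathbf V_{\mathcal A}=[\mathbf x_i^{\alpha}]_{i\le n,\ \alpha\in\mathcal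 A}$, $\mathbf V_{\le k}=\mathbf V_{\mathbb P_k}$, $\mathbf V_k=\mathbf V_{\mathbb H_k}$, $\mathbf W_{\mathcal A,\mathcal B}=\big[K^{(\alpha,\beta)}(0,0)/(\alpha!\beta!)\big]_{\alpha\in\mathcal A,\beta\in\mathcal B}$ and $\mathbf W_{\le k}=\mathbf W_{\mathbb P_k,\mathbb P_k}$. "$\mathbf V_{\le k}$ has full rank" means $\operatorname{rank}\mathbf V_{\le k}=\#\mathbb P_k$. Assume $n=\#\mathbb P_{r-1}+N$ with $N\ge0$. Let $\mathbf V_{\le r-1}=[\mathbf Q_{\rm thin}\ \mathbf Q_\perp]\begin{bmatrix}\mathbf R\\0\end{bmatrix}$ be any full QR factorization (orthogonal first factor, $\mathbf R$ upper triangular), and let $\mathbf Q_{\rm thin}=[\mathbf Q_0\ \cdots\ \mathbf Q_{r-1}]$ with $\mathbf Q_s\in\mathbb R^{n\times\#\mathbb H_s}$. **1.** As $\varepsilon\to0$, $\det\mathbf K_\varepsilon=\varepsilon^{2M(r-1,d)+(2r-1)N}\big(\widetilde k+O(\varepsilon)\big)$, where $$\widetilde k=(-1)^{\#\mathbb P_{r-1}}\det\mathbf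 W_{\le r-1}\det\begin{bmatrix}f_{2r-1}\mathbf D_{(2r-1)}&\mathbf V_{\le r-1}\\ \mathbf V_{\le r-1}^{\mathsf T}&0\end{bmatrix}=\det\mathbf W_{\le r-1}\,\det(\mathbf V_{\le r-1}^{\mathsf T}\mathbf V_{\le r-1})\,\det(f_{2r-1}\mathbf Q_\perp^{\mathsf T}\mathbf D_{(2r-1)}\mathbf Q_\perp);$$ in the last expression $\mathbf Q_\perp$ may be any matrix in $\mathbb R^{n\times N}$ with $\mathbf Q_\perp^{\mathsf T}\mathbf Q_\perp=\mathbf I$ and $\mathbf Q_\perp^{\mathsf T}\mathbf V_{\le r-1}=0$. **2.** If $\mathbf K_\varepsilon$ is positive semidefinite for all $\varepsilon\in[0,\varepsilon_0]$, for some $\varepsilon_0>0$, then its eigenvalues $\lambda_1(\varepsilon)\ge\dots\ge\lambda_n(\varepsilon)$ split, in this order, into $r+1$ groups: for $0\le s\le r-1$ the $s$-th group consists of $\#\mathbb H_s$ eigenvalues, all $O(\varepsilon^{2s})$, and the last group consists of the remaining $N$ eigenvalues, all $O(\varepsilon^{2r-1})$, as $\varepsilon\to0^+$. **3.** Assume moreover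 that $\varepsilon\mapsto\mathbf K_\varepsilon$ is analytic in a neighbourhood of $0$. Then there is an eigenvalue decomposition $\mathbf K_\varepsilon=\sum_k\lambda_k(\varepsilon)\mathbf P_k(\varepsilon)$ near $0$ with analytic $\lambda_k$ and analytic, mutually orthogonal, rank-one orthogonal projectors $\mathbf P_k$, where $\lambda_1(\varepsilon)\ge\dots\ge\lambda_n(\varepsilon)$ for small $\varepsilon>0$. For every such decomposition, the eigenvalues of the $s$-th group ($0\le s\le r-1$) have the form $\lambda_{s,j}(\varepsilon)=\varepsilon^{2s}(\widetilde\lambda_{s,j}+O(\varepsilon))$, those of the last group have the form $\varepsilon^{2r-1}(\widetilde\lambda+O(\varepsilon))$, and the main terms satisfy: - $\widetilde\lambda_{0,0}=nK(0,0)$; - for $1\le s\le r-1$, if $\det\mathbf W_{\le s-1}\ne0$ and $\mathbf V_{\le s-1}$ has full rank, then $$\prod_{j}\widetilde\lambda_{s,j}=\frac{\det(\mathbf V_{\le s}^{\mathsf T}\mathbf V_{\le s})\det\mathbf W_{\le s}}{\det(\mathbf V_{\le s-1}^{\mathsf T}\mathbf V_{\le s-1})\det\mathbf W_{\le s-1}},$$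 and $\widetilde\lambda_{s,1},\dots,\widetilde\lambda_{s,\#\mathbb H_s}$ are the eigenvalues, with multiplicity, of $\mathbf Q_s^{\mathsf T}\mathbf V_s\widetilde{\mathbf W}\mathbf V_s^{\mathsf T}\mathbf Q_s$, where $\widetilde{\mathbf W}=\mathbf W_{\mathbb H_s,\mathbb H_s}-\mathbf W_{\mathbb H_s,\mathbb P_{s-1}}\mathbf W_{\le s-1}^{-1}\mathbf W_{\mathbb P_{s-1},\mathbb H_s}$; - if $\det\mathbf W_{\le r-1}\ne0$ and $\mathbf V_{\le r-1}$ has full rank, the $N$ main terms of the last group are the eigenvalues, with multiplicity, of $f_{2r-1}\,\mathbf Q_\perp^{\mathsf T}\mathbf D_{(2r-1)}\mathbf Q_\perp$. **4.** In the situation of 3, let $\mathbf p_k$ be the limiting eigenvectors, i.e. $\mathbf P_k(0)=\mathbf p_k\mathbf p_k^{\mathsf T}$. For $0\le s\le r-1$, if $\det\mathbf W_{\le s}\ne0$ and $\mathbf V_{\le s}$ has full rank, the limiting eigenvectors of the $s$-th group span the column space of $\mathbf Q_s$. If $\det\mathbf W_{\le r-1}\ne0$ and $\mathbf V_{\le r-1}$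 has full rank, the limiting eigenvectors of the last group span the column space of $\mathbf Q_\perp$. -/

import Mathlib

open Filter Topology Asymptotics

/-! ### Multi-indices -/

/-- `ℍ_k`: the multi-indices `α ∈ ℕ^d` with `|α| = k`. -/
def multiIdxEQ (d k : ℕ) : Finset (Fin d → ℕ) := Finset.Nat.antidiagonalTuple d k

/-- The multi-indices `α ∈ ℕ^d` with `|α| < k`. -/
def multiIdxLT (d k : ℕ) : Finset (Fin d → ℕ) := (Finset.range k).biUnion (multiIdxEQ d)

/-- `ℙ_k`: the multi-indices `α ∈ ℕ^d` with `|α| ≤ k`. -/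
def multiIdxLE (d k : ℕ) : Finset (Fin d → ℕ) := multiIdxLT d (k + 1)

theorem mem_multiIdxEQ {d k : ℕ} {α : Fin d → ℕ} :
    α ∈ multiIdxEQ d k ↔ ∑ i, α i = k := by
  simp [multiIdxEQ, Finset.Nat.mem_antidiagonalTuple]

theorem mem_multiIdxLT {d k : ℕ} {α : Fin d → ℕ} :
    α ∈ multiIdxLT d k ↔ ∑ i, α i < k := by
  simp [multiIdxLT, mem_multiIdxEQ]

theorem mem_multiIdxLE {d k : ℕ} {α : Fin d → ℕ} :
    α ∈ multiIdxLE d k ↔ ∑ i, α i ≤ k := by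
  simp [multiIdxLE, mem_multiIdxLT]

theorem multiIdxEQ_subset_multiIdxLE {d s k : ℕ} (h : s ≤ k) :
    multiIdxEQ d s ⊆ multiIdxLE d k := fun _ hα =>
  mem_multiIdxLE.2 ((mem_multiIdxEQ.1 hα).le.trans h)

/-- `M(k,d) = ∑_{|α| ≤ k} |α|`. -/
def totalDegreeSum (k d : ℕ) : ℕ := ∑ α ∈ multiIdxLE d k, ∑ i, α i

/-- A graded linear ordering of all multi-indices, given by its enumeration: `α` comes before `β`
iff `ord α < ord β`, and `|α| < |β|` implies that `α` comes before `β`. -/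
structure IsGradedOrdering (d : ℕ) (ord : (Fin d → ℕ) → ℕ) : Prop where
  injective : Function.Injective ord
  graded : ∀ α β : Fin d → ℕ, ∑ i, α i < ∑ i, β i → ord α < ord β

/-! ### Vandermonde, distance and kernel matrices -/

noncomputable section

/-- The multivariate Vandermonde matrix `V_A = [x_i ^ α]` for `α ∈ A`. -/
def vandermondeMat {d n : ℕ} (x : Fin n → EuclideanSpace ℝ (Fin d)) (A : Finset (Fin d → ℕ)) :
    Matrix (Fin n) A ℝ :=
  Matrix.of fun i α => ∏ j, x i j ^ (α : Fin d → ℕ) j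

/-- `D_{(k)} = [‖x_i - x_j‖₂ ^ k]`. -/
def distMat {d n : ℕ} (x : Fin n → EuclideanSpace ℝ (Fin d)) (k : ℕ) :
    Matrix (Fin n) (Fin n) ℝ :=
  Matrix.of fun i j => ‖x i - x j‖ ^ k

/-- The radial kernel `K(x,y) = f(‖x - y‖₂)`. -/
def radialKernel (d : ℕ) (f : ℝ → ℝ) (x y : EuclideanSpace ℝ (Fin d)) : ℝ := f ‖x - y‖

/-- The scaled kernel matrix `K_ε = [f(ε ‖x_i - x_j‖₂)]`. -/
def kernelMat {d n : ℕ} (f : ℝ → ℝ) (x : Fin n → EuclideanSpace ℝ (Fin d)) (ε : ℝ) :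
    Matrix (Fin n) (Fin n) ℝ :=
  Matrix.of fun i j => f (ε * ‖x i - x j‖)

theorem kernelMat_isHermitian {d n : ℕ} (f : ℝ → ℝ) (x : Fin n → EuclideanSpace ℝ (Fin d))
    (ε : ℝ) : (kernelMat f x ε).IsHermitian := by
  ext i j
  simp [kernelMat, norm_sub_rev]

/-- The `k`-th largest eigenvalue (`k = 0, 1, …`, with multiplicity) of `K_ε`. -/
def kernelEigenvalue {d n : ℕ} (f : ℝ → ℝ) (x : Fin n → EuclideanSpace ℝ (Fin d)) (k : Fin n)
    (ε : ℝ) : ℝ :=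
  (kernelMat_isHermitian f x ε).eigenvalues₀ (Fin.cast (Fintype.card_fin n).symm k)

/-! ### Order of smoothness -/

/-- `f_k = f^{(k)}(0) / k!`. -/
def scaledDeriv (f : ℝ → ℝ) (k : ℕ) : ℝ := iteratedDeriv k f 0 / (k.factorial : ℝ)

/-- The radial basis function `f` has order of smoothness `r`: it is `C^{2r}` on some `(-2a, 2a)`,
its derivatives of odd order less than `2r - 1` vanish at `0`, and `f^{(2r-1)}(0) ≠ 0`. -/
structure HasSmoothnessOrder (f : ℝ → ℝ) (r : ℕ) : Prop where
  pos : 1 ≤ r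
  contDiffOn : ∃ a : ℝ, 0 < a ∧
    ContDiffOn ℝ ((2 * r : ℕ) : WithTop ℕ∞) f (Set.Ioo (-(2 * a)) (2 * a))
  odd_eq_zero : ∀ l : ℕ, 1 ≤ l → l < r → iteratedDeriv (2 * l - 1) f 0 = 0
  odd_ne_zero : iteratedDeriv (2 * r - 1) f 0 ≠ 0

/-! ### Partial derivatives and the Wronskian -/

/-- `∂g/∂z_i`. -/
def partialDeriv {d : ℕ} (i : Fin d) (g : EuclideanSpace ℝ (Fin d) → ℝ) :
    EuclideanSpace ℝ (Fin d) → ℝ :=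
  fun z => lineDeriv ℝ g z (EuclideanSpace.single i 1)

/-- `g^{(α)} = ∂^{|α|} g / ∂z_1^{α_1} ⋯ ∂z_d^{α_d}`. -/
def mixedPartial {d : ℕ} (α : Fin d → ℕ) (g : EuclideanSpace ℝ (Fin d) → ℝ) :
    EuclideanSpace ℝ (Fin d) → ℝ :=
  (List.finRange d).foldr (fun i h => (partialDeriv i)^[α i] h) g

/-- `K^{(α,β)}(x,y)`: derivative `α` in the first and `β` in the second argument. -/
def kernelDeriv {d : ℕ} (K : EuclideanSpace ℝ (Fin d) → EuclideanSpace ℝ (Fin d) → ℝ)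
    (α β : Fin d → ℕ) (x y : EuclideanSpace ℝ (Fin d)) : ℝ :=
  mixedPartial α (fun x' => mixedPartial β (K x') y) x

/-- The block `W_{A,B} = [K^{(α,β)}(0,0) / (α! β!)]` of the Wronskian, `α ∈ A`, `β ∈ B`. -/
def wronskianBlock {d : ℕ} (K : EuclideanSpace ℝ (Fin d) → EuclideanSpace ℝ (Fin d) → ℝ)
    (A B : Finset (Fin d → ℕ)) : Matrix A B ℝ :=
  Matrix.of fun α β =>
    kernelDeriv K α β 0 0 /
      ((∏ i, (((α : Fin d → ℕ) i).factorial : ℝ)) * ∏ i, (((β : Fin d → ℕ) i).factorial : ℝ))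

/-- The Wronskian matrix `W_{≤ k}`. -/
def wronskianMat {d : ℕ} (K : EuclideanSpace ℝ (Fin d) → EuclideanSpace ℝ (Fin d) → ℝ) (k : ℕ) :
    Matrix (multiIdxLE d k) (multiIdxLE d k) ℝ :=
  wronskianBlock K (multiIdxLE d k) (multiIdxLE d k)

/-- The Schur complement of `W_{≤ s-1}` in `W_{≤ s}` (for `s ≥ 1`), indexed by `|α| = |β| = s`. -/
def wronskianSchur {d : ℕ} (K : EuclideanSpace ℝ (Fin d) → EuclideanSpace ℝ (Fin d) → ℝ) (s : ℕ) :
    Matrix (multiIdxEQ d s) (multiIdxEQ d s) ℝ :=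
  wronskianBlock K (multiIdxEQ d s) (multiIdxEQ d s) -
    wronskianBlock K (multiIdxEQ d s) (multiIdxLE d (s - 1)) *
      (wronskianMat K (s - 1))⁻¹ *
        wronskianBlock K (multiIdxLE d (s - 1)) (multiIdxEQ d s)

/-! ### Full QR factorization -/

/-- `V_{≤ k} = [Qthin Qperp] [R; 0]` is a full QR factorization of the Vandermonde matrix whose
columns are arranged according to `ord`: `[Qthin Qperp]` is orthogonal, `R` is upper triangular. -/
structure IsFullQR {d n k N : ℕ} (x : Fin n → EuclideanSpace ℝ (Fin d))
    (ord : (Fin d → ℕ) → ℕ) (Qthin : Matrix (Fin n) (multiIdxLE d k) ℝ)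
    (Qperp : Matrix (Fin n) (Fin N) ℝ)
    (R : Matrix (multiIdxLE d k) (multiIdxLE d k) ℝ) : Prop where
  card_eq : n = (multiIdxLE d k).card + N
  orthogonal : (Matrix.fromCols Qthin Qperp).transpose * Matrix.fromCols Qthin Qperp = 1
  upper : ∀ α β : multiIdxLE d k, ord β < ord α → R α β = 0
  factor : vandermondeMat x (multiIdxLE d k) = Qthin * R

/-- `Q_s`: the columns of the `Q` factor at the places of the monomials of degree `s`. -/
def degreeCols {d n k : ℕ} (Qthin : Matrix (Fin n) (multiIdxLE d k) ℝ) (s : ℕ) (hs : s ≤ k) :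
    Matrix (Fin n) (multiIdxEQ d s) ℝ :=
  Qthin.submatrix id fun α => ⟨α, multiIdxEQ_subset_multiIdxLE hs α.2⟩

/-! ### Groups of eigenvalues -/

/-- Positions (in the decreasing order of eigenvalues) of the `s`-th group:
`#ℙ_{s-1} ≤ k < #ℙ_s`. -/
def evGroup (d n s : ℕ) : Finset (Fin n) :=
  Finset.univ.filter fun k => (multiIdxLT d s).card ≤ (k : ℕ) ∧ (k : ℕ) < (multiIdxLE d s).card

/-- Positions of the last group: `#ℙ_{r-1} ≤ k`. -/
def evLastGroup (d n r : ℕ) : Finset (Fin n) :=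
  Finset.univ.filter fun k => (multiIdxLT d r).card ≤ (k : ℕ)

/-- An analytic eigenvalue decomposition `A(ε) = ∑ λ_k(ε) P_k(ε)` near `ε = 0`, with rank-one
orthogonal projectors, with the eigenvalues in decreasing order for small `ε > 0`, and with limiting
eigenvectors `p_k`, i.e. `P_k(0) = p_k p_kᵀ`. -/
structure IsAnalyticEVD {n : ℕ} (A : ℝ → Matrix (Fin n) (Fin n) ℝ) (lam : Fin n → ℝ → ℝ)
    (P : Fin n → ℝ → Matrix (Fin n) (Fin n) ℝ) (p : Fin n → Fin n → ℝ) : Prop where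
  analytic_lam : ∀ k, AnalyticAt ℝ (lam k) 0
  analytic_proj : ∀ k i j, AnalyticAt ℝ (fun ε => P k ε i j) 0
  symm : ∀ᶠ ε in 𝓝 (0 : ℝ), ∀ k, (P k ε).transpose = P k ε
  idem : ∀ᶠ ε in 𝓝 (0 : ℝ), ∀ k, P k ε * P k ε = P k ε
  rank_one : ∀ᶠ ε in 𝓝 (0 : ℝ), ∀ k, (P k ε).rank = 1
  orthogonal : ∀ᶠ ε in 𝓝 (0 : ℝ), ∀ k l, k ≠ l → P k ε * P l ε = 0
  evd : ∀ᶠ ε in 𝓝 (0 : ℝ), A ε = ∑ k, lam k ε • P k ε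
  ordered : ∀ᶠ ε in 𝓝[>] (0 : ℝ), Antitone fun k => lam k ε
  limit : ∀ k, P k 0 = Matrix.vecMulVec (p k) (p k)

end

/-! Call an orthonormal basis of `ℝ^n` graded if its members of degree `s < r`, read as weights on
the nodes, annihilate all monomials of degree less than `s`, and its last `N` members annihilate all
monomials of degree less than `r`. The `Q` factor of a QR factorization in a graded order is such a
basis, and Gram–Schmidt yields one for arbitrary nodes, without a rank condition.

Since the odd derivatives of `f` below order `2r - 1` vanish, Taylor's formula splits the scaled
kernel into the polynomial `∑ ε^(|α|+|β|) W_{αβ} x^α y^β`, the term `f_{2r-1} ε^(2r-1) ‖x -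
y‖^(2r-1)` and an error `O(ε^(2r))` (`kernelMat_expansion`). The coefficients with `|α| + |β| ≤ 2r -
2` are the Wronskian entries, because a radial remainder that vanishes to order `2r - 1` has no
partial derivatives at the origin up to order `2r - 2` (`flat_radialTerm`). In a graded basis the
low order terms cancel: the entry between members of degrees `s, t < r` starts at order `s + t`, its
leading coefficients forming a congruence `G W Gᵀ` of the Wronskian (`frameLimit_submatrix`), while
between the last members only the distance matrix survives, at order `2r - 1`.

The rest compares leading terms. The Leibniz formula with row and column weights gives the
determinant (`HasLead.det`), and a bordered determinant identity gives its second form. A min-max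
argument on the members of high degree bounds the eigenvalues (`eigenvalue_le_sum_abs`). For
analytic families Rellich's theorem supplies the eigenvalue decomposition, and the bounds make its
eigenvalues have main terms. These are read off from `det (z ε^k - K_ε) = ∏ (z ε^k - λ)`: at the
scale of one group, the groups with larger eigenvalues contribute constants and those with smaller
ones only powers of `z`, which leaves the characteristic polynomial of a Schur complement
(`charpoly_schur_roots`). Finally, an eigenvector with eigenvalue of high order loses its components
of low degree in the limit (`limit_eigenvector_apply_eq_zero`), and orthogonality turns this
triangular structure into a block diagonal one. -/

/-! ### Leading terms of functions near `0` -/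

/-- `F(t) = t ^ m (c + O(t))` as `t → 0`. -/
def HasLead (F : ℝ → ℝ) (m : ℕ) (c : ℝ) : Prop :=
  (fun t : ℝ => F t - t ^ m * c) =O[𝓝 0] fun t : ℝ => t ^ (m + 1)

theorem isBigO_pow_pow_nhds_zero {a b : ℕ} (h : a ≤ b) :
    (fun t : ℝ => t ^ b) =O[𝓝 0] fun t : ℝ => t ^ a := by
  obtain ⟨c, rfl⟩ := Nat.exists_eq_add_of_le h
  have h1 : (fun t : ℝ => t ^ c) =O[𝓝 0] fun _ => (1 : ℝ) :=
    (continuous_pow c).continuousAt.norm.isBoundedUnder_le.isBigO_one ℝ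
  simpa [pow_add] using (isBigO_refl (fun t : ℝ => t ^ a) (𝓝 0)).mul h1

namespace HasLead

variable {F G : ℝ → ℝ} {m k : ℕ} {c c' : ℝ}

theorem isBigO (h : HasLead F m c) : F =O[𝓝 0] fun t : ℝ => t ^ m := by
  have h1 : (fun t : ℝ => t ^ m * c) =O[𝓝 0] fun t : ℝ => t ^ m := by
    simpa [mul_comm] using (isBigO_refl (fun t : ℝ => t ^ m) (𝓝 0)).const_mul_left c
  simpa using (h.trans (isBigO_pow_pow_nhds_zero m.le_succ)).add h1

theorem of_isBigO (h : F =O[𝓝 0] fun t : ℝ => t ^ k) (hm : m < k) : HasLead F m 0 := by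
  simpa [HasLead] using h.trans (isBigO_pow_pow_nhds_zero hm)

theorem lower (h : HasLead F k c) (hm : m < k) : HasLead F m 0 := of_isBigO h.isBigO hm

theorem zero : HasLead (fun _ => 0) m 0 := by simp [HasLead, isBigO_zero]

theorem const : HasLead (fun _ => c) 0 c := by simp [HasLead, isBigO_zero]

theorem pow_mul_const : HasLead (fun t => t ^ m * c) m c := by simp [HasLead, isBigO_zero]

theorem add (hF : HasLead F m c) (hG : HasLead G m c') :
    HasLead (fun t => F t + G t) m (c + c') :=
  (IsBigO.add hF hG).congr_left fun t => by ring

theorem const_mul (a : ℝ) (hF : HasLead F m c) : HasLead (fun t => a * F t) m (a * c) :=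
  (IsBigO.const_mul_left hF a).congr_left fun t => by ring

theorem neg (hF : HasLead F m c) : HasLead (fun t => - F t) m (-c) := by
  simpa using hF.const_mul (-1)

theorem sub (hF : HasLead F m c) (hG : HasLead G m c') :
    HasLead (fun t => F t - G t) m (c - c') := by
  simpa [sub_eq_add_neg] using hF.add hG.neg

theorem mul (hF : HasLead F m c) (hG : HasLead G k c') :
    HasLead (fun t => F t * G t) (m + k) (c * c') := by
  have h1 := IsBigO.mul hF hG.isBigO
  have h2 := (isBigO_refl (fun t : ℝ => t ^ m * c) (𝓝 0)).mul hG
  have h3 : (fun t : ℝ => t ^ m * c) =O[𝓝 0] fun t : ℝ => t ^ m := by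
    simpa [mul_comm] using (isBigO_refl (fun t : ℝ => t ^ m) (𝓝 0)).const_mul_left c
  have h4 := h3.mul hG
  have h5 := (h1.congr_right fun t => (by ring : _ = t ^ (m + k + 1))).add
    (h4.congr_right fun t => (by ring : _ = t ^ (m + k + 1)))
  exact h5.congr_left fun t => by ring

theorem sum {ι : Type*} (s : Finset ι) {F : ι → ℝ → ℝ} {c : ι → ℝ}
    (h : ∀ i ∈ s, HasLead (F i) m (c i)) :
    HasLead (fun t => ∑ i ∈ s, F i t) m (∑ i ∈ s, c i) := by
  have := IsBigO.sum (fun i hi => h i hi)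
  refine this.congr_left fun t => ?_
  simp [Finset.sum_sub_distrib, Finset.mul_sum]

theorem prod {ι : Type*} (s : Finset ι) {F : ι → ℝ → ℝ} {m : ι → ℕ} {c : ι → ℝ}
    (h : ∀ i ∈ s, HasLead (F i) (m i) (c i)) :
    HasLead (fun t => ∏ i ∈ s, F i t) (∑ i ∈ s, m i) (∏ i ∈ s, c i) := by
  classical
  induction s using Finset.induction_on with
  | empty => simpa using const
  | insert a s ha ih =>
    simp only [Finset.prod_insert ha, Finset.sum_insert ha]
    exact (h a (Finset.mem_insert_self a s)).mul
      (ih fun i hi => h i (Finset.mem_insert_of_mem hi))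

theorem congr (h : HasLead F m c) (hFG : F =ᶠ[𝓝 0] G) : HasLead G m c := by
  refine IsBigO.congr' h ?_ EventuallyEq.rfl
  filter_upwards [hFG] with t ht
  rw [ht]

theorem tendsto_div (h : HasLead F m c) : Tendsto (fun t => F t / t ^ m) (𝓝[>] 0) (𝓝 c) := by
  have h1 : (fun t : ℝ => F t - t ^ m * c) =o[𝓝[>] 0] fun t : ℝ => t ^ m := by
    refine (h.mono nhdsWithin_le_nhds).trans_isLittleO ?_
    have : (fun t : ℝ => t ^ (m + 1)) =o[𝓝 0] fun t : ℝ => t ^ m :=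
      isLittleO_pow_pow (Nat.lt_succ_self m)
    exact this.mono nhdsWithin_le_nhds
  have h2 := h1.tendsto_div_nhds_zero
  have h3 : Tendsto (fun t => (F t - t ^ m * c) / t ^ m + c) (𝓝[>] 0) (𝓝 c) := by
    simpa using h2.add_const c
  refine h3.congr' ?_
  filter_upwards [self_mem_nhdsWithin] with t ht
  have : t ^ m ≠ 0 := pow_ne_zero _ (ne_of_gt ht)
  field_simp
  ring

theorem unique (h : HasLead F m c) (h' : HasLead F m c') : c = c' :=
  tendsto_nhds_unique h.tendsto_div h'.tendsto_div

theorem comp_sq (h : HasLead F m c) : HasLead (fun t => F (t ^ 2)) (2 * m) c := by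
  have h0 : Tendsto (fun t : ℝ => t ^ 2) (𝓝 0) (𝓝 0) := by
    simpa using (continuous_pow 2).tendsto (0 : ℝ)
  have h1 := IsBigO.comp_tendsto h h0
  have h2 := h1.trans ((isBigO_pow_pow_nhds_zero (a := 2 * m + 1) (b := 2 * (m + 1))
    (by omega)).congr_left fun t => (by simp [pow_mul]))
  exact h2.congr_left fun t => by simp [pow_mul]

end HasLead

/-- Leading term of a determinant whose entries have leading terms of order `r a + c b`. -/
theorem HasLead.det {ι : Type*} [Fintype ι] [DecidableEq ι] {A : ℝ → Matrix ι ι ℝ}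
    {L : Matrix ι ι ℝ} {r c : ι → ℕ}
    (h : ∀ a b, HasLead (fun t => A t a b) (r a + c b) (L a b)) :
    HasLead (fun t => (A t).det) (∑ a, r a + ∑ a, c a) L.det := by
  simp only [Matrix.det_apply']
  refine HasLead.sum _ fun σ _ => HasLead.const_mul _ ?_
  have := HasLead.prod Finset.univ (fun a _ => h (σ a) a)
  -- Every permutation gives a product of the same total order, so all terms of the Leibniz sum
  -- compete and the leading coefficients add up to `L.det`.
  rwa [Finset.sum_add_distrib, Equiv.sum_comp σ r] at this

/-- The pencil identity: if the entries of `A` have leading terms `η ^ (e a + e b) L a b`,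
and its eigenvalues leading terms `η ^ (2 e a) main a`, where `e ≤ t`, then comparing leading terms
in `det (z η ^ (2 t) - A) = ∏ (z η ^ (2 t) - lam a)` one gets an identity between limits. -/
theorem det_pencil_eq_prod {ι : Type*} [Fintype ι] [DecidableEq ι] {A : ℝ → Matrix ι ι ℝ}
    {L : Matrix ι ι ℝ} {lam : ι → ℝ → ℝ} {main : ι → ℝ} {e : ι → ℕ} {t : ℕ} (he : ∀ a, e a ≤ t)
    (hA : ∀ a b, HasLead (fun η => A η a b) (e a + e b) (L a b))
    (hlam : ∀ a, HasLead (lam a) (2 * e a) (main a))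
    (hdet : ∀ᶠ η in 𝓝 (0 : ℝ), ∀ z : ℝ, (z • (1 : Matrix ι ι ℝ) - A η).det = ∏ a, (z - lam a η))
    (z : ℝ) :
    (z • Matrix.diagonal (fun a => if e a = t then (1 : ℝ) else 0) - L).det =
      ∏ a, ((if e a = t then z else 0) - main a) := by
  -- The shift `z η ^ (2 t)` is measured at the scale `η ^ (2 e a)` of its own row: it is of leading
  -- order exactly where `e a = t` and negligible where `e a < t`.
  have key : ∀ a, HasLead (fun η => z * η ^ (2 * t)) (2 * e a) (if e a = t then z else 0) := by
    intro a
    have h0 : HasLead (fun η => z * η ^ (2 * t)) (2 * t) z := by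
      simpa [mul_comm] using HasLead.pow_mul_const (m := 2 * t) (c := z)
    split_ifs with h
    · rw [h]; exact h0
    · exact h0.lower (by have := he a; omega)
  have h1 : HasLead (fun η => ((z * η ^ (2 * t)) • (1 : Matrix ι ι ℝ) - A η).det)
      (∑ a, e a + ∑ a, e a)
      (z • Matrix.diagonal (fun a => if e a = t then (1 : ℝ) else 0) - L).det := by
    refine HasLead.det fun a b => ?_
    simp only [Matrix.sub_apply, Matrix.smul_apply, smul_eq_mul]
    refine HasLead.sub ?_ (hA a b)
    by_cases hab : a = b
    · subst hab
      have := key a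
      rw [two_mul (e a)] at this
      simpa using this
    · simpa [hab] using HasLead.zero
  have h2 : HasLead (fun η => ∏ a, (z * η ^ (2 * t) - lam a η)) (∑ a, 2 * e a)
      (∏ a, ((if e a = t then z else 0) - main a)) :=
    HasLead.prod _ fun a _ => (key a).sub (hlam a)
  rw [← Finset.mul_sum, two_mul (∑ a, e a)] at h2
  refine h1.unique (h2.congr ?_)
  filter_upwards [hdet] with η hη
  rw [hη]


/-! ### Analytic families of matrices -/

section Rellich

open scoped Matrix.Norms.Operator Matrix ContDiff

variable {m n : Type*} [Fintype m] [Fintype n]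

theorem analyticAt_matrix_of_entries {A : ℝ → Matrix m n ℝ} {x : ℝ}
    (h : ∀ i j, AnalyticAt ℝ (fun ε => A ε i j) x) : AnalyticAt ℝ A x := by
  classical
  have h1 : A = fun ε => ∑ i, ∑ j, A ε i j • Matrix.single i j (1 : ℝ) := by
    funext ε
    conv_lhs => rw [Matrix.matrix_eq_sum_single (A ε)]
    simp [Matrix.smul_single]
  rw [h1]
  refine Finset.univ.analyticAt_fun_sum fun i _ => Finset.univ.analyticAt_fun_sum fun j _ => ?_
  exact (h i j).smul analyticAt_const

theorem AnalyticAt.matrix_entry {A : ℝ → Matrix m n ℝ} {x : ℝ} (h : AnalyticAt ℝ A x) (i : m)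
    (j : n) : AnalyticAt ℝ (fun ε => A ε i j) x :=
  (LinearMap.toContinuousLinearMap (Matrix.entryLinearMap ℝ ℝ i j)).analyticAt _ |>.comp h

/-- The skew-symmetric matrix `[[0, -Xᵀ], [X, 0]]`. -/
def skewBlock (κ τ : Type*) : Matrix τ κ ℝ →ₗ[ℝ] Matrix (κ ⊕ τ) (κ ⊕ τ) ℝ where
  toFun X := Matrix.fromBlocks 0 (-Xᵀ) X 0
  map_add' X Y := by simp [Matrix.fromBlocks_add, add_comm]
  map_smul' c X := by simp [Matrix.fromBlocks_smul]

/-- Taking the lower left block, as a continuous linear map. -/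
noncomputable def toBlocks21CLM (κ τ : Type*) [Fintype κ] [Fintype τ] :
    Matrix (κ ⊕ τ) (κ ⊕ τ) ℝ →L[ℝ] Matrix τ κ ℝ :=
  LinearMap.toContinuousLinearMap
    { toFun := fun M => M.toBlocks₂₁
      map_add' := fun _ _ => rfl
      map_smul' := fun _ _ => rfl }

theorem toBlocks21CLM_apply {κ τ : Type*} [Fintype κ] [Fintype τ]
    (M : Matrix (κ ⊕ τ) (κ ⊕ τ) ℝ) (j : τ) (i : κ) :
    toBlocks21CLM κ τ M j i = M (Sum.inr j) (Sum.inl i) := rfl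

theorem skewBlock_apply {κ τ : Type*} (X : Matrix τ κ ℝ) :
    skewBlock κ τ X = Matrix.fromBlocks 0 (-Xᵀ) X 0 := rfl

variable {κ τ : Type*} [Fintype κ] [Fintype τ] [DecidableEq κ] [DecidableEq τ]

theorem exp_skewBlock_transpose (X : Matrix τ κ ℝ) :
    (NormedSpace.exp (skewBlock κ τ X))ᵀ = NormedSpace.exp (-(skewBlock κ τ X)) := by
  rw [← Matrix.exp_transpose]
  congr 1
  simp [skewBlock_apply, Matrix.fromBlocks_transpose, Matrix.fromBlocks_neg]

theorem exp_skewBlock_orthogonal (X : Matrix τ κ ℝ) :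
    (NormedSpace.exp (skewBlock κ τ X))ᵀ * NormedSpace.exp (skewBlock κ τ X) = 1 := by
  rw [exp_skewBlock_transpose, ← Matrix.exp_add_of_commute _ _ (Commute.refl (skewBlock κ τ X)).neg_left]
  simp

/-- An analytic family whose value at `0` is diagonal with disjoint spectra in the two blocks can be
made block lower-left-free by an analytic family of orthogonal matrices. -/
theorem exists_analytic_orthogonal_toBlocks21 (C : ℝ → Matrix (κ ⊕ τ) (κ ⊕ τ) ℝ)
    (hC : AnalyticAt ℝ C 0) (μ : κ → ℝ) (ν : τ → ℝ)
    (h0 : C 0 = Matrix.diagonal (Sum.elim μ ν)) (hne : ∀ i j, μ i ≠ ν j) :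
    ∃ U : ℝ → Matrix (κ ⊕ τ) (κ ⊕ τ) ℝ, AnalyticAt ℝ U 0 ∧ (∀ ε, (U ε)ᵀ * U ε = 1) ∧
      ∀ᶠ ε in 𝓝 0, ((U ε)ᵀ * C ε * U ε).toBlocks₂₁ = 0 := by
  let S : Matrix τ κ ℝ →L[ℝ] Matrix (κ ⊕ τ) (κ ⊕ τ) ℝ :=
    LinearMap.toContinuousLinearMap (skewBlock κ τ)
  -- The orthogonal matrices are sought as exponentials of skew blocks; the unknown block is found
  -- by the implicit function theorem from the vanishing of the lower left block.
  let F : ℝ × Matrix τ κ ℝ → Matrix τ κ ℝ := fun p =>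
    toBlocks21CLM κ τ (NormedSpace.exp (-(S p.2)) * C p.1 * NormedSpace.exp (S p.2))
  have hexp : ∀ x : Matrix (κ ⊕ τ) (κ ⊕ τ) ℝ, AnalyticAt ℝ NormedSpace.exp x :=
    NormedSpace.exp_analytic
  have hS : AnalyticAt ℝ (fun p : ℝ × Matrix τ κ ℝ => S p.2) (0, 0) :=
    (S.analyticAt _).comp analyticAt_snd
  have hF : AnalyticAt ℝ F (0, 0) := by
    refine ((toBlocks21CLM κ τ).analyticAt _).comp ?_
    refine AnalyticAt.mul (AnalyticAt.mul ?_ ?_) ?_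
    · exact (hexp _).comp hS.neg
    · exact AnalyticAt.fun_comp (g := C) (by simpa using hC) analyticAt_fst
    · exact (hexp _).comp hS
  have hcd : ContDiffAt ℝ ω F (0, 0) := hF.contDiffAt
  -- the partial derivative in the second variable
  have hpart : HasFDerivAt (fun X : Matrix τ κ ℝ => F (0, X))
      ((fderiv ℝ F (0, 0)) ∘L ContinuousLinearMap.inr ℝ ℝ (Matrix τ κ ℝ)) 0 := by
    have h1 : HasFDerivAt F (fderiv ℝ F (0, 0)) (0, 0) := hF.differentiableAt.hasFDerivAt
    exact h1.comp (0 : Matrix τ κ ℝ) (hasFDerivAt_prodMk_right (0 : ℝ) (0 : Matrix τ κ ℝ))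
  have hexp0 : HasFDerivAt (NormedSpace.exp : Matrix (κ ⊕ τ) (κ ⊕ τ) ℝ → _)
      (1 : Matrix (κ ⊕ τ) (κ ⊕ τ) ℝ →L[ℝ] _) 0 := hasStrictFDerivAt_exp_zero.hasFDerivAt
  have hS1 : HasFDerivAt (fun X => NormedSpace.exp (S X)) S 0 := by
    have : HasFDerivAt (NormedSpace.exp : Matrix (κ ⊕ τ) (κ ⊕ τ) ℝ → _)
      (1 : Matrix (κ ⊕ τ) (κ ⊕ τ) ℝ →L[ℝ] _) (S 0) := by simpa using hexp0
    exact this.comp (0 : Matrix τ κ ℝ) S.hasFDerivAt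
  have hS2 : HasFDerivAt (fun X => NormedSpace.exp (-(S X))) (-S) 0 := by
    have : HasFDerivAt (NormedSpace.exp : Matrix (κ ⊕ τ) (κ ⊕ τ) ℝ → _)
      (1 : Matrix (κ ⊕ τ) (κ ⊕ τ) ℝ →L[ℝ] _) (-(S 0)) := by simpa using hexp0
    exact this.comp (0 : Matrix τ κ ℝ) S.hasFDerivAt.neg
  have hpart2 := (toBlocks21CLM κ τ).hasFDerivAt.comp (0 : Matrix τ κ ℝ)
    ((hS2.mul_const' (C 0)).mul' hS1)
  have heq := hpart.unique hpart2
  -- The partial derivative at the origin is the lower left block of the commutator of `C 0` with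
  -- the skew block, a diagonal Sylvester operator. It is invertible because the two spectra are
  -- disjoint.
  have happ : ∀ X : Matrix τ κ ℝ, ∀ j i,
      ((fderiv ℝ F (0, 0)) ∘L ContinuousLinearMap.inr ℝ ℝ (Matrix τ κ ℝ)) X j i =
        (ν j - μ i) * X j i := by
    intro X j i
    rw [heq]
    change toBlocks21CLM κ τ (NormedSpace.exp (-(S 0)) * C 0 * skewBlock κ τ X +
      -(skewBlock κ τ X) * C 0 * NormedSpace.exp (S 0)) j i = _
    simp only [toBlocks21CLM_apply, h0, map_zero, neg_zero, NormedSpace.exp_zero, one_mul, mul_one,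
      skewBlock_apply, Matrix.add_apply, Matrix.neg_mul, Matrix.neg_apply, Matrix.mul_diagonal,
      Matrix.diagonal_mul, Matrix.fromBlocks_apply₂₁, Sum.elim_inl, Sum.elim_inr]
    ring
  have hinv : ((fderiv ℝ F (0, 0)) ∘L ContinuousLinearMap.inr ℝ ℝ (Matrix τ κ ℝ)).IsInvertible := by
    let g : Matrix τ κ ℝ →L[ℝ] Matrix τ κ ℝ := LinearMap.toContinuousLinearMap
      { toFun := fun X => Matrix.of fun j i => (ν j - μ i)⁻¹ * X j i
        map_add' := fun X Y => by ext; simp [mul_add]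
        map_smul' := fun c X => by ext; simp; ring }
    refine ContinuousLinearMap.IsInvertible.of_inverse (g := g) ?_ ?_
    · ext X j i
      have : ν j - μ i ≠ 0 := sub_ne_zero.2 (hne i j).symm
      rw [ContinuousLinearMap.comp_apply, happ]
      simp [g, this]
    · ext X j i
      have : ν j - μ i ≠ 0 := sub_ne_zero.2 (hne i j).symm
      exact (congrArg ((ν j - μ i)⁻¹ * ·) (happ X j i)).trans (inv_mul_cancel_left₀ this _)
  let ψ := hcd.implicitFunction (by simp) hinv
  have hψ : AnalyticAt ℝ ψ 0 := (hcd.contDiffAt_implicitFunction (by simp) hinv).analyticAt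
  have hψF : ∀ᶠ ε in 𝓝 (0 : ℝ), F (ε, ψ ε) = F (0, 0) :=
    hcd.eventually_apply_implicitFunction (by simp) hinv
  have hF0 : F (0, 0) = 0 := by
    ext j i
    simp [F, h0, toBlocks21CLM, Matrix.toBlocks₂₁]
  refine ⟨fun ε => NormedSpace.exp (skewBlock κ τ (ψ ε)), ?_, fun ε => exp_skewBlock_orthogonal _,
    ?_⟩
  · exact (hexp _).comp ((S.analyticAt _).comp hψ)
  · filter_upwards [hψF] with ε hε
    rw [exp_skewBlock_transpose]
    rw [hF0] at hε
    exact hε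

/-- `A` has, near `0`, an orthogonal diagonalization depending analytically on the parameter. -/
def AnalyticallyDiagonalizable {ι : Type*} [Fintype ι] [DecidableEq ι]
    (A : ℝ → Matrix ι ι ℝ) : Prop :=
  ∃ (U : ℝ → Matrix ι ι ℝ) (lam : ι → ℝ → ℝ), AnalyticAt ℝ U 0 ∧ (∀ k, AnalyticAt ℝ (lam k) 0) ∧
    (∀ᶠ ε in 𝓝 0, (U ε)ᵀ * U ε = 1) ∧
    ∀ᶠ ε in 𝓝 0, (U ε)ᵀ * A ε * U ε = Matrix.diagonal fun k => lam k ε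

namespace AnalyticallyDiagonalizable

variable {ι : Type*} [Fintype ι] [DecidableEq ι]

theorem conj {A V : ℝ → Matrix ι ι ℝ} (hV : AnalyticAt ℝ V 0)
    (hV1 : ∀ᶠ ε in 𝓝 0, (V ε)ᵀ * V ε = 1)
    (h : AnalyticallyDiagonalizable fun ε => (V ε)ᵀ * A ε * V ε) :
    AnalyticallyDiagonalizable A := by
  obtain ⟨U, lam, hU, hlam, h1, h2⟩ := h
  refine ⟨fun ε => V ε * U ε, lam, hV.mul hU, hlam, ?_, ?_⟩
  · filter_upwards [h1, hV1] with ε h1 h3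
    rw [Matrix.transpose_mul, Matrix.mul_assoc, ← Matrix.mul_assoc (V ε)ᵀ, h3, Matrix.one_mul, h1]
  · filter_upwards [h2] with ε h2
    rw [← h2, Matrix.transpose_mul]
    simp only [Matrix.mul_assoc]

theorem affine {A B : ℝ → Matrix ι ι ℝ} {τ g : ℝ → ℝ} (hτ : AnalyticAt ℝ τ 0)
    (hg : AnalyticAt ℝ g 0) (hA : ∀ᶠ ε in 𝓝 0, A ε = τ ε • 1 + g ε • B ε)
    (h : AnalyticallyDiagonalizable B) : AnalyticallyDiagonalizable A := by
  obtain ⟨U, lam, hU, hlam, h1, h2⟩ := h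
  refine ⟨U, fun k ε => τ ε + g ε * lam k ε, hU, fun k => hτ.add (hg.mul (hlam k)), h1, ?_⟩
  filter_upwards [h1, h2, hA] with ε h1 h2 hA
  rw [hA, Matrix.mul_add, Matrix.add_mul, Matrix.mul_smul, Matrix.smul_mul, Matrix.mul_one, h1,
    Matrix.mul_smul, Matrix.smul_mul, h2]
  ext i j
  by_cases hij : i = j
  · subst hij; simp
  · simp [hij]

theorem zero : AnalyticallyDiagonalizable fun _ => (0 : Matrix ι ι ℝ) :=
  ⟨fun _ => 1, fun _ _ => 0, analyticAt_const, fun _ => analyticAt_const, by simp, by simp⟩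

theorem reindex {ι' : Type*} [Fintype ι'] [DecidableEq ι'] (e : ι' ≃ ι) {A : ℝ → Matrix ι ι ℝ}
    (h : AnalyticallyDiagonalizable fun ε => (A ε).submatrix e e) :
    AnalyticallyDiagonalizable A := by
  obtain ⟨U, lam, hU, hlam, h1, h2⟩ := h
  refine ⟨fun ε => (U ε).submatrix e.symm e.symm, fun k => lam (e.symm k),
    analyticAt_matrix_of_entries fun i j => hU.matrix_entry _ _, fun k => hlam _, ?_, ?_⟩
  · filter_upwards [h1] with ε h1
    rw [Matrix.transpose_submatrix, Matrix.submatrix_mul_equiv, h1, Matrix.submatrix_one_equiv]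
  · filter_upwards [h2] with ε h2
    have h3 : A ε = ((A ε).submatrix e e).submatrix e.symm e.symm := by simp
    rw [h3, Matrix.transpose_submatrix, Matrix.submatrix_mul_equiv, Matrix.submatrix_mul_equiv, h2,
      Matrix.submatrix_diagonal_equiv]
    rfl

theorem fromBlocks {A : ℝ → Matrix κ κ ℝ} {D : ℝ → Matrix τ τ ℝ}
    (hA : AnalyticallyDiagonalizable A) (hD : AnalyticallyDiagonalizable D) :
    AnalyticallyDiagonalizable fun ε => Matrix.fromBlocks (A ε) 0 0 (D ε) := by
  obtain ⟨U, lam, hU, hlam, h1, h2⟩ := hA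
  obtain ⟨V, mu, hV, hmu, h3, h4⟩ := hD
  refine ⟨fun ε => Matrix.fromBlocks (U ε) 0 0 (V ε), Sum.elim lam mu, ?_, ?_, ?_, ?_⟩
  · refine analyticAt_matrix_of_entries ?_
    rintro (i | i) (j | j)
    · exact hU.matrix_entry i j
    · exact analyticAt_const
    · exact analyticAt_const
    · exact hV.matrix_entry i j
  · rintro (k | k)
    · exact hlam k
    · exact hmu k
  · filter_upwards [h1, h3] with ε h1 h3
    simp [Matrix.fromBlocks_transpose, Matrix.fromBlocks_multiply, h1, h3]
  · filter_upwards [h2, h4] with ε h2 h4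
    simp only [Matrix.fromBlocks_transpose, Matrix.fromBlocks_multiply, h2, h4, Matrix.mul_zero,
      Matrix.zero_mul, add_zero, zero_add, Matrix.transpose_zero, Matrix.fromBlocks_diagonal]
    congr 1
    funext k
    rcases k with k | k <;> rfl

theorem congr {A B : ℝ → Matrix ι ι ℝ} (hAB : A =ᶠ[𝓝 0] B) (h : AnalyticallyDiagonalizable A) :
    AnalyticallyDiagonalizable B := by
  refine affine (τ := fun _ => 0) (g := fun _ => 1) analyticAt_const analyticAt_const ?_ h
  filter_upwards [hAB] with ε hε
  simp [hε]

end AnalyticallyDiagonalizable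

/-- Cancelling `ε ^ k` is only possible off `0`; isolation of zeros recovers the value at `0`. -/
theorem AnalyticAt.eventually_eq_zero_of_pow_mul {h : ℝ → ℝ} (hh : AnalyticAt ℝ h 0) {k : ℕ}
    (h0 : ∀ᶠ ε in 𝓝 (0 : ℝ), ε ^ k * h ε = 0) : ∀ᶠ ε in 𝓝 (0 : ℝ), h ε = 0 := by
  refine hh.frequently_zero_iff_eventually_zero.1 (Eventually.frequently ?_)
  filter_upwards [h0.filter_mono nhdsWithin_le_nhds, self_mem_nhdsWithin] with ε h1 h2
  exact (mul_eq_zero.1 h1).resolve_left (pow_ne_zero _ h2)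

/-- A nonzero analytic family of matrices is `ε ^ k B(ε)` with `B` analytic, `B(0) ≠ 0`. -/
theorem exists_pow_smul_of_analyticAt {m n : Type*} [Fintype m] [Fintype n]
    {A : ℝ → Matrix m n ℝ} (hA : AnalyticAt ℝ A 0)
    (h0 : ¬ ∀ᶠ ε in 𝓝 0, A ε = 0) :
    ∃ (k : ℕ) (B : ℝ → Matrix m n ℝ), AnalyticAt ℝ B 0 ∧ B 0 ≠ 0 ∧
      ∀ᶠ ε in 𝓝 0, A ε = ε ^ k • B ε := by
  let o : m × n → ℕ∞ := fun p => analyticOrderAt (fun ε => A ε p.1 p.2) 0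
  have hent := fun i j => hA.matrix_entry i j
  have hne : ∃ p, o p ≠ ⊤ := by
    by_contra! h
    refine h0 ?_
    have : ∀ p : m × n, ∀ᶠ ε in 𝓝 (0 : ℝ), A ε p.1 p.2 = 0 := fun p =>
      analyticOrderAt_eq_top.1 (h p)
    filter_upwards [eventually_all.2 this] with ε hε
    ext i j
    exact hε (i, j)
  obtain ⟨p0, hp0⟩ := hne
  have : Nonempty (m × n) := ⟨p0⟩
  -- The exponent is the smallest order of vanishing among the entries; the entry attaining it stays
  -- nonzero at `0` after division.
  obtain ⟨q, hq⟩ := Finite.exists_min o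
  obtain ⟨k, hk⟩ := ENat.ne_top_iff_exists.1 (ne_top_of_le_ne_top hp0 (hq p0))
  have hg : ∀ i j, ∃ g : ℝ → ℝ, AnalyticAt ℝ g 0 ∧ (∀ᶠ ε in 𝓝 (0 : ℝ), A ε i j = ε ^ k * g ε) ∧
      (o (i, j) = k → g 0 ≠ 0) := by
    intro i j
    by_cases h : o (i, j) = k
    · obtain ⟨g, h1, h2, h3⟩ := (hent i j).analyticOrderAt_eq_natCast.1 h
      exact ⟨g, h1, by simpa using h3, fun _ => h2⟩
    · obtain ⟨g, h1, h3⟩ := (natCast_le_analyticOrderAt (hent i j)).1 (hk.le.trans (hq (i, j)))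
      exact ⟨g, h1, by simpa using h3, fun h' => absurd h' h⟩
  choose g hg1 hg2 hg3 using hg
  refine ⟨k, fun ε => Matrix.of fun i j => g i j ε, analyticAt_matrix_of_entries hg1, ?_, ?_⟩
  · intro h
    exact hg3 q.1 q.2 hk.symm (congrFun (congrFun h q.1) q.2)
  · filter_upwards [eventually_all.2 fun i => eventually_all.2 (hg2 i)] with ε hε
    ext i j
    simpa using hε i j

/-- One splitting step: a family that is not scalar at `0` reduces to smaller families. -/
theorem analyticallyDiagonalizable_of_not_scalar {ι : Type*} [Fintype ι] [DecidableEq ι]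
    (ih : ∀ (p : ι → Prop) [DecidablePred p], (∃ i, ¬ p i) →
      ∀ A : ℝ → Matrix {i // p i} {i // p i} ℝ, AnalyticAt ℝ A 0 →
        (∀ᶠ ε in 𝓝 0, (A ε)ᵀ = A ε) → AnalyticallyDiagonalizable A)
    {B : ℝ → Matrix ι ι ℝ} (hB : AnalyticAt ℝ B 0) (hsymm : ∀ᶠ ε in 𝓝 0, (B ε)ᵀ = B ε)
    (hns : ∀ c : ℝ, B 0 ≠ c • 1) : AnalyticallyDiagonalizable B := by
  have hB0 : (B 0).IsHermitian := by
    rw [Matrix.IsHermitian, Matrix.conjTranspose_eq_transpose_of_trivial]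
    exact hsymm.self_of_nhds
  set U0 : Matrix ι ι ℝ := hB0.eigenvectorUnitary.1 with hU0
  have hU0' : star U0 = U0ᵀ := Matrix.conjTranspose_eq_transpose_of_trivial U0
  have hUU : U0ᵀ * U0 = 1 := by
    rw [← hU0']; exact Unitary.coe_star_mul_self _
  have hUU' : U0 * U0ᵀ = 1 := by
    rw [← hU0']; exact Unitary.coe_mul_star_self _
  set μ := hB0.eigenvalues
  have hdiag : U0ᵀ * B 0 * U0 = Matrix.diagonal μ := by
    have := hB0.conjStarAlgAut_star_eigenvectorUnitary
    rw [Unitary.conjStarAlgAut_star_apply] at this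
    rw [← hU0']
    exact this
  have hB0' : B 0 = U0 * Matrix.diagonal μ * U0ᵀ := by
    rw [← hdiag]
    simp only [← Matrix.mul_assoc, hUU', Matrix.one_mul]
    rw [Matrix.mul_assoc, hUU', Matrix.mul_one]
  have hne : ∃ i0 i1, μ i1 ≠ μ i0 := by
    by_contra! h
    rcases isEmpty_or_nonempty ι with hι | ⟨⟨i0⟩⟩
    · exact hns 0 (by ext i; exact hι.elim i)
    · refine hns (μ i0) ?_
      have : Matrix.diagonal μ = μ i0 • (1 : Matrix ι ι ℝ) := by
        rw [← Matrix.diagonal_one, ← Matrix.diagonal_smul]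
        congr 1
        funext i
        simp [h i0 i]
      rw [hB0', this]
      simp [hUU']
  obtain ⟨i0, i1, hi⟩ := hne
  -- The basis is split into the eigenspace of one eigenvalue of `B 0` and the rest. Both parts are
  -- proper, so the induction hypothesis applies to each diagonal block.
  let p : ι → Prop := fun i => μ i = μ i0
  let e := Equiv.sumCompl p
  have hU0an : AnalyticAt ℝ (fun _ : ℝ => U0) 0 := analyticAt_const
  refine .conj hU0an (by simp [hUU]) (.reindex e ?_)
  set C : ℝ → Matrix ({i // p i} ⊕ {i // ¬ p i}) ({i // p i} ⊕ {i // ¬ p i}) ℝ :=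
    fun ε => (U0ᵀ * B ε * U0).submatrix e e with hCdef
  have hCan : AnalyticAt ℝ C 0 := by
    refine analyticAt_matrix_of_entries fun i j => ?_
    have : AnalyticAt ℝ (fun ε => U0ᵀ * B ε * U0) 0 :=
      (analyticAt_const.mul hB).mul analyticAt_const
    exact this.matrix_entry (e i) (e j)
  have hCsymm : ∀ᶠ ε in 𝓝 0, (C ε)ᵀ = C ε := by
    filter_upwards [hsymm] with ε hε
    simp [C, Matrix.transpose_mul, hε, Matrix.mul_assoc]
  have hC0 : C 0 = Matrix.diagonal (Sum.elim (fun i : {i // p i} => μ i)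
      fun j : {i // ¬ p i} => μ j) := by
    simp only [C, hdiag, Matrix.submatrix_diagonal_equiv]
    congr 1
    funext k
    rcases k with k | k <;> rfl
  obtain ⟨U, hU, hU1, hU2⟩ := exists_analytic_orthogonal_toBlocks21 C hCan _ _ hC0 (by
    rintro ⟨i, hi⟩ ⟨j, hj⟩ h
    exact hj (h.symm.trans hi))
  refine .conj hU (Eventually.of_forall hU1) ?_
  have hDan : AnalyticAt ℝ (fun ε => (U ε)ᵀ * C ε * U ε) 0 := by
    refine AnalyticAt.mul (AnalyticAt.mul ?_ hCan) hU
    exact analyticAt_matrix_of_entries fun i j => hU.matrix_entry j i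
  have hDsymm : ∀ᶠ ε in 𝓝 0, ((U ε)ᵀ * C ε * U ε)ᵀ = (U ε)ᵀ * C ε * U ε := by
    filter_upwards [hCsymm] with ε hε
    simp [Matrix.transpose_mul, hε, Matrix.mul_assoc]
  set D := fun ε => (U ε)ᵀ * C ε * U ε
  replace hDsymm : ∀ᶠ ε in 𝓝 0, (D ε)ᵀ = D ε := hDsymm
  replace hU2 : ∀ᶠ ε in 𝓝 0, (D ε).toBlocks₂₁ = 0 := hU2
  have h11 : AnalyticallyDiagonalizable fun ε => (D ε).toBlocks₁₁ := by
    refine ih p ⟨i1, hi⟩ _ (analyticAt_matrix_of_entries fun i j => hDan.matrix_entry _ _) ?_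
    filter_upwards [hDsymm] with ε hε
    conv_rhs => rw [← hε]
    rfl
  have h22 : AnalyticallyDiagonalizable fun ε => (D ε).toBlocks₂₂ := by
    refine ih (fun i => ¬ p i) ⟨i0, by simp [p]⟩ _
      (analyticAt_matrix_of_entries fun i j => hDan.matrix_entry _ _) ?_
    filter_upwards [hDsymm] with ε hε
    conv_rhs => rw [← hε]
    rfl
  refine (h11.fromBlocks h22).congr ?_
  filter_upwards [hDsymm, hU2] with ε h1 h2
  have h12 : (D ε).toBlocks₁₂ = 0 := by
    rw [← h1]
    have : ((D ε)ᵀ).toBlocks₁₂ = ((D ε).toBlocks₂₁)ᵀ := rfl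
    rw [this, h2, Matrix.transpose_zero]
  conv_rhs => rw [← Matrix.fromBlocks_toBlocks (D ε)]
  rw [h12, h2]

/-- **Rellich's theorem**: a real-analytic one-parameter family of symmetric matrices has an
orthogonal diagonalization depending analytically on the parameter. -/
theorem analyticallyDiagonalizable_of_symm : ∀ (m : ℕ) {ι : Type} [Fintype ι] [DecidableEq ι],
    Fintype.card ι = m → ∀ A : ℝ → Matrix ι ι ℝ, AnalyticAt ℝ A 0 →
      (∀ᶠ ε in 𝓝 0, (A ε)ᵀ = A ε) → AnalyticallyDiagonalizable A := by
  intro m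
  induction m using Nat.strong_induction_on with
  | _ m ih =>
  intro ι _ _ hcard A hA hsymm
  rcases isEmpty_or_nonempty ι with hι | hι
  · exact AnalyticallyDiagonalizable.zero.congr (Eventually.of_forall fun ε => by
      ext i; exact hι.elim i)
  have hcard0 : (Fintype.card ι : ℝ) ≠ 0 := by simp
  -- Removing the mean of the diagonal makes the family traceless, a property that survives division
  -- by `ε ^ k`. The quotient is then traceless and nonzero at `0`, hence not scalar there, and the
  -- splitting step applies.
  set τ' : ℝ → ℝ := fun ε => (Fintype.card ι : ℝ)⁻¹ * ∑ i, A ε i i with hτ'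
  have hτan : AnalyticAt ℝ τ' 0 :=
    analyticAt_const.mul (Finset.univ.analyticAt_fun_sum fun i _ => hA.matrix_entry i i)
  set A' : ℝ → Matrix ι ι ℝ := fun ε => A ε - τ' ε • 1 with hA'
  have hA'an : AnalyticAt ℝ A' 0 := hA.sub (hτan.smul analyticAt_const)
  have htr : ∀ ε, ∑ i, A' ε i i = 0 := by
    intro ε
    simp [A', τ', Finset.sum_sub_distrib]
  have hA'symm : ∀ᶠ ε in 𝓝 0, (A' ε)ᵀ = A' ε := by
    filter_upwards [hsymm] with ε hε
    simp [A', hε]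
  by_cases h0 : ∀ᶠ ε in 𝓝 0, A' ε = 0
  · refine .affine hτan (g := fun _ => 0) analyticAt_const ?_ .zero
    filter_upwards [h0] with ε hε
    simpa using sub_eq_zero.1 hε
  obtain ⟨k, B, hB, hB0, hAB⟩ := exists_pow_smul_of_analyticAt hA'an h0
  refine .affine hτan (g := fun ε => ε ^ k) (by fun_prop) (B := B) ?_ ?_
  · filter_upwards [hAB] with ε hε
    rw [← hε]
    simp [A']
  have hBsymm : ∀ᶠ ε in 𝓝 0, (B ε)ᵀ = B ε := by
    have : ∀ i j, ∀ᶠ ε in 𝓝 (0 : ℝ), B ε j i - B ε i j = 0 := by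
      intro i j
      refine ((hB.matrix_entry j i).sub (hB.matrix_entry i j)).eventually_eq_zero_of_pow_mul
        (k := k) ?_
      filter_upwards [hAB, hA'symm] with ε h1 h2
      rw [h1] at h2
      have := congrFun (congrFun h2 i) j
      simp only [Matrix.transpose_apply, Matrix.smul_apply, smul_eq_mul] at this
      simp only [Pi.sub_apply]
      linarith
    filter_upwards [eventually_all.2 fun i => eventually_all.2 (this i)] with ε hε
    ext i j
    exact sub_eq_zero.1 (hε i j)
  have hBtr : ∑ i, B 0 i i = 0 := by
    have h1 : AnalyticAt ℝ (fun ε => ∑ i, B ε i i) 0 :=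
      Finset.univ.analyticAt_fun_sum fun i _ => hB.matrix_entry i i
    refine (h1.eventually_eq_zero_of_pow_mul (k := k) ?_).self_of_nhds
    filter_upwards [hAB] with ε h1
    have := htr ε
    rw [h1] at this
    simpa [← Finset.mul_sum] using this
  refine analyticallyDiagonalizable_of_not_scalar ?_ hB hBsymm ?_
  · intro p _ hp A₁ hA₁ hs
    exact ih _ (hcard ▸ Fintype.card_subtype_lt hp.choose_spec) rfl A₁ hA₁ hs
  · intro c hc
    refine hB0 ?_
    rw [hc] at hBtr ⊢
    have : c = 0 := by simpa using hBtr
    simp [this]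

/-- A difference of analytic functions is identically zero near `0` or of the form `ε ^ k g(ε)` with
`g 0 ≠ 0`, and then has a constant sign on the right of `0`. -/
theorem AnalyticAt.eventually_le_or_eventually_lt {F G : ℝ → ℝ} (hF : AnalyticAt ℝ F 0)
    (hG : AnalyticAt ℝ G 0) :
    (∀ᶠ ε in 𝓝[>] (0 : ℝ), F ε ≤ G ε) ∨ ∀ᶠ ε in 𝓝[>] (0 : ℝ), G ε < F ε := by
  by_cases h0 : ∀ᶠ ε in 𝓝 (0 : ℝ), (F - G) ε = 0
  · left
    filter_upwards [h0.filter_mono nhdsWithin_le_nhds] with ε hε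
    exact (sub_eq_zero.1 hε).le
  obtain ⟨k, g, hg, hg0, h⟩ := (hF.sub hG).exists_eventuallyEq_pow_smul_nonzero_iff.2 h0
  rcases lt_or_gt_of_ne hg0 with hlt | hlt
  · left
    filter_upwards [h.filter_mono nhdsWithin_le_nhds, self_mem_nhdsWithin,
      (hg.continuousAt.eventually_lt_const hlt).filter_mono nhdsWithin_le_nhds] with ε h1 h2 h3
    have h4 : (ε - 0) ^ k * g ε ≤ 0 :=
      mul_nonpos_of_nonneg_of_nonpos (pow_nonneg (by simpa using le_of_lt h2) k) h3.le
    simp only [smul_eq_mul, Pi.sub_apply] at h1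
    linarith
  · right
    filter_upwards [h.filter_mono nhdsWithin_le_nhds, self_mem_nhdsWithin,
      (hg.continuousAt.eventually_const_lt hlt).filter_mono nhdsWithin_le_nhds] with ε h1 h2 h3
    have h4 : 0 < (ε - 0) ^ k * g ε := mul_pos (pow_pos (by simpa using h2) k) h3
    simp only [smul_eq_mul, Pi.sub_apply] at h1
    linarith

/-- Finitely many analytic functions can be put in decreasing order on the right of `0`. -/
theorem exists_perm_eventually_antitone {n : ℕ} {lam : Fin n → ℝ → ℝ}
    (h : ∀ k, AnalyticAt ℝ (lam k) 0) :
    ∃ σ : Equiv.Perm (Fin n), ∀ᶠ ε in 𝓝[>] (0 : ℝ), Antitone fun k => lam (σ k) ε := by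
  classical
  have h1 : ∀ᶠ ε in 𝓝[>] (0 : ℝ), ∀ i j, if ∀ᶠ ε in 𝓝[>] (0 : ℝ), lam i ε ≤ lam j ε then
      lam i ε ≤ lam j ε else lam j ε < lam i ε := by
    refine eventually_all.2 fun i => eventually_all.2 fun j => ?_
    by_cases hc : ∀ᶠ ε in 𝓝[>] (0 : ℝ), lam i ε ≤ lam j ε
    · simp only [hc, if_true]
    · simpa only [hc, if_false] using
        ((h i).eventually_le_or_eventually_lt (h j)).resolve_left hc
  obtain ⟨ε₀, hε₀⟩ := h1.exists
  -- Every pairwise comparison has a constant outcome near `0⁺`, so sorting at the single point `ε₀`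
  -- sorts at all small `ε > 0`.
  refine ⟨Tuple.sort fun k => - lam k ε₀, ?_⟩
  filter_upwards [h1] with ε hε k l hkl
  have h2 := Tuple.monotone_sort (fun k => - lam k ε₀) hkl
  simp only [Function.comp_apply, neg_le_neg_iff] at h2
  set σ := Tuple.sort fun k => - lam k ε₀
  have h3 := hε₀ (σ l) (σ k)
  have h4 := hε (σ l) (σ k)
  split_ifs at h3 h4 with hc
  · exact h4
  · exact absurd h2 (not_le.2 h3)

theorem exists_isAnalyticEVD {n : ℕ} {A : ℝ → Matrix (Fin n) (Fin n) ℝ}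
    (hA : ∀ i j, AnalyticAt ℝ (fun ε => A ε i j) 0) (hsymm : ∀ ε, (A ε)ᵀ = A ε) :
    ∃ lam P p, IsAnalyticEVD A lam P p := by
  obtain ⟨U, lam, hU, hlam, h1, h2⟩ := analyticallyDiagonalizable_of_symm n (Fintype.card_fin n) A
    (analyticAt_matrix_of_entries hA) (Eventually.of_forall hsymm)
  obtain ⟨σ, hσ⟩ := exists_perm_eventually_antitone hlam
  have hdot : ∀ᶠ ε in 𝓝 (0 : ℝ), ∀ k l, (U ε).col k ⬝ᵥ (U ε).col l = if k = l then 1 else 0 := by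
    filter_upwards [h1] with ε hε k l
    have := congrFun (congrFun hε k) l
    rw [Matrix.one_apply] at this
    exact this
  refine ⟨fun k => lam (σ k), fun k ε => Matrix.vecMulVec ((U ε).col (σ k)) ((U ε).col (σ k)),
    fun k => (U 0).col (σ k), fun k => hlam _, fun k i j => ?_, ?_, ?_, ?_, ?_, ?_, hσ,
    fun k => rfl⟩
  · exact (hU.matrix_entry i (σ k)).mul (hU.matrix_entry j (σ k))
  · exact Eventually.of_forall fun ε k => Matrix.transpose_vecMulVec _ _
  · filter_upwards [hdot] with ε hε k
    rw [Matrix.vecMulVec_mul_vecMulVec, hε]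
    simp
  · filter_upwards [hdot] with ε hε k
    refine le_antisymm (Matrix.rank_vecMulVec_le _ _) ?_
    rw [Nat.one_le_iff_ne_zero, Matrix.rank]
    intro h
    rw [Submodule.finrank_eq_zero, LinearMap.range_eq_bot] at h
    have h3 := congrArg (fun v => ((U ε).col (σ k)) ⬝ᵥ v)
      (LinearMap.congr_fun h ((U ε).col (σ k)))
    simp [Matrix.vecMulVec_mulVec, hε] at h3
  · filter_upwards [hdot] with ε hε k l hkl
    rw [Matrix.vecMulVec_mul_vecMulVec, hε, if_neg (σ.injective.ne hkl)]
    simp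
  · filter_upwards [h1, h2] with ε h1 h2
    have h1' := mul_eq_one_comm.1 h1
    have h3 : A ε = U ε * Matrix.diagonal (fun k => lam k ε) * (U ε)ᵀ := by
      rw [← h2]
      simp only [← Matrix.mul_assoc, h1', Matrix.one_mul]
      rw [Matrix.mul_assoc, h1', Matrix.mul_one]
    rw [Equiv.sum_comp σ fun k => lam k ε • Matrix.vecMulVec ((U ε).col k) ((U ε).col k), h3]
    ext i j
    rw [Matrix.mul_apply]
    simp [Matrix.sum_apply, Matrix.vecMulVec_apply, Matrix.mul_diagonal]
    exact Finset.sum_congr rfl fun k _ => by ring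

end Rellich


/-! ### Taylor expansions with big-O remainders -/

theorem isBigO_pow_succ_of_deriv {φ : ℝ → ℝ} {n : ℕ} (hd : ∀ᶠ t in 𝓝 (0 : ℝ), DifferentiableAt ℝ φ t)
    (h0 : φ 0 = 0) (h : deriv φ =O[𝓝 0] fun t : ℝ => t ^ n) :
    φ =O[𝓝 0] fun t : ℝ => t ^ (n + 1) := by
  obtain ⟨C, hC⟩ := h.bound
  obtain ⟨δ, hδ, hball⟩ := Metric.eventually_nhds_iff.1 (hd.and hC)
  refine IsBigO.of_bound C ?_
  filter_upwards [Metric.ball_mem_nhds (0 : ℝ) hδ] with t ht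
  have hsub : ∀ s ∈ segment ℝ 0 t, |s| ≤ |t| := by
    intro s hs
    rw [segment_eq_uIcc] at hs
    have := Set.abs_sub_left_of_mem_uIcc hs
    simpa using this
  have ht' : |t| < δ := by simpa using ht
  have h1 := Convex.norm_image_sub_le_of_norm_deriv_le (𝕜 := ℝ) (f := φ) (s := segment ℝ 0 t)
    (C := C * |t| ^ n) (x := 0) (y := t) (fun s hs => (hball (by
      rw [Real.dist_eq, sub_zero]; exact (hsub s hs).trans_lt ht')).1) (fun s hs => by
      refine (hball (y := s) (by
        rw [Real.dist_eq, sub_zero]; exact (hsub s hs).trans_lt ht')).2.trans ?_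
      have h2 := (hball (y := t) (by rw [Real.dist_eq, sub_zero]; exact ht')).2
      -- The constant of a big-O bound carries no sign; a negative one is only compatible with `t ^
      -- n = 0`.
      have hCn : 0 ≤ C ∨ t ^ n = 0 := by
        by_contra! hcon
        have := (norm_nonneg _).trans h2
        have h3 : 0 < ‖t ^ n‖ := norm_pos_iff.2 hcon.2
        nlinarith
      rw [norm_pow, Real.norm_eq_abs]
      rcases hCn with hCn | hCn
      · exact mul_le_mul_of_nonneg_left (pow_le_pow_left₀ (abs_nonneg _) (hsub s hs) n) hCn
      · have hz : t = 0 := eq_zero_of_pow_eq_zero hCn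
        have hs0 : s = 0 := by have := hsub s hs; rw [hz, abs_zero] at this; exact abs_nonpos_iff.1 this
        rw [hs0, hz])
    (convex_segment 0 t) (left_mem_segment ℝ 0 t) (right_mem_segment ℝ 0 t)
  rw [h0, sub_zero, sub_zero] at h1
  rw [norm_pow, Real.norm_eq_abs t, pow_succ, ← mul_assoc]
  exact h1

/-- Integrating the bound for the derivative gains one power at a time, starting from the
boundedness of a continuous function; hence `C^n` is enough for `O(t ^ n)`. -/
theorem isBigO_pow_of_iteratedDeriv_eq_zero {n : ℕ} : ∀ {φ : ℝ → ℝ}, ContDiffAt ℝ n φ 0 →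
    (∀ k < n, iteratedDeriv k φ 0 = 0) → φ =O[𝓝 0] fun t : ℝ => t ^ n := by
  induction n with
  | zero =>
    intro φ hφ _
    simpa using hφ.continuousAt.norm.isBoundedUnder_le.isBigO_one ℝ
  | succ n ih =>
    intro φ hφ h
    refine isBigO_pow_succ_of_deriv ?_ (by simpa using h 0 n.succ_pos) (ih ?_ fun k hk => ?_)
    · filter_upwards [hφ.eventually (by simp)] with t ht
      exact ht.differentiableAt (by simp)
    · exact hφ.derivWithin (by norm_cast)
    · rw [← iteratedDeriv_succ']
      exact h (k + 1) (by omega)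

theorem contDiffAt_iteratedDeriv {n : ℕ} {φ : ℝ → ℝ} {t : ℝ} (j : ℕ) (h : ContDiffAt ℝ (n + j : ℕ) φ t) :
    ContDiffAt ℝ n (iteratedDeriv j φ) t := by
  induction j generalizing φ with
  | zero => simpa using h
  | succ j ih =>
    rw [iteratedDeriv_succ']
    refine ih ?_
    exact h.derivWithin (by norm_cast)

theorem iteratedDeriv_iteratedDeriv (i j : ℕ) (φ : ℝ → ℝ) :
    iteratedDeriv i (iteratedDeriv j φ) = iteratedDeriv (i + j) φ := by
  simp only [iteratedDeriv_eq_iterate, Function.iterate_add_apply]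

/-- The Taylor polynomial of degree less than `n` of `f` at `0`. -/
noncomputable def taylorSum (f : ℝ → ℝ) (n : ℕ) (t : ℝ) : ℝ :=
  ∑ k ∈ Finset.range n, scaledDeriv f k * t ^ k

theorem contDiff_taylorSum (f : ℝ → ℝ) (n : ℕ) {m : WithTop ℕ∞} : ContDiff ℝ m (taylorSum f n) := by
  unfold taylorSum
  fun_prop

theorem iteratedDeriv_sub_taylorSum {f : ℝ → ℝ} {n m : ℕ} (hf : ContDiffAt ℝ m f 0) (hnm : n ≤ m + 1)
    {k : ℕ} (hk : k < n) : iteratedDeriv k (f - taylorSum f n) 0 = 0 := by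
  have hkm : (k : WithTop ℕ∞) ≤ m := by exact_mod_cast (by omega : k ≤ m)
  rw [iteratedDeriv_sub (hf.of_le hkm) (contDiff_taylorSum f n).contDiffAt]
  have h1 : iteratedDeriv k (taylorSum f n) 0 = iteratedDeriv k f 0 := by
    unfold taylorSum
    rw [iteratedDeriv_fun_sum (fun i _ => by fun_prop)]
    simp only [iteratedDeriv_const_mul_field, iteratedDeriv_fun_pow_zero]
    rw [Finset.sum_eq_single k]
    · simp only [if_true, scaledDeriv]
      field_simp
    · intro b _ hb
      simp [hb.symm]
    · intro h
      exact absurd (Finset.mem_range.2 hk) h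
  rw [h1, sub_self]

theorem sub_taylorSum_isBigO {f : ℝ → ℝ} {n : ℕ} (hf : ContDiffAt ℝ n f 0) :
    (f - taylorSum f n) =O[𝓝 0] fun t : ℝ => t ^ n :=
  isBigO_pow_of_iteratedDeriv_eq_zero (hf.sub (contDiff_taylorSum f n).contDiffAt) fun _ hk =>
    iteratedDeriv_sub_taylorSum hf (by omega) hk

namespace HasSmoothnessOrder

variable {f : ℝ → ℝ} {r : ℕ}

theorem contDiffAt (hf : HasSmoothnessOrder f r) : ContDiffAt ℝ (2 * r : ℕ) f 0 := by
  obtain ⟨a, ha, h⟩ := hf.contDiffOn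
  exact h.contDiffAt (Ioo_mem_nhds (by linarith) (by linarith))

/-- Having only even powers is what makes this Taylor sum, evaluated at `‖z‖`, a polynomial in the
coordinates of `z`. -/
theorem taylorSum_odd (hf : HasSmoothnessOrder f r) (t : ℝ) :
    taylorSum f (2 * r - 1) t = ∑ j ∈ Finset.range r, scaledDeriv f (2 * j) * t ^ (2 * j) := by
  have hr := hf.pos
  symm
  unfold taylorSum
  refine Finset.sum_of_injOn (fun j => 2 * j) (fun a _ b _ h => by simpa using h) ?_ ?_
    fun _ _ => rfl
  · intro j hj
    simp only [Finset.coe_range, Set.mem_Iio] at hj ⊢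
    omega
  · intro k hk hk2
    have hodd : ¬ Even k := fun ⟨j, hj⟩ => hk2 ⟨j, by
      simp only [Finset.mem_range, Finset.coe_range, Set.mem_Iio] at hk ⊢; omega, by
      simp only; omega⟩
    obtain ⟨j, hj⟩ := Nat.not_even_iff_odd.1 hodd
    have h1 := hf.odd_eq_zero (j + 1) (by omega) (by rw [Finset.mem_range] at hk; omega)
    have h2 : 2 * (j + 1) - 1 = k := by omega
    rw [h2] at h1
    simp [scaledDeriv, h1]

theorem taylorSum_even (hf : HasSmoothnessOrder f r) (t : ℝ) :
    taylorSum f (2 * r) t = ∑ j ∈ Finset.range r, scaledDeriv f (2 * j) * t ^ (2 * j) +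
      scaledDeriv f (2 * r - 1) * t ^ (2 * r - 1) := by
  have hr := hf.pos
  rw [← hf.taylorSum_odd]
  unfold taylorSum
  rw [← Finset.sum_range_succ]
  congr 2
  omega

end HasSmoothnessOrder


/-! ### Partial derivatives at the origin -/

section Partial

variable {d : ℕ}

theorem partialDeriv_congr {i : Fin d} {g h : EuclideanSpace ℝ (Fin d) → ℝ}
    {z : EuclideanSpace ℝ (Fin d)} (hgh : g =ᶠ[𝓝 z] h) :
    partialDeriv i g =ᶠ[𝓝 z] partialDeriv i h := by
  filter_upwards [hgh.eventuallyEq_nhds] with y hy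
  exact hy.lineDeriv_eq

theorem partialDeriv_const_mul (i : Fin d) (c : ℝ) (g : EuclideanSpace ℝ (Fin d) → ℝ) :
    partialDeriv i (fun z => c * g z) = fun z => c * partialDeriv i g z := by
  funext z
  simp only [partialDeriv, lineDeriv]
  exact deriv_const_mul_field c

/-- `u` vanishes at the origin together with its partial derivatives up to order `l`, with the
expected rates. -/
def Flat : ℕ → (EuclideanSpace ℝ (Fin d) → ℝ) → Prop
  | 0, u => u =O[𝓝 0] fun z => ‖z‖
  | l + 1, u => u =O[𝓝 0] (fun z => ‖z‖ ^ (l + 2)) ∧ (∀ᶠ z in 𝓝 0, DifferentiableAt ℝ u z) ∧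
      ∀ i, Flat l (partialDeriv i u)

namespace Flat

theorem congr : ∀ {l : ℕ} {u v : EuclideanSpace ℝ (Fin d) → ℝ}, Flat l u → u =ᶠ[𝓝 0] v → Flat l v
  | 0, _, _, hu, h => IsBigO.congr' hu h EventuallyEq.rfl
  | _ + 1, _, _, ⟨h1, h2, h3⟩, h => ⟨h1.congr' h EventuallyEq.rfl, by
      filter_upwards [h2, h.eventuallyEq_nhds] with z hz hz'
      exact hz.congr_of_eventuallyEq hz'.symm, fun i => (h3 i).congr (partialDeriv_congr h)⟩

theorem add : ∀ {l : ℕ} {u v : EuclideanSpace ℝ (Fin d) → ℝ}, Flat l u → Flat l v →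
    Flat l fun z => u z + v z
  | 0, _, _, hu, hv => IsBigO.add hu hv
  | l + 1, u, v, ⟨h1, h2, h3⟩, ⟨k1, k2, k3⟩ => ⟨h1.add k1, by
      filter_upwards [h2, k2] with z hz hz'
      exact hz.add hz', fun i => ((h3 i).add (k3 i)).congr (by
      filter_upwards [h2, k2] with z hz hz'
      exact ((hz.lineDifferentiableAt.hasLineDerivAt (v := EuclideanSpace.single i 1)).add
        hz'.lineDifferentiableAt.hasLineDerivAt).deriv.symm)⟩

theorem const_mul (c : ℝ) : ∀ {l : ℕ} {u : EuclideanSpace ℝ (Fin d) → ℝ}, Flat l u →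
    Flat l fun z => c * u z
  | 0, _, hu => IsBigO.const_mul_left hu c
  | l + 1, u, ⟨h1, h2, h3⟩ => ⟨h1.const_mul_left c, by
      filter_upwards [h2] with z hz
      exact hz.const_mul c, fun i => by
      rw [partialDeriv_const_mul]
      exact (h3 i).const_mul c⟩

theorem zero : ∀ {l : ℕ}, Flat l fun _ : EuclideanSpace ℝ (Fin d) => (0 : ℝ)
  | 0 => isBigO_zero _ _
  | l + 1 => ⟨isBigO_zero _ _, by simp, fun i => by
      have : partialDeriv i (fun _ : EuclideanSpace ℝ (Fin d) => (0 : ℝ)) = fun _ => 0 := by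
        funext z; exact (hasDerivAt_const (0 : ℝ) (0 : ℝ)).deriv
      rw [this]
      exact zero⟩

end Flat

/-- The value of a polynomial at a point of Euclidean space. -/
noncomputable def polyFun (p : MvPolynomial (Fin d) ℝ) (z : EuclideanSpace ℝ (Fin d)) : ℝ :=
  MvPolynomial.eval (fun i => z i) p

theorem polyFun_differentiable (p : MvPolynomial (Fin d) ℝ) : Differentiable ℝ (polyFun p) := by
  have h : polyFun p = fun z : EuclideanSpace ℝ (Fin d) =>
      ∑ m ∈ p.support, p.coeff m * ∏ i ∈ m.support, z i ^ m i := by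
    funext z
    exact MvPolynomial.eval_eq _ _
  rw [h]
  fun_prop

theorem polyFun_hasLineDerivAt (p : MvPolynomial (Fin d) ℝ) (z : EuclideanSpace ℝ (Fin d))
    (i : Fin d) : HasLineDerivAt ℝ (polyFun p) (polyFun (MvPolynomial.pderiv i p) z) z
      (EuclideanSpace.single i 1) := by
  unfold HasLineDerivAt
  induction p using MvPolynomial.induction_on with
  | C a => simpa [polyFun] using hasDerivAt_const (0 : ℝ) a
  | add p q hp hq => simpa [polyFun] using! hp.add hq
  | mul_X p j hp =>
    have hj : HasDerivAt (fun t : ℝ => (z + t • EuclideanSpace.single i (1 : ℝ)) j)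
        (if j = i then 1 else 0) 0 := by
      simp only [PiLp.add_apply, PiLp.smul_apply, PiLp.single_apply, smul_eq_mul]
      simpa using (hasDerivAt_mul_const (if j = i then (1 : ℝ) else 0)).const_add (z j)
    have hX : MvPolynomial.eval (fun k => z k) (MvPolynomial.pderiv i (MvPolynomial.X j)) =
        if j = i then (1 : ℝ) else 0 := by
      rw [MvPolynomial.pderiv_X, Pi.single_apply]
      split_ifs <;> simp_all
    have h := hp.mul hj
    simp only [polyFun, map_mul, MvPolynomial.eval_X, MvPolynomial.pderiv_mul, map_add, hX,
      zero_smul, add_zero] at h ⊢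
    exact h

theorem norm_hasLineDerivAt {z : EuclideanSpace ℝ (Fin d)} (hz : z ≠ 0) (i : Fin d) :
    HasLineDerivAt ℝ (fun z : EuclideanSpace ℝ (Fin d) => ‖z‖) (z i / ‖z‖) z
      (EuclideanSpace.single i 1) := by
  have h1 := ((hasStrictFDerivAt_norm_sq z).hasFDerivAt.hasLineDerivAt
    (EuclideanSpace.single i (1 : ℝ)))
  have h2 : HasDerivAt (fun t : ℝ => ‖z + t • EuclideanSpace.single i (1 : ℝ)‖ ^ 2) (2 * z i) 0 := by
    simpa [HasLineDerivAt, EuclideanSpace.inner_single_right] using h1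
  have h3 := h2.sqrt (by simpa using hz)
  have h4 : (fun t : ℝ => √(‖z + t • EuclideanSpace.single i (1 : ℝ)‖ ^ 2)) =
      fun t => ‖z + t • EuclideanSpace.single i (1 : ℝ)‖ := by
    funext t
    exact Real.sqrt_sq (norm_nonneg _)
  rw [h4] at h3
  refine HasDerivAt.congr_deriv (f := fun t : ℝ => ‖z + t • EuclideanSpace.single i (1 : ℝ)‖) h3 ?_
  rw [zero_smul, add_zero, Real.sqrt_sq (norm_nonneg _), mul_div_mul_left _ _ two_ne_zero]

theorem polyFun_isBigO {p : MvPolynomial (Fin d) ℝ} {q : ℕ} (hp : p.IsHomogeneous q) :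
    polyFun p =O[𝓝 0] fun z => ‖z‖ ^ q := by
  refine IsBigO.of_bound (∑ m ∈ p.support, |p.coeff m|) (Eventually.of_forall fun z => ?_)
  rw [polyFun, MvPolynomial.eval_eq, Finset.sum_mul]
  refine (norm_sum_le _ _).trans (Finset.sum_le_sum fun m hm => ?_)
  rw [norm_mul, Real.norm_eq_abs, norm_pow, norm_norm]
  refine mul_le_mul_of_nonneg_left ?_ (abs_nonneg _)
  have hm' : ∑ i, m i = q := by
    have := hp (MvPolynomial.mem_support_iff.1 hm)
    rw [Finsupp.weight_apply, Finsupp.sum_fintype _ _ (by simp)] at this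
    simpa using this
  rw [Finset.prod_subset (Finset.subset_univ m.support) (fun i _ hi => by
    rw [Finsupp.notMem_support_iff.1 hi, pow_zero]), norm_prod, ← hm', ← Finset.prod_pow_eq_pow_sum]
  refine Finset.prod_le_prod (fun _ _ => norm_nonneg _) fun i _ => ?_
  rw [norm_pow]
  exact pow_le_pow_left₀ (norm_nonneg _) (PiLp.norm_apply_le z i) _

/-- `φ(z) H(‖z‖) / ‖z‖ ^ k`. -/
noncomputable def radialTerm (φ : MvPolynomial (Fin d) ℝ) (H : ℝ → ℝ) (k : ℕ)
    (z : EuclideanSpace ℝ (Fin d)) : ℝ :=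
  polyFun φ z * H ‖z‖ * (‖z‖ ^ k)⁻¹

/-- The family of radial terms is closed under partial derivatives away from the origin. If `φ` is
homogeneous of degree `q` and `H` vanishes to order `a`, each of the three terms has the index `q +
a - k` lowered by one, which drives the induction in `flat_radialTerm`. -/
theorem radialTerm_hasLineDerivAt (φ : MvPolynomial (Fin d) ℝ) {H : ℝ → ℝ} {H' : ℝ} (k : ℕ)
    {z : EuclideanSpace ℝ (Fin d)} (hz : z ≠ 0) (hH : HasDerivAt H H' ‖z‖) (i : Fin d) :
    HasLineDerivAt ℝ (radialTerm φ H k)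
      (radialTerm (MvPolynomial.pderiv i φ) H k z +
        (radialTerm (MvPolynomial.X i * φ) (fun _ => H') (k + 1) z +
          (-k : ℝ) * radialTerm (MvPolynomial.X i * φ) H (k + 2) z)) z
      (EuclideanSpace.single i 1) := by
  have hz' : ‖z‖ ≠ 0 := norm_ne_zero_iff.2 hz
  have h1 : HasDerivAt _ _ _ := polyFun_hasLineDerivAt φ z i
  have h2 : HasDerivAt _ _ _ := norm_hasLineDerivAt hz i
  have h3 := HasDerivAt.comp (0 : ℝ) (h₂ := H) (h₂' := H') (by simpa using hH) h2
  have h4 := (h2.fun_pow k).inv (by simp [hz])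
  refine HasDerivAt.congr_deriv
    (f := fun t : ℝ => radialTerm φ H k (z + t • EuclideanSpace.single i (1 : ℝ)))
    ((h1.mul h3).mul h4) ?_
  simp only [radialTerm, polyFun, map_mul, MvPolynomial.eval_X, zero_smul, add_zero,
    Function.comp_apply, Pi.mul_apply]
  rcases k with _ | k
  · simp
    field_simp
  · simp only [Nat.add_sub_cancel]
    field_simp
    ring

theorem radialTerm_differentiableAt (φ : MvPolynomial (Fin d) ℝ) {H : ℝ → ℝ} (k : ℕ)
    {z : EuclideanSpace ℝ (Fin d)} (hz : z ≠ 0) (hH : DifferentiableAt ℝ H ‖z‖) :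
    DifferentiableAt ℝ (radialTerm φ H k) z := by
  have h2 : DifferentiableAt ℝ (fun z : EuclideanSpace ℝ (Fin d) => ‖z‖) z :=
    differentiableAt_id.norm ℝ hz
  refine (((polyFun_differentiable φ) z).mul (hH.comp z h2)).mul ?_
  exact (h2.fun_pow k).fun_inv (by simp [hz])

theorem radialTerm_isBigO {φ : MvPolynomial (Fin d) ℝ} {H : ℝ → ℝ} {q a k l : ℕ}
    (hφ : φ.IsHomogeneous q) (hH0 : H 0 = 0) (hH : H =O[𝓝 0] fun t : ℝ => t ^ a)
    (hk : k + l ≤ q + a) : radialTerm φ H k =O[𝓝 0] fun z => ‖z‖ ^ l := by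
  have hn : Tendsto (fun z : EuclideanSpace ℝ (Fin d) => ‖z‖) (𝓝 0) (𝓝 0) := by
    simpa using (continuous_norm (E := EuclideanSpace ℝ (Fin d))).tendsto 0
  have h1 := (polyFun_isBigO hφ).mul (hH.comp_tendsto hn)
  have h2 : (fun z : EuclideanSpace ℝ (Fin d) => ‖z‖ ^ (q + a)) =O[𝓝 0]
      fun z => ‖z‖ ^ (k + l) := (isBigO_pow_pow_nhds_zero hk).comp_tendsto hn
  have h3 : (fun z : EuclideanSpace ℝ (Fin d) => polyFun φ z * H ‖z‖) =O[𝓝 0]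
      fun z => ‖z‖ ^ (k + l) :=
    (h1.congr_right fun z => by simp [pow_add]).trans h2
  obtain ⟨C, hC0, hC⟩ := h3.exists_nonneg
  refine IsBigO.of_bound C ?_
  filter_upwards [hC.bound] with z hz
  -- At the origin the quotient is a default value, made harmless for every `k`, including `k = 0`,
  -- by `H 0 = 0`.
  by_cases h0 : z = 0
  · subst h0
    simp only [radialTerm, norm_zero, hH0, mul_zero, zero_mul]
    positivity
  · have hz' : 0 < ‖z‖ := norm_pos_iff.2 h0
    rw [radialTerm, norm_mul, norm_inv, norm_pow, norm_norm, norm_pow, norm_norm,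
      mul_inv_le_iff₀ (by positivity)]
    refine hz.trans_eq ?_
    rw [norm_pow, norm_norm, pow_add]
    ring

/-- Radial functions with vanishing derivatives are flat. -/
theorem flat_radialTerm {H : ℕ → ℝ → ℝ} {m : ℕ} (h0 : ∀ j < m, H j 0 = 0)
    (hO : ∀ j < m, H j =O[𝓝 0] fun t : ℝ => t ^ (m - j))
    (hd : ∀ j < m, ∀ᶠ t in 𝓝 (0 : ℝ), HasDerivAt (H j) (H (j + 1) t) t) :
    ∀ (l q j k : ℕ) (φ : MvPolynomial (Fin d) ℝ), φ.IsHomogeneous q → l + j < m →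
      k + (l + 1) ≤ q + (m - j) → Flat l (radialTerm φ (H j) k) := by
  have hn : Tendsto (fun z : EuclideanSpace ℝ (Fin d) => ‖z‖) (𝓝 0) (𝓝 0) := by
    simpa using (continuous_norm (E := EuclideanSpace ℝ (Fin d))).tendsto 0
  intro l
  induction l with
  | zero =>
    intro q j k φ hφ hj hk
    simpa [Flat] using radialTerm_isBigO (l := 1) hφ (h0 j (by omega)) (hO j (by omega)) hk
  | succ l ih =>
    intro q j k φ hφ hj hk
    have hO' := radialTerm_isBigO (l := l + 2) hφ (h0 j (by omega)) (hO j (by omega)) hk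
    have hzero : radialTerm φ (H j) k 0 = 0 := by simp [radialTerm, h0 j (by omega)]
    -- The product formula is not available at the origin; there the bound by `‖z‖ ^ (l + 2)` alone
    -- shows that the derivative exists and is zero.
    have hdz : HasFDerivAt (radialTerm φ (H j) k) (0 : EuclideanSpace ℝ (Fin d) →L[ℝ] ℝ) 0 := by
      rw [hasFDerivAt_iff_isLittleO_nhds_zero]
      simp only [zero_add, hzero, sub_zero, zero_apply]
      refine hO'.trans_isLittleO ?_
      refine (((isLittleO_pow_pow (𝕜 := ℝ) (by omega : 1 < l + 2)).comp_tendsto hn).congr_right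
        (g₂ := fun z => ‖z‖) (fun z => by simp)).of_norm_right
    refine ⟨hO', ?_, fun i => ?_⟩
    · filter_upwards [hn.eventually (hd j (by omega))] with z hz
      by_cases hz0 : z = 0
      · rw [hz0]; exact hdz.differentiableAt
      · exact radialTerm_differentiableAt φ k hz0 hz.differentiableAt
    · have hA : Flat l (radialTerm (MvPolynomial.pderiv i φ) (H j) k) := by
        -- For constant `φ` the derivative is zero and no degree `q - 1` exists, so this case cannot
        -- use the count of exponents.
        rcases q with _ | q
        · have : MvPolynomial.pderiv i φ = 0 := by
            rw [← MvPolynomial.totalDegree_zero_iff_isHomogeneous,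
              MvPolynomial.totalDegree_eq_zero_iff_eq_C] at hφ
            rw [hφ, MvPolynomial.pderiv_C]
          rw [this]
          refine Flat.zero.congr (Eventually.of_forall fun z => ?_)
          simp [radialTerm, polyFun]
        · exact ih q j k _ hφ.pderiv (by omega) (by omega)
      have hX : (MvPolynomial.X i * φ).IsHomogeneous (1 + q) := (MvPolynomial.isHomogeneous_X ℝ i).mul hφ
      have hB := ih (1 + q) (j + 1) (k + 1) _ hX (by omega) (by omega)
      have hC := ih (1 + q) j (k + 2) _ hX (by omega) (by omega)
      refine (hA.add (hB.add (hC.const_mul (-k : ℝ)))).congr ?_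
      filter_upwards [hn.eventually (hd j (by omega))] with z hz
      by_cases hz0 : z = 0
      · subst hz0
        have : partialDeriv i (radialTerm φ (H j) k) 0 = 0 := (hdz.hasLineDerivAt _).lineDeriv
        rw [this]
        simp [radialTerm, h0 j (by omega), h0 (j + 1) (by omega)]
      · exact (radialTerm_hasLineDerivAt φ k hz0 hz i).lineDeriv.symm

end Partial


/-! ### The Wronskian of a radial kernel -/

section Wronskian

variable {d : ℕ}

/-- `g` agrees with the polynomial `p` at the origin up to order `l`. -/
def PolyApprox (l : ℕ) (g : EuclideanSpace ℝ (Fin d) → ℝ) (p : MvPolynomial (Fin d) ℝ) : Prop :=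
  Flat l fun z => g z - polyFun p z

namespace PolyApprox

theorem partialDeriv {l : ℕ} {g : EuclideanSpace ℝ (Fin d) → ℝ} {p : MvPolynomial (Fin d) ℝ}
    (h : PolyApprox (l + 1) g p) (i : Fin d) :
    PolyApprox l (partialDeriv i g) (MvPolynomial.pderiv i p) := by
  obtain ⟨-, h2, h3⟩ := h
  refine (h3 i).congr ?_
  filter_upwards [h2] with z hz
  have hp := polyFun_hasLineDerivAt p z i
  have h1 : LineDifferentiableAt ℝ g z (EuclideanSpace.single i 1) := by
    have := (hz.add (polyFun_differentiable p z)).lineDifferentiableAt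
      (v := EuclideanSpace.single i (1 : ℝ))
    simpa [Pi.add_def] using! this
  exact (HasDerivAt.sub h1.hasLineDerivAt hp).deriv

theorem iterate {g : EuclideanSpace ℝ (Fin d) → ℝ} {p : MvPolynomial (Fin d) ℝ} (i : Fin d)
    {l : ℕ} (a : ℕ) (h : PolyApprox (l + a) g p) :
    PolyApprox l ((_root_.partialDeriv i)^[a] g) ((MvPolynomial.pderiv i)^[a] p) := by
  induction a generalizing l with
  | zero => exact h
  | succ a ih =>
    rw [Function.iterate_succ_apply', Function.iterate_succ_apply']
    exact (ih (l := l + 1) (by rwa [Nat.add_right_comm, Nat.add_assoc])).partialDeriv i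

theorem foldr {g : EuclideanSpace ℝ (Fin d) → ℝ} {p : MvPolynomial (Fin d) ℝ} (α : Fin d → ℕ)
    (L : List (Fin d)) {l : ℕ} (h : PolyApprox (l + (L.map α).sum) g p) :
    PolyApprox l (L.foldr (fun i h => (_root_.partialDeriv i)^[α i] h) g)
      (L.foldr (fun i q => (MvPolynomial.pderiv i)^[α i] q) p) := by
  induction L generalizing l with
  | nil => exact h
  | cons i L ih =>
    refine iterate i (α i) (ih ?_)
    simpa [add_assoc] using h

end PolyApprox

/-- The iterated partial derivative of a polynomial. -/
noncomputable def polyMixedPartial (α : Fin d → ℕ) (p : MvPolynomial (Fin d) ℝ) :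
    MvPolynomial (Fin d) ℝ :=
  (List.finRange d).foldr (fun i q => (MvPolynomial.pderiv i)^[α i] q) p

theorem PolyApprox.mixedPartial {g : EuclideanSpace ℝ (Fin d) → ℝ} {p : MvPolynomial (Fin d) ℝ}
    (α : Fin d → ℕ) {l : ℕ} (h : PolyApprox (l + ∑ i, α i) g p) :
    PolyApprox l (mixedPartial α g) (polyMixedPartial α p) := by
  refine PolyApprox.foldr α _ ?_
  rwa [← Fin.sum_univ_def]

theorem Flat.apply_zero {l : ℕ} {u : EuclideanSpace ℝ (Fin d) → ℝ} (h : Flat l u) : u 0 = 0 := by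
  rcases l with _ | l
  · exact (show _ =O[_] _ from h).eq_zero_imp.self_of_nhds (by simp)
  · exact h.1.eq_zero_imp.self_of_nhds (by simp)

theorem PolyApprox.apply_zero {l : ℕ} {g : EuclideanSpace ℝ (Fin d) → ℝ}
    {p : MvPolynomial (Fin d) ℝ} (h : PolyApprox l g p) : g 0 = p.coeff 0 := by
  have h1 := Flat.apply_zero h
  rw [sub_eq_zero] at h1
  rw [h1, polyFun, ← MvPolynomial.constantCoeff_eq]
  have : (fun i => (0 : EuclideanSpace ℝ (Fin d)) i) = (0 : Fin d → ℝ) := rfl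
  rw [this, MvPolynomial.eval_zero]

theorem coeff_iterate_pderiv (i : Fin d) (a : ℕ) (p : MvPolynomial (Fin d) ℝ) (m : Fin d →₀ ℕ) :
    ((MvPolynomial.pderiv i)^[a] p).coeff m =
      p.coeff (m + Finsupp.single i a) * ((m i + 1).ascFactorial a : ℕ) := by
  induction a generalizing m with
  | zero => simp
  | succ a ih =>
    rw [Function.iterate_succ_apply', MvPolynomial.coeff_pderiv, ih]
    have h1 : (m + Finsupp.single i 1) + Finsupp.single i a = m + Finsupp.single i (a + 1) := by
      rw [add_assoc, ← Finsupp.single_add, add_comm 1 a]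
    have h2 := Nat.succ_ascFactorial (m i + 1) a
    rw [← Nat.ascFactorial_succ] at h2
    rw [h1, ← h2]
    simp only [Finsupp.add_apply, Finsupp.single_eq_same]
    push_cast
    ring

theorem coeff_foldr_pderiv (α : Fin d → ℕ) (p : MvPolynomial (Fin d) ℝ) (L : List (Fin d))
    (hL : L.Nodup) (m : Fin d →₀ ℕ) :
    (L.foldr (fun i q => (MvPolynomial.pderiv i)^[α i] q) p).coeff m =
      p.coeff (m + (L.map fun i => Finsupp.single i (α i)).sum) *
        (L.map fun i => ((m i + 1).ascFactorial (α i) : ℝ)).prod := by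
  induction L generalizing m with
  | nil => simp
  | cons i L ih =>
    rw [List.nodup_cons] at hL
    rw [List.foldr_cons, coeff_iterate_pderiv, ih hL.2]
    have h1 : (L.map fun j => (((m + Finsupp.single i (α i)) j + 1).ascFactorial (α j) : ℝ)) =
        L.map fun j => ((m j + 1).ascFactorial (α j) : ℝ) := by
      refine List.map_congr_left fun j hj => ?_
      have : i ≠ j := fun h => hL.1 (h ▸ hj)
      simp [this]
    rw [h1]
    simp only [List.map_cons, List.sum_cons, List.prod_cons, add_assoc]
    ring

/-- A multi-index as a finitely supported function. -/
noncomputable def toFinsupp (α : Fin d → ℕ) : Fin d →₀ ℕ := Finsupp.equivFunOnFinite.symm α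

theorem coeff_polyMixedPartial (α : Fin d → ℕ) (p : MvPolynomial (Fin d) ℝ) (m : Fin d →₀ ℕ) :
    (polyMixedPartial α p).coeff m =
      p.coeff (m + toFinsupp α) * ∏ i, ((m i + 1).ascFactorial (α i) : ℝ) := by
  rw [polyMixedPartial, coeff_foldr_pderiv α p _ (List.nodup_finRange d), ← Fin.sum_univ_def,
    ← Fin.prod_univ_def]
  congr 3
  ext j
  simp [toFinsupp, Finsupp.finsetSum_apply, Finsupp.single_apply]

theorem partialDeriv_comp_sub (x : EuclideanSpace ℝ (Fin d)) (i : Fin d)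
    (g : EuclideanSpace ℝ (Fin d) → ℝ) (c : ℝ) :
    partialDeriv i (fun y => c * g (x - y)) = fun y => (-c) * partialDeriv i g (x - y) := by
  rw [partialDeriv_const_mul]
  funext y
  have h : partialDeriv i (fun y => g (x - y)) y = - partialDeriv i g (x - y) := by
    simp only [partialDeriv, lineDeriv]
    have := deriv_comp_neg (fun t : ℝ => g (x - y + t • EuclideanSpace.single i (1 : ℝ))) 0
    rw [neg_zero] at this
    rw [← this]
    congr 1
    funext t
    congr 1
    simp only [neg_smul]
    abel
  rw [h]
  ring

theorem mixedPartial_comp_sub (x : EuclideanSpace ℝ (Fin d)) (β : Fin d → ℕ)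
    (g : EuclideanSpace ℝ (Fin d) → ℝ) :
    mixedPartial β (fun y => g (x - y)) =
      fun y => (-1) ^ (∑ i, β i) * mixedPartial β g (x - y) := by
  have hit : ∀ (i : Fin d) (a : ℕ) (c : ℝ) (g : EuclideanSpace ℝ (Fin d) → ℝ),
      (partialDeriv i)^[a] (fun y => c * g (x - y)) =
        fun y => (c * (-1) ^ a) * (partialDeriv i)^[a] g (x - y) := by
    intro i a c g
    induction a with
    | zero => simp
    | succ a ih =>
      rw [Function.iterate_succ_apply', ih, partialDeriv_comp_sub, Function.iterate_succ_apply']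
      funext y
      ring
  have hl : ∀ L : List (Fin d),
      L.foldr (fun i h => (partialDeriv i)^[β i] h) (fun y => g (x - y)) =
        fun y => (-1) ^ (L.map β).sum *
          L.foldr (fun i h => (partialDeriv i)^[β i] h) g (x - y) := by
    intro L
    induction L with
    | nil => simp
    | cons i L ih =>
      rw [List.foldr_cons, ih, hit]
      funext y
      simp only [List.map_cons, List.sum_cons, List.foldr_cons, pow_add]
      ring
  have := hl (List.finRange d)
  rwa [← Fin.sum_univ_def] at this

theorem mixedPartial_const_mul (α : Fin d → ℕ) (c : ℝ) (g : EuclideanSpace ℝ (Fin d) → ℝ) :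
    mixedPartial α (fun z => c * g z) = fun z => c * mixedPartial α g z := by
  have hit : ∀ (i : Fin d) (a : ℕ) (g : EuclideanSpace ℝ (Fin d) → ℝ),
      (partialDeriv i)^[a] (fun y => c * g y) = fun y => c * (partialDeriv i)^[a] g y := by
    intro i a g
    induction a with
    | zero => rfl
    | succ a ih =>
      rw [Function.iterate_succ_apply', ih, partialDeriv_const_mul, Function.iterate_succ_apply']
  unfold mixedPartial
  induction List.finRange d with
  | nil => rfl
  | cons i L ih => rw [List.foldr_cons, ih, hit]; rfl

/-- The kernel depends on `x - y` only, so derivatives in `y` are derivatives in `x` up to one sign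
each, and everything reduces to one function at the origin. -/
theorem kernelDeriv_radialKernel (f : ℝ → ℝ) (α β : Fin d → ℕ) :
    kernelDeriv (radialKernel d f) α β 0 0 =
      (-1) ^ (∑ i, β i) * mixedPartial α (mixedPartial β fun z => f ‖z‖) 0 := by
  unfold kernelDeriv
  have : (fun x' : EuclideanSpace ℝ (Fin d) => mixedPartial β (radialKernel d f x') 0) =
      fun x' => (-1) ^ (∑ i, β i) * mixedPartial β (fun z => f ‖z‖) x' := by
    funext x'
    have := congrFun (mixedPartial_comp_sub x' β fun z => f ‖z‖) 0
    rw [sub_zero] at this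
    exact this
  rw [this, mixedPartial_const_mul]

/-- The even Taylor polynomial `∑_{j<r} f_{2j} ‖z‖ ^ (2j)` of a radial function. -/
noncomputable def radialPoly (d : ℕ) (f : ℝ → ℝ) (r : ℕ) : MvPolynomial (Fin d) ℝ :=
  ∑ j ∈ Finset.range r, MvPolynomial.C (scaledDeriv f (2 * j)) * (∑ i, MvPolynomial.X i ^ 2) ^ j

theorem polyFun_radialPoly (f : ℝ → ℝ) (r : ℕ) (z : EuclideanSpace ℝ (Fin d)) :
    polyFun (radialPoly d f r) z = ∑ j ∈ Finset.range r, scaledDeriv f (2 * j) * ‖z‖ ^ (2 * j) := by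
  have : ‖z‖ ^ 2 = ∑ i, z i ^ 2 := by
    rw [EuclideanSpace.norm_sq_eq]
    simp
  simp [polyFun, radialPoly, pow_mul, this]

/-- The remainder of `f` after degree `2r - 2` vanishes to order `2r - 1`; composed with the norm it
is the radial term with `φ = 1`, `k = 0`, and thus flat up to order `2r - 2`. -/
theorem polyApprox_radialPoly {f : ℝ → ℝ} {r : ℕ} (hf : HasSmoothnessOrder f r) :
    PolyApprox (2 * r - 2) (fun z : EuclideanSpace ℝ (Fin d) => f ‖z‖) (radialPoly d f r) := by
  have hr := hf.pos
  set m := 2 * r - 1 with hm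
  set h : ℝ → ℝ := f - taylorSum f m with hh
  have hcd : ContDiffAt ℝ (m + 1 : ℕ) h 0 := by
    have := hf.contDiffAt.sub (contDiff_taylorSum f m).contDiffAt
    convert! this using 2
    omega
  have hd : ∀ k < m, iteratedDeriv k h 0 = 0 := fun k hk =>
    iteratedDeriv_sub_taylorSum (m := m) (hf.contDiffAt.of_le (by
      exact_mod_cast (by omega : m ≤ 2 * r))) (by omega) hk
  have hcdj : ∀ j < m, ContDiffAt ℝ (m + 1 - j : ℕ) (iteratedDeriv j h) 0 := fun j hj =>
    contDiffAt_iteratedDeriv j (by rwa [Nat.sub_add_cancel (by omega)])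
  have key := flat_radialTerm (d := d) (H := fun j => iteratedDeriv j h) (m := m) hd
    (fun j hj => isBigO_pow_of_iteratedDeriv_eq_zero
      ((hcdj j hj).of_le (by exact_mod_cast (by omega : m - j ≤ m + 1 - j))) (fun k hk => by
        rw [iteratedDeriv_iteratedDeriv]; exact hd _ (by omega)))
    (fun j hj => by
      filter_upwards [(hcdj j hj).eventually (by simp)] with t ht
      rw [iteratedDeriv_succ]
      exact (ht.differentiableAt (by norm_cast; omega)).hasDerivAt)
    (2 * r - 2) 0 0 0 1 (MvPolynomial.isHomogeneous_one _ _) (by omega) (by omega)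
  refine key.congr (Eventually.of_forall fun z => ?_)
  simp only [radialTerm, polyFun_radialPoly, ← hf.taylorSum_odd]
  simp [polyFun, h, m]

/-- The entries of the Wronskian, and of its extension to all multi-indices by the coefficients of
the Taylor polynomial. -/
noncomputable def wronskianCoeff (f : ℝ → ℝ) (r : ℕ) (α β : Fin d → ℕ) : ℝ :=
  (-1) ^ (∑ i, β i) * (∏ i, ((α i + β i).choose (α i) : ℝ)) *
    (radialPoly d f r).coeff (toFinsupp (α + β))

/-- Within this range of degrees the derivatives of `f ‖·‖` at the origin are those of its Taylor
polynomial. The range contains all pairs of multi-indices of degree at most `r - 1`. -/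
theorem wronskianBlock_apply {f : ℝ → ℝ} {r : ℕ} (hf : HasSmoothnessOrder f r)
    {A B : Finset (Fin d → ℕ)} (α : A) (β : B)
    (h : ∑ i, α.1 i + ∑ i, β.1 i ≤ 2 * r - 2) :
    wronskianBlock (radialKernel d f) A B α β = wronskianCoeff f r α.1 β.1 := by
  obtain ⟨α, hα⟩ := α
  obtain ⟨β, hβ⟩ := β
  simp only at h
  obtain ⟨c, hc⟩ := Nat.exists_eq_add_of_le h
  have h1 := polyApprox_radialPoly (d := d) hf
  have h2 : PolyApprox c (mixedPartial α (mixedPartial β fun z => f ‖z‖))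
      (polyMixedPartial α (polyMixedPartial β (radialPoly d f r))) := by
    refine PolyApprox.mixedPartial α (PolyApprox.mixedPartial β ?_)
    rwa [add_assoc, add_comm, ← hc]
  have h3 := h2.apply_zero
  rw [coeff_polyMixedPartial, coeff_polyMixedPartial] at h3
  simp only [wronskianBlock, Matrix.of_apply, kernelDeriv_radialKernel, wronskianCoeff, h3]
  have hfin : (0 : Fin d →₀ ℕ) + toFinsupp α + toFinsupp β = toFinsupp (α + β) := by
    ext i; simp [toFinsupp]
  rw [hfin, ← Finset.prod_mul_distrib, mul_assoc, mul_assoc, mul_div_assoc]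
  rw [mul_comm (∏ i, ((α i + β i).choose (α i) : ℝ)), mul_div_assoc]
  congr 2
  rw [← Finset.prod_mul_distrib, ← Finset.prod_div_distrib]
  refine Finset.prod_congr rfl fun i _ => ?_
  rw [div_eq_iff (by positivity)]
  have e1 := Nat.add_choose_mul_factorial_mul_factorial (α i) (β i)
  have e2 := Nat.factorial_mul_ascFactorial (α i) (β i)
  have e3 := Nat.factorial_mul_ascFactorial 0 (α i)
  simp only [Nat.factorial_zero, one_mul, zero_add] at e3
  rw [← Nat.choose_symm_add] at e1
  -- The rising factorials produced by differentiating monomials, divided by `α! β!`, are binomial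
  -- coefficients.
  have e4 : (α i + 1).ascFactorial (β i) = (α i + β i).choose (α i) * (β i).factorial :=
    Nat.eq_of_mul_eq_mul_left (Nat.factorial_pos (α i)) (by rw [e2, ← e1]; ring)
  have e5 : (0 + toFinsupp α) i = α i := by simp [toFinsupp]
  rw [e5, e4, Finsupp.coe_zero, Pi.zero_apply, zero_add, e3]
  push_cast
  ring

theorem radialPoly_coeff_eq_zero (f : ℝ → ℝ) (r : ℕ) {γ : Fin d → ℕ} (hγ : 2 * r - 2 < ∑ i, γ i) :
    (radialPoly d f r).coeff (toFinsupp γ) = 0 := by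
  refine MvPolynomial.coeff_eq_zero_of_totalDegree_lt (lt_of_le_of_lt ?_ (hγ.trans_eq ?_))
  · refine MvPolynomial.totalDegree_finsetSum_le fun j hj => ?_
    rw [Finset.mem_range] at hj
    refine (MvPolynomial.totalDegree_mul _ _).trans ?_
    rw [MvPolynomial.totalDegree_C, zero_add]
    refine (MvPolynomial.totalDegree_pow _ _).trans ?_
    have : (∑ i : Fin d, (MvPolynomial.X i : MvPolynomial (Fin d) ℝ) ^ 2).totalDegree ≤ 2 := by
      refine MvPolynomial.totalDegree_finsetSum_le fun i _ => ?_
      exact (MvPolynomial.totalDegree_pow _ _).trans (by simp)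
    calc j * _ ≤ j * 2 := Nat.mul_le_mul_left j this
      _ ≤ 2 * r - 2 := by omega
  · symm
    exact Finset.sum_subset (Finset.subset_univ _) fun i _ hi => by simpa [toFinsupp] using hi

theorem polyFun_radialPoly_eq_sum (f : ℝ → ℝ) (r : ℕ) (z : EuclideanSpace ℝ (Fin d)) :
    polyFun (radialPoly d f r) z = ∑ γ ∈ multiIdxLE d (2 * r - 2),
      (radialPoly d f r).coeff (toFinsupp γ) * ∏ i, z i ^ γ i := by
  rw [polyFun, MvPolynomial.eval_eq']
  symm
  have h1 : ∑ γ ∈ multiIdxLE d (2 * r - 2),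
      (radialPoly d f r).coeff (toFinsupp γ) * ∏ i, z i ^ γ i =
      ∑ m ∈ (multiIdxLE d (2 * r - 2)).map Finsupp.equivFunOnFinite.symm.toEmbedding,
      (radialPoly d f r).coeff m * ∏ i, z i ^ m i := by
    rw [Finset.sum_map]
    rfl
  rw [h1]
  symm
  refine Finset.sum_subset (fun m hm => ?_) fun m _ hm => ?_
  · rw [Finset.mem_map]
    refine ⟨m, ?_, by simp⟩
    rw [mem_multiIdxLE]
    by_contra! hcon
    refine MvPolynomial.mem_support_iff.1 hm ?_
    have := radialPoly_coeff_eq_zero f r hcon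
    convert this
    ext i
    simp [toFinsupp]
  · rw [MvPolynomial.notMem_support_iff.1 hm, zero_mul]

/-- The binomial theorem for multi-indices. -/
theorem prod_sub_pow (a b : Fin d → ℝ) (γ : Fin d → ℕ) :
    ∏ i, (a i - b i) ^ γ i = ∑ q ∈ Fintype.piFinset fun i => Finset.HasAntidiagonal.antidiagonal (γ i),
      ∏ i, (((γ i).choose (q i).1 : ℝ) * (a i ^ (q i).1 * (-b i) ^ (q i).2)) := by
  rw [← Finset.prod_univ_sum (fun i => Finset.HasAntidiagonal.antidiagonal (γ i))
    fun i p => (((γ i).choose p.1 : ℝ) * (a i ^ p.1 * (-b i) ^ p.2))]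
  refine Finset.prod_congr rfl fun i _ => ?_
  rw [sub_eq_add_neg, (Commute.all (a i) (-b i)).add_pow']
  simp [nsmul_eq_mul]

/-- Each monomial of degree `γ` in `x - y` is expanded by the binomial theorem; the pairs with `α +
β = γ` receive exactly the Wronskian coefficients. -/
theorem polyFun_radialPoly_sub (f : ℝ → ℝ) (r : ℕ) (x y : EuclideanSpace ℝ (Fin d)) :
    polyFun (radialPoly d f r) (x - y) = ∑ α ∈ multiIdxLE d (2 * r - 2),
      ∑ β ∈ multiIdxLE d (2 * r - 2), wronskianCoeff f r α β *
        ((∏ i, x i ^ α i) * ∏ i, y i ^ β i) := by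
  rw [polyFun_radialPoly_eq_sum]
  simp only [PiLp.sub_apply, prod_sub_pow, Finset.mul_sum]
  rw [Finset.sum_sigma', ← Finset.sum_product']
  symm
  -- The square of pairs `(α, β)` is larger than the set that occurs in the expansion, but the
  -- coefficients with `|α| + |β| > 2r - 2` are zero.
  have hsub : ∑ p ∈ (multiIdxLE d (2 * r - 2) ×ˢ multiIdxLE d (2 * r - 2)).filter
      (fun p => p.1 + p.2 ∈ multiIdxLE d (2 * r - 2)), wronskianCoeff f r p.1 p.2 *
        ((∏ i, x i ^ p.1 i) * ∏ i, y i ^ p.2 i) =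
      ∑ p ∈ multiIdxLE d (2 * r - 2) ×ˢ multiIdxLE d (2 * r - 2), wronskianCoeff f r p.1 p.2 *
        ((∏ i, x i ^ p.1 i) * ∏ i, y i ^ p.2 i) := by
    refine Finset.sum_subset (Finset.filter_subset _ _) fun p hp hp2 => ?_
    have : 2 * r - 2 < ∑ i, (p.1 + p.2) i := by
      by_contra! hcon
      exact hp2 (Finset.mem_filter.2 ⟨hp, mem_multiIdxLE.2 hcon⟩)
    rw [wronskianCoeff, radialPoly_coeff_eq_zero f r this, mul_zero, zero_mul]
  rw [← hsub]
  refine Finset.sum_bij' (fun p _ => ⟨p.1 + p.2, fun i => (p.1 i, p.2 i)⟩)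
    (fun s _ => (fun i => (s.2 i).1, fun i => (s.2 i).2)) ?_ ?_ ?_ ?_ ?_
  · intro p hp
    rw [Finset.mem_filter] at hp
    simp [hp.2]
  · rintro ⟨γ, q⟩ hs
    rw [Finset.mem_sigma, Fintype.mem_piFinset] at hs
    obtain ⟨h1, h2⟩ := hs
    simp only [Finset.HasAntidiagonal.mem_antidiagonal] at h2
    have h3 : (fun i => (q i).1) + (fun i => (q i).2) = γ := funext h2
    simp only [Finset.mem_filter, Finset.mem_product, h3]
    rw [mem_multiIdxLE] at h1
    refine ⟨⟨mem_multiIdxLE.2 ((Finset.sum_le_sum fun i _ => ?_).trans h1),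
      mem_multiIdxLE.2 ((Finset.sum_le_sum fun i _ => ?_).trans h1)⟩, mem_multiIdxLE.2 h1⟩
    · simp only [← h2 i]; omega
    · simp only [← h2 i]; omega
  · intro p _
    rfl
  · rintro ⟨γ, q⟩ hs
    rw [Finset.mem_sigma, Fintype.mem_piFinset] at hs
    simp only [Finset.HasAntidiagonal.mem_antidiagonal] at hs
    have h3 : (fun i => (q i).1) + (fun i => (q i).2) = γ := funext hs.2
    subst h3
    rfl
  · intro p _
    simp only [wronskianCoeff, Pi.add_apply, neg_pow (y _), Finset.prod_mul_distrib,
      Finset.prod_pow_eq_pow_sum]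
    ring

/-! ### The flat-limit expansion of the kernel matrix -/

/-- The vector `[x_i ^ α]`. -/
noncomputable def monoVec {n : ℕ} (x : Fin n → EuclideanSpace ℝ (Fin d)) (α : Fin d → ℕ)
    (i : Fin n) : ℝ :=
  ∏ j, x i j ^ α j

theorem kernelMat_expansion {f : ℝ → ℝ} {r n : ℕ} (hf : HasSmoothnessOrder f r)
    (x : Fin n → EuclideanSpace ℝ (Fin d)) (i j : Fin n) :
    (fun ε : ℝ => kernelMat f x ε i j -
      (∑ α ∈ multiIdxLE d (2 * r - 2), ∑ β ∈ multiIdxLE d (2 * r - 2),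
        ε ^ (∑ i, α i + ∑ i, β i) * (wronskianCoeff f r α β * (monoVec x α i * monoVec x β j)) +
      ε ^ (2 * r - 1) * (scaledDeriv f (2 * r - 1) * distMat x (2 * r - 1) i j)))
      =O[𝓝 0] fun ε : ℝ => ε ^ (2 * r) := by
  set D := ‖x i - x j‖ with hD
  have h0 : Tendsto (fun ε : ℝ => ε * D) (𝓝 0) (𝓝 0) := by
    simpa using (continuous_mul_const D).tendsto (0 : ℝ)
  have h1 := (sub_taylorSum_isBigO hf.contDiffAt).comp_tendsto h0
  have h2 : (fun ε : ℝ => (ε * D) ^ (2 * r)) =O[𝓝 0] fun ε : ℝ => ε ^ (2 * r) := by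
    simp only [mul_pow]
    simpa [mul_comm] using (isBigO_refl (fun ε : ℝ => ε ^ (2 * r)) (𝓝 0)).const_mul_left (D ^ (2 * r))
  refine (h1.trans h2).congr_left fun ε => ?_
  simp only [Function.comp_apply, Pi.sub_apply, hf.taylorSum_even]
  have h3 : ∑ α ∈ multiIdxLE d (2 * r - 2), ∑ β ∈ multiIdxLE d (2 * r - 2),
        ε ^ (∑ i, α i + ∑ i, β i) * (wronskianCoeff f r α β * (monoVec x α i * monoVec x β j)) =
      ∑ k ∈ Finset.range r, scaledDeriv f (2 * k) * (ε * D) ^ (2 * k) := by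
    have h4 := polyFun_radialPoly_sub f r (ε • x i) (ε • x j)
    rw [← smul_sub, polyFun_radialPoly, norm_smul] at h4
    -- The norm of a scaled vector produces `|ε|`; only even powers occur, so the expansion is valid
    -- for both signs of `ε`.
    have h5 : ∀ k, (‖ε‖ * ‖x i - x j‖) ^ (2 * k) = (ε * D) ^ (2 * k) := fun k => by
      rw [pow_mul, pow_mul, mul_pow, Real.norm_eq_abs, sq_abs, ← hD, mul_pow ε]
    simp only [h5] at h4
    rw [h4]
    refine Finset.sum_congr rfl fun α _ => Finset.sum_congr rfl fun β _ => ?_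
    simp only [monoVec, PiLp.smul_apply, smul_eq_mul, mul_pow, Finset.prod_mul_distrib,
      Finset.prod_pow_eq_pow_sum, pow_add]
    ring
  rw [h3]
  simp only [kernelMat, distMat, Matrix.of_apply, mul_pow, ← hD]
  ring

end Wronskian


/-! ### Bordered determinants -/

section Bordered

open Matrix

theorem mul_transpose_eq_one_of_card {m ι : Type*} [Fintype m] [Fintype ι] [DecidableEq m]
    [DecidableEq ι] {Q : Matrix m ι ℝ} (hcard : Fintype.card m = Fintype.card ι) (h : Qᵀ * Q = 1) :
    Q * Qᵀ = 1 :=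
  (Matrix.mul_eq_one_comm_of_equiv (Fintype.card_eq.mp hcard.symm).some).1 h

/-- An orthonormal family of columns can be completed to an orthogonal matrix. -/
theorem exists_orthogonal_completion {n N : ℕ} {κ : Type*} [Fintype κ] [DecidableEq κ]
    (hn : n = Fintype.card κ + N) (Qp : Matrix (Fin n) (Fin N) ℝ) (hQ : Qpᵀ * Qp = 1) :
    ∃ Q1 : Matrix (Fin n) κ ℝ, (fromCols Q1 Qp)ᵀ * fromCols Q1 Qp = 1 := by
  let v : κ ⊕ Fin N → EuclideanSpace ℝ (Fin n) := fun a => WithLp.toLp 2 fun i => Sum.elim 0 (Qp i) a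
  have hv : Orthonormal ℝ ((Set.range (Sum.inr : Fin N → κ ⊕ Fin N)).domRestrict v) := by
    rw [orthonormal_iff_ite]
    rintro ⟨_, a, rfl⟩ ⟨_, b, rfl⟩
    have h := congrFun (congrFun hQ b) a
    simp only [Matrix.mul_apply, transpose_apply, one_apply] at h
    simp only [Set.domRestrict_apply, v, PiLp.inner_apply, Sum.elim_inr]
    simp only [RCLike.inner_apply, conj_trivial]
    rw [h]
    by_cases hab : b = a
    · subst hab; simp
    · rw [if_neg hab, if_neg fun h' => hab (Sum.inr_injective (congrArg Subtype.val h')).symm]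
  obtain ⟨b, hb⟩ := hv.exists_orthonormalBasis_extension_of_card_eq (by simp [hn])
  refine ⟨Matrix.of fun i a => b (Sum.inl a) i, ?_⟩
  have hQb : fromCols (Matrix.of fun i a => b (Sum.inl a) i) Qp = Matrix.of fun i a => b a i := by
    ext i a
    rcases a with a | a
    · rfl
    · simp [hb (Sum.inr a) ⟨a, rfl⟩, v]
  rw [hQb]
  ext a c
  have h := (orthonormal_iff_ite.1 b.orthonormal) c a
  simp only [PiLp.inner_apply, RCLike.inner_apply, conj_trivial] at h
  simp only [Matrix.mul_apply, transpose_apply, of_apply, one_apply]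
  rw [h]
  simp [eq_comm]

variable {P N : Type*} [Fintype P] [Fintype N] [DecidableEq P] [DecidableEq N]

/-- Exchanging the `P` columns of `A` with the border columns, up to sign, makes the matrix block
triangular with diagonal blocks `-R`, `A.toBlocks₂₂`, `Rᵀ`. -/
theorem det_fromBlocks_bordered_triangular (A : Matrix (P ⊕ N) (P ⊕ N) ℝ) (R : Matrix P P ℝ) :
    (fromBlocks A (fromRows R 0) (fromCols Rᵀ 0) 0).det =
      (-1) ^ Fintype.card P * (R.det * R.det) * A.toBlocks₂₂.det := by
  -- The signed exchange of columns is a product of three unipotent shears, so its determinant is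
  -- `1` without counting transpositions.
  let E1 : Matrix ((P ⊕ N) ⊕ P) ((P ⊕ N) ⊕ P) ℝ := fromBlocks 1 (fromRows 1 0) 0 1
  let E2 : Matrix ((P ⊕ N) ⊕ P) ((P ⊕ N) ⊕ P) ℝ := fromBlocks 1 0 (fromCols (-1) 0) 1
  have h1 : E1.det = 1 := by simp [E1]
  have h2 : E2.det = 1 := by simp [E2]
  have hJ : E1 * E2 * E1 = fromBlocks (fromBlocks 0 0 0 1) (fromRows 1 0) (fromCols (-1) 0) 0 := by
    simp only [E1, E2, fromBlocks_multiply]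
    ext i j
    rcases i with (i | i) | i <;> rcases j with (j | j) | j <;>
      simp [Matrix.mul_apply, Matrix.one_apply, Fintype.sum_sum_type]
  have h3 : fromBlocks A (fromRows R 0) (fromCols Rᵀ 0) 0 * (E1 * E2 * E1) =
      fromBlocks (fromBlocks (-R) A.toBlocks₁₂ 0 A.toBlocks₂₂)
        (fromRows A.toBlocks₁₁ A.toBlocks₂₁) 0 Rᵀ := by
    rw [hJ, fromBlocks_multiply]
    conv_lhs => rw [← fromBlocks_toBlocks A]
    ext i j
    rcases i with (i | i) | i <;> rcases j with (j | j) | j <;>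
      simp [Matrix.mul_apply, Matrix.one_apply, Fintype.sum_sum_type]
  have h4 := congrArg Matrix.det h3
  rw [det_mul, det_mul, det_mul, h1, h2, det_fromBlocks_zero₂₁, det_fromBlocks_zero₂₁,
    det_transpose, det_neg] at h4
  rw [mul_one, mul_one, mul_one] at h4
  rw [h4]
  ring

/-- Conjugation by the orthogonal matrix `diag(Q, 1)` replaces `V` by `[Q1ᵀ V; 0]`, as `Qp`
annihilates `V`. The block `Q1ᵀ V` plays the role of `R`: neither its triangularity nor its
invertibility matters, only `Vᵀ V = (Q1ᵀ V)ᵀ (Q1ᵀ V)`. -/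
theorem det_fromBlocks_bordered {n : ℕ} (A : Matrix (Fin n) (Fin n) ℝ) (V : Matrix (Fin n) P ℝ)
    (Q1 : Matrix (Fin n) P ℝ) (Qp : Matrix (Fin n) N ℝ)
    (hn : n = Fintype.card P + Fintype.card N)
    (hQ : (fromCols Q1 Qp)ᵀ * fromCols Q1 Qp = 1) (hV : Qpᵀ * V = 0) :
    (-1) ^ Fintype.card P * (fromBlocks A V Vᵀ 0).det = (Vᵀ * V).det * (Qpᵀ * A * Qp).det := by
  set Q := fromCols Q1 Qp
  have hQ' : Q * Qᵀ = 1 := mul_transpose_eq_one_of_card (by simp [hn]) hQ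
  have hQV : Qᵀ * V = fromRows (Q1ᵀ * V) 0 := by
    rw [transpose_fromCols, fromRows_mul, hV]
  have hVR : Vᵀ * V = (Q1ᵀ * V)ᵀ * (Q1ᵀ * V) := by
    calc Vᵀ * V = Vᵀ * (Q * Qᵀ) * V := by rw [hQ', Matrix.mul_one]
      _ = (Qᵀ * V)ᵀ * (Qᵀ * V) := by simp [Matrix.mul_assoc]
      _ = _ := by rw [hQV, transpose_fromRows, fromCols_mul_fromRows]; simp
  let M1 : Matrix ((P ⊕ N) ⊕ P) (Fin n ⊕ P) ℝ := fromBlocks Qᵀ 0 0 1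
  let M2 : Matrix (Fin n ⊕ P) ((P ⊕ N) ⊕ P) ℝ := fromBlocks Q 0 0 1
  let Z : Matrix (Fin n ⊕ P) (Fin n ⊕ P) ℝ := fromBlocks A V Vᵀ 0
  have hM12 : M1 * M2 = 1 := by simp [M1, M2, fromBlocks_multiply, hQ]
  have hM21 : M2 * M1 = 1 := by simp [M1, M2, fromBlocks_multiply, hQ']
  have hconj : M1 * Z * M2 =
      fromBlocks (Qᵀ * A * Q) (fromRows (Q1ᵀ * V) 0) (fromCols (Q1ᵀ * V)ᵀ 0) 0 := by
    have h1 : Vᵀ * Q = fromCols (Q1ᵀ * V)ᵀ 0 := by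
      have := congrArg transpose hQV
      rw [transpose_mul, transpose_transpose, transpose_fromRows, transpose_zero] at this
      exact this
    simp only [M1, M2, Z]
    rw [fromBlocks_multiply, fromBlocks_multiply]
    simp only [Matrix.zero_mul, Matrix.mul_zero, Matrix.mul_one, Matrix.one_mul, add_zero, zero_add,
      hQV, h1]
  have hdet := congrArg Matrix.det hconj
  rw [det_conj_of_mul_eq_one hM12 hM21, det_fromBlocks_bordered_triangular] at hdet
  have h22 : (Qᵀ * A * Q).toBlocks₂₂ = Qpᵀ * A * Qp := by
    simp only [Q, transpose_fromCols, fromRows_mul, mul_fromCols]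
    rfl
  rw [show (fromBlocks A V Vᵀ 0).det = Z.det from rfl, hdet, h22, hVR, det_mul,
    det_transpose, ← mul_assoc, ← mul_assoc, ← mul_pow]
  simp

end Bordered


/-! ### Graded orthonormal frames -/

section Frames

open Matrix

variable {d n r N : ℕ}

/-- The pairing of a vector of weights with a monomial on the nodes. -/
noncomputable def moment (x : Fin n → EuclideanSpace ℝ (Fin d)) (q : Fin n → ℝ) (α : Fin d → ℕ) :
    ℝ := ∑ i, q i * monoVec x α i

theorem kernelMat_bilin_expansion {f : ℝ → ℝ} (hf : HasSmoothnessOrder f r)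
    (x : Fin n → EuclideanSpace ℝ (Fin d)) (q q' : Fin n → ℝ) :
    (fun ε : ℝ => (∑ i, ∑ j, q i * q' j * kernelMat f x ε i j) -
      (∑ α ∈ multiIdxLE d (2 * r - 2), ∑ β ∈ multiIdxLE d (2 * r - 2),
          ε ^ (∑ i, α i + ∑ i, β i) * (wronskianCoeff f r α β * (moment x q α * moment x q' β)) +
        ε ^ (2 * r - 1) * (scaledDeriv f (2 * r - 1) *
          ∑ i, ∑ j, q i * q' j * distMat x (2 * r - 1) i j)))
      =O[𝓝 0] fun ε : ℝ => ε ^ (2 * r) := by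
  have h := IsBigO.sum (s := Finset.univ) fun i _ => IsBigO.sum (s := Finset.univ) fun j _ =>
    (kernelMat_expansion hf x i j).const_mul_left (q i * q' j)
  refine h.congr_left fun ε => ?_
  have h1 : (∑ i, ∑ j, q i * q' j * ∑ α ∈ multiIdxLE d (2 * r - 2),
      ∑ β ∈ multiIdxLE d (2 * r - 2), ε ^ (∑ i, α i + ∑ i, β i) *
        (wronskianCoeff f r α β * (monoVec x α i * monoVec x β j))) =
      ∑ α ∈ multiIdxLE d (2 * r - 2), ∑ β ∈ multiIdxLE d (2 * r - 2),
        ε ^ (∑ i, α i + ∑ i, β i) *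
          (wronskianCoeff f r α β * (moment x q α * moment x q' β)) := by
    have hm : ∀ α β, moment x q α * moment x q' β =
        ∑ i, ∑ j, q i * monoVec x α i * (q' j * monoVec x β j) := fun α β => Finset.sum_mul_sum ..
    simp only [hm, Finset.mul_sum]
    have hcomm : ∀ g : Fin n → Fin n → (Fin d → ℕ) → (Fin d → ℕ) → ℝ,
        (∑ i, ∑ j, ∑ α ∈ multiIdxLE d (2 * r - 2), ∑ β ∈ multiIdxLE d (2 * r - 2), g i j α β) =
        ∑ α ∈ multiIdxLE d (2 * r - 2), ∑ β ∈ multiIdxLE d (2 * r - 2), ∑ i, ∑ j, g i j α β :=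
      fun g => (Finset.sum_congr rfl fun i _ => Finset.sum_comm).trans <| Finset.sum_comm.trans <|
        Finset.sum_congr rfl fun α _ =>
          (Finset.sum_congr rfl fun i _ => Finset.sum_comm).trans Finset.sum_comm
    rw [hcomm]
    refine Finset.sum_congr rfl fun α _ => Finset.sum_congr rfl fun β _ =>
      Finset.sum_congr rfl fun i _ => Finset.sum_congr rfl fun j _ => by ring
  have h2 : (∑ i, ∑ j, q i * q' j * (ε ^ (2 * r - 1) * (scaledDeriv f (2 * r - 1) *
      distMat x (2 * r - 1) i j))) = ε ^ (2 * r - 1) * (scaledDeriv f (2 * r - 1) *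
          ∑ i, ∑ j, q i * q' j * distMat x (2 * r - 1) i j) := by
    simp only [Finset.mul_sum]
    exact Finset.sum_congr rfl fun i _ => Finset.sum_congr rfl fun j _ => by ring
  rw [← h1, ← h2]
  simp only [mul_sub, mul_add, Finset.sum_apply, Finset.sum_sub_distrib, Finset.sum_add_distrib]

theorem multiIdxLE_filter {s k : ℕ} (h : s ≤ k) :
    (multiIdxLE d k).filter (fun α => ∑ i, α i = s) = multiIdxEQ d s := by
  ext α
  simp only [Finset.mem_filter, mem_multiIdxLE, mem_multiIdxEQ]
  omega

/-- The moment conditions leave only terms with `|α| ≥ s` and `|β| ≥ t`; among these the order `s +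
t` is attained only for equality in both. The distance term has order `2r - 1`, which is higher. -/
theorem hasLead_bilin_of_add_le {f : ℝ → ℝ} (hf : HasSmoothnessOrder f r)
    (x : Fin n → EuclideanSpace ℝ (Fin d)) {q q' : Fin n → ℝ} {s t : ℕ}
    (hq : ∀ α, ∑ i, α i < s → moment x q α = 0) (hq' : ∀ α, ∑ i, α i < t → moment x q' α = 0)
    (hst : s + t ≤ 2 * r - 2) :
    HasLead (fun ε => ∑ i, ∑ j, q i * q' j * kernelMat f x ε i j) (s + t)
      (∑ α ∈ multiIdxEQ d s, ∑ β ∈ multiIdxEQ d t,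
        wronskianCoeff f r α β * (moment x q α * moment x q' β)) := by
  have hr := hf.pos
  have h1 := HasLead.of_isBigO (kernelMat_bilin_expansion hf x q q') (m := s + t) (by omega)
  have h2 : HasLead (fun ε : ℝ => ε ^ (2 * r - 1) * (scaledDeriv f (2 * r - 1) *
      ∑ i, ∑ j, q i * q' j * distMat x (2 * r - 1) i j)) (s + t) 0 :=
    HasLead.pow_mul_const.lower (by omega)
  have h3 : HasLead (fun ε : ℝ => ∑ α ∈ multiIdxLE d (2 * r - 2),
      ∑ β ∈ multiIdxLE d (2 * r - 2), ε ^ (∑ i, α i + ∑ i, β i) *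
        (wronskianCoeff f r α β * (moment x q α * moment x q' β))) (s + t)
      (∑ α ∈ multiIdxLE d (2 * r - 2), ∑ β ∈ multiIdxLE d (2 * r - 2),
        if ∑ i, α i = s then if ∑ i, β i = t then
          wronskianCoeff f r α β * (moment x q α * moment x q' β) else 0 else 0) := by
    refine HasLead.sum _ fun α _ => HasLead.sum _ fun β _ => ?_
    rcases lt_or_ge (∑ i, α i) s with h | h
    · rw [hq α h]
      simpa using HasLead.zero
    rcases lt_or_ge (∑ i, β i) t with h' | h'
    · rw [hq' β h']
      simpa using HasLead.zero
    split_ifs with h4 h5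
    · rw [h4, h5]
      exact HasLead.pow_mul_const
    · exact HasLead.pow_mul_const.lower (by omega)
    · exact HasLead.pow_mul_const.lower (by omega)
  have h4 := (h1.add (h3.add h2)).congr (Eventually.of_forall fun ε => by ring : _ =ᶠ[𝓝 0]
    (fun ε => ∑ i, ∑ j, q i * q' j * kernelMat f x ε i j))
  convert h4 using 1
  rw [zero_add, add_zero, ← multiIdxLE_filter (d := d) (show s ≤ 2 * r - 2 by omega),
    Finset.sum_filter]
  refine Finset.sum_congr rfl fun α _ => ?_
  split_ifs with h
  · rw [← multiIdxLE_filter (d := d) (show t ≤ 2 * r - 2 by omega), Finset.sum_filter]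
  · simp

/-- The moment conditions require `|α| + |β| ≥ 2r - 1`, whereas nonzero coefficients require `|α| +
|β| ≤ 2r - 2`. The polynomial part therefore vanishes identically and the distance term leads. -/
theorem hasLead_bilin_of_le_add {f : ℝ → ℝ} (hf : HasSmoothnessOrder f r)
    (x : Fin n → EuclideanSpace ℝ (Fin d)) {q q' : Fin n → ℝ} {s t : ℕ}
    (hq : ∀ α, ∑ i, α i < s → moment x q α = 0) (hq' : ∀ α, ∑ i, α i < t → moment x q' α = 0)
    (hst : 2 * r - 1 ≤ s + t) :
    HasLead (fun ε => ∑ i, ∑ j, q i * q' j * kernelMat f x ε i j) (2 * r - 1)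
      (scaledDeriv f (2 * r - 1) * ∑ i, ∑ j, q i * q' j * distMat x (2 * r - 1) i j) := by
  have hr := hf.pos
  have h := kernelMat_bilin_expansion hf x q q'
  have h0 : ∀ ε : ℝ, ∑ α ∈ multiIdxLE d (2 * r - 2), ∑ β ∈ multiIdxLE d (2 * r - 2),
      ε ^ (∑ i, α i + ∑ i, β i) *
        (wronskianCoeff f r α β * (moment x q α * moment x q' β)) = 0 := by
    refine fun ε => Finset.sum_eq_zero fun α _ => Finset.sum_eq_zero fun β _ => ?_
    rcases lt_or_ge (∑ i, α i) s with h | h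
    · simp [hq α h]
    rcases lt_or_ge (∑ i, β i) t with h' | h'
    · simp [hq' β h']
    have : wronskianCoeff f r α β = 0 := by
      rw [wronskianCoeff, radialPoly_coeff_eq_zero f r, mul_zero]
      simp only [Pi.add_apply, Finset.sum_add_distrib]
      omega
    rw [this]
    simp
  simp only [h0, zero_add] at h
  have h2 : 2 * r = 2 * r - 1 + 1 := by omega
  unfold HasLead
  rw [← h2]
  exact h

/-- The degree of a member of a graded frame. -/
def frameDeg : multiIdxLE d (r - 1) ⊕ Fin N → ℕ :=
  Sum.elim (fun α => ∑ i, (α : Fin d → ℕ) i) fun _ => r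

theorem degree_lt (hr : 1 ≤ r) (α : multiIdxLE d (r - 1)) : ∑ i, (α : Fin d → ℕ) i < r := by
  have := mem_multiIdxLE.1 α.2
  omega

/-- An orthonormal basis of `ℝ^n` whose members of degree `s` are orthogonal on the nodes to all the
monomials of degree less than `s`. -/
structure IsGradedFrame (x : Fin n → EuclideanSpace ℝ (Fin d))
    (Q : Matrix (Fin n) (multiIdxLE d (r - 1) ⊕ Fin N) ℝ) : Prop where
  card_eq : n = (multiIdxLE d (r - 1)).card + N
  orthogonal : Qᵀ * Q = 1
  moment_eq_zero : ∀ a β, ∑ i, β i < frameDeg a → moment x (fun i => Q i a) β = 0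

theorem moment_col (x : Fin n → EuclideanSpace ℝ (Fin d)) {κ : Type*} [Fintype κ]
    (Q : Matrix (Fin n) κ ℝ) (A : Finset (Fin d → ℕ)) (a : κ) (α : A) :
    (Qᵀ * vandermondeMat x A) a α = moment x (fun i => Q i a) α := rfl

/-- The moments of the columns of `Qthin` are the entries of `R`, which vanish below the diagonal of
a graded ordering; those of `Qperp` are all zero. -/
theorem IsFullQR.isGradedFrame {x : Fin n → EuclideanSpace ℝ (Fin d)} {ord : (Fin d → ℕ) → ℕ}
    {Qthin : Matrix (Fin n) (multiIdxLE d (r - 1)) ℝ} {Qperp : Matrix (Fin n) (Fin N) ℝ}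
    {R : Matrix (multiIdxLE d (r - 1)) (multiIdxLE d (r - 1)) ℝ} (hr : 1 ≤ r)
    (ho : IsGradedOrdering d ord) (h : IsFullQR x ord Qthin Qperp R) :
    IsGradedFrame x (fromCols Qthin Qperp) where
  card_eq := h.card_eq
  orthogonal := h.orthogonal
  moment_eq_zero a β hβ := by
    have hQ := h.orthogonal
    rw [transpose_fromCols, fromRows_mul_fromCols, ← fromBlocks_one, fromBlocks_inj] at hQ
    rcases a with a | a
    · have hβ' : ∑ i, β i < ∑ i, (a : Fin d → ℕ) i := hβ
      have hmem : β ∈ multiIdxLE d (r - 1) :=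
        mem_multiIdxLE.2 (hβ'.le.trans (mem_multiIdxLE.1 a.2))
      have h1 := moment_col x Qthin _ a ⟨β, hmem⟩
      rw [h.factor, ← Matrix.mul_assoc, hQ.1, Matrix.one_mul,
        h.upper a ⟨β, hmem⟩ (ho.graded _ _ hβ')] at h1
      exact h1.symm
    · have hβ' : ∑ i, β i < r := hβ
      have hmem : β ∈ multiIdxLE d (r - 1) := mem_multiIdxLE.2 (by omega)
      have h1 := moment_col x Qperp _ a ⟨β, hmem⟩
      rw [h.factor, ← Matrix.mul_assoc, hQ.2.2.1, Matrix.zero_mul] at h1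
      exact h1.symm

end Frames


section GradedForm

open Matrix

variable {d n r N : ℕ} {x : Fin n → EuclideanSpace ℝ (Fin d)}
  {Q : Matrix (Fin n) (multiIdxLE d (r - 1) ⊕ Fin N) ℝ}

theorem exists_equiv_monotone {ι : Type*} [Fintype ι] (h : n = Fintype.card ι) (g : ι → ℕ) :
    ∃ σ : Fin n ≃ ι, Monotone (g ∘ σ) := by
  have e : Fin n ≃ ι := Fintype.equivOfCardEq (by simp [h])
  exact ⟨(Tuple.sort (g ∘ e)).trans e, Tuple.monotone_sort (g ∘ e)⟩

/-- Gram–Schmidt applied to the monomial vectors sorted by degree, completed where these vectors are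
dependent. No rank condition on the nodes is needed. -/
theorem exists_isGradedFrame (hr : 1 ≤ r) (x : Fin n → EuclideanSpace ℝ (Fin d))
    (hn : n = (multiIdxLE d (r - 1)).card + N) :
    ∃ Q : Matrix (Fin n) (multiIdxLE d (r - 1) ⊕ Fin N) ℝ, IsGradedFrame x Q := by
  obtain ⟨σ, hσ⟩ := exists_equiv_monotone (ι := multiIdxLE d (r - 1) ⊕ Fin N) (n := n) (by simp [hn])
    frameDeg
  -- Zero vectors in the last `N` places impose nothing; the members found there come after all
  -- monomials and so are orthogonal to them.
  let v : Fin n → EuclideanSpace ℝ (Fin n) := fun k =>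
    Sum.elim (fun α : multiIdxLE d (r - 1) => WithLp.toLp 2 (monoVec x α)) (fun _ => 0) (σ k)
  let b := InnerProductSpace.gramSchmidtOrthonormalBasis (𝕜 := ℝ) (by simp) v
  refine ⟨Matrix.of fun i a => b (σ.symm a) i, hn, ?_, ?_⟩
  · ext a c
    have h := (orthonormal_iff_ite.1 b.orthonormal) (σ.symm c) (σ.symm a)
    simp only [PiLp.inner_apply, RCLike.inner_apply, conj_trivial] at h
    simp only [Matrix.mul_apply, transpose_apply, of_apply, one_apply]
    rw [h]
    simp [eq_comm]
  · intro a β hβ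
    have hmem : β ∈ multiIdxLE d (r - 1) := by
      refine mem_multiIdxLE.2 ?_
      rcases a with a | a
      · exact hβ.le.trans (mem_multiIdxLE.1 a.2)
      · have : ∑ i, β i < r := hβ
        omega
    have hlt : σ.symm (Sum.inl ⟨β, hmem⟩) < σ.symm a := by
      by_contra! hle
      have := hσ hle
      simp only [Function.comp_apply, Equiv.apply_symm_apply] at this
      exact absurd (hβ.trans_le this) (lt_irrefl _)
    have h := InnerProductSpace.gramSchmidtOrthonormalBasis_inv_triangular (𝕜 := ℝ) (by simp) v hlt
    simp only [v, Equiv.apply_symm_apply, Sum.elim_inl, PiLp.inner_apply, RCLike.inner_apply,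
      conj_trivial] at h
    rw [moment, ← h]
    exact Finset.sum_congr rfl fun i _ => mul_comm _ _

theorem conj_apply_eq_sum {κ : Type*} (Q : Matrix (Fin n) κ ℝ) (A : Matrix (Fin n) (Fin n) ℝ)
    (a b : κ) : (Qᵀ * A * Q) a b = ∑ i, ∑ j, Q i a * Q j b * A i j := by
  simp only [Matrix.mul_apply, transpose_apply, Finset.sum_mul]
  rw [Finset.sum_comm]
  exact Finset.sum_congr rfl fun i _ => Finset.sum_congr rfl fun j _ => by ring

theorem multiIdxLE_mono {k l : ℕ} (h : k ≤ l) : multiIdxLE d k ⊆ multiIdxLE d l := fun _ hα =>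
  mem_multiIdxLE.2 ((mem_multiIdxLE.1 hα).trans h)

/-- The place of a monomial in a graded frame. -/
def frameIdx {B : Finset (Fin d → ℕ)} (hB : B ⊆ multiIdxLE d (r - 1)) (α : B) :
    multiIdxLE d (r - 1) ⊕ Fin N :=
  Sum.inl ⟨α, hB α.2⟩

theorem frameIdx_injective {B : Finset (Fin d → ℕ)} (hB : B ⊆ multiIdxLE d (r - 1)) :
    Function.Injective (frameIdx (N := N) hB) := fun α β h => by
  have h1 := Sum.inl_injective (β := Fin N) h
  exact Subtype.ext (Subtype.mk.inj h1)

theorem mem_range_frameIdx (hr : 1 ≤ r) {k : ℕ} (hk : k ≤ r - 1)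
    (a : multiIdxLE d (r - 1) ⊕ Fin N) :
    a ∈ Set.range (frameIdx (multiIdxLE_mono hk)) ↔ frameDeg a ≤ k := by
  constructor
  · rintro ⟨α, rfl⟩
    exact mem_multiIdxLE.1 α.2
  · intro h
    rcases a with a | a
    · exact ⟨⟨a, mem_multiIdxLE.2 h⟩, rfl⟩
    · have : r ≤ k := h
      omega

theorem mem_range_frameIdx_multiIdxEQ (hr : 1 ≤ r) {k : ℕ} (hk : k ≤ r - 1)
    (a : multiIdxLE d (r - 1) ⊕ Fin N) :
    a ∈ Set.range (frameIdx (multiIdxEQ_subset_multiIdxLE hk)) ↔ frameDeg a = k := by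
  constructor
  · rintro ⟨α, rfl⟩
    exact mem_multiIdxEQ.1 α.2
  · intro h
    rcases a with a | a
    · exact ⟨⟨a, mem_multiIdxEQ.2 h⟩, rfl⟩
    · have : r = k := h
      omega

/-- The degree-preserving part of the matrix of moments of a graded frame. -/
noncomputable def gradedMoment (x : Fin n → EuclideanSpace ℝ (Fin d))
    (Q : Matrix (Fin n) (multiIdxLE d (r - 1) ⊕ Fin N) ℝ) {B : Finset (Fin d → ℕ)}
    (hB : B ⊆ multiIdxLE d (r - 1)) : Matrix B B ℝ :=
  Matrix.of fun a α => if ∑ i, (α : Fin d → ℕ) i = ∑ i, (a : Fin d → ℕ) i then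
    moment x (fun i => Q i (frameIdx hB a)) α else 0

/-- The leading coefficients of the kernel matrix in a graded frame. -/
noncomputable def gradedForm (f : ℝ → ℝ) (r : ℕ) (x : Fin n → EuclideanSpace ℝ (Fin d))
    (Q : Matrix (Fin n) (multiIdxLE d (r - 1) ⊕ Fin N) ℝ) :
    Matrix (multiIdxLE d (r - 1)) (multiIdxLE d (r - 1)) ℝ :=
  Matrix.of fun a b =>
    ∑ α ∈ multiIdxEQ d (∑ i, (a : Fin d → ℕ) i), ∑ β ∈ multiIdxEQ d (∑ i, (b : Fin d → ℕ) i),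
      wronskianCoeff f r α β *
        (moment x (fun i => Q i (Sum.inl a)) α * moment x (fun i => Q i (Sum.inl b)) β)

/-- The block diagonal matrix of the leading coefficients of the kernel matrix in a graded frame. -/
noncomputable def frameLimit (f : ℝ → ℝ) (r : ℕ) (x : Fin n → EuclideanSpace ℝ (Fin d))
    (Q : Matrix (Fin n) (multiIdxLE d (r - 1) ⊕ Fin N) ℝ) :
    Matrix (multiIdxLE d (r - 1) ⊕ Fin N) (multiIdxLE d (r - 1) ⊕ Fin N) ℝ :=
  fromBlocks (gradedForm f r x Q) 0 0 (scaledDeriv f (2 * r - 1) •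
    ((Q.submatrix id Sum.inr)ᵀ * distMat x (2 * r - 1) * Q.submatrix id Sum.inr))

/-- A leading coefficient involves only monomials of the same degrees as the two members, whence the
degree-preserving moments on both sides. The index sets must be unions of full degree classes for
these monomials to be available. -/
theorem frameLimit_submatrix {f : ℝ → ℝ} (hf : HasSmoothnessOrder f r)
    (x : Fin n → EuclideanSpace ℝ (Fin d))
    (Q : Matrix (Fin n) (multiIdxLE d (r - 1) ⊕ Fin N) ℝ) {B C : Finset (Fin d → ℕ)}
    (hB : B ⊆ multiIdxLE d (r - 1)) (hC : C ⊆ multiIdxLE d (r - 1))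
    (hB' : ∀ α ∈ B, multiIdxEQ d (∑ i, α i) ⊆ B) (hC' : ∀ α ∈ C, multiIdxEQ d (∑ i, α i) ⊆ C) :
    (frameLimit f r x Q).submatrix (frameIdx hB) (frameIdx hC) =
      gradedMoment x Q hB * wronskianBlock (radialKernel d f) B C * (gradedMoment x Q hC)ᵀ := by
  have key : ∀ {B : Finset (Fin d → ℕ)} (_ : ∀ α ∈ B, multiIdxEQ d (∑ i, α i) ⊆ B) (a : B)
      (F : (Fin d → ℕ) → ℝ), ∑ α ∈ multiIdxEQ d (∑ i, (a : Fin d → ℕ) i), F α =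
        ∑ α : B, if ∑ i, (α : Fin d → ℕ) i = ∑ i, (a : Fin d → ℕ) i then F α else 0 := by
    intro B hB a F
    have h : multiIdxEQ d (∑ i, (a : Fin d → ℕ) i) =
        B.filter fun α => ∑ i, α i = ∑ i, (a : Fin d → ℕ) i := by
      ext α
      rw [Finset.mem_filter, mem_multiIdxEQ]
      exact ⟨fun h => ⟨hB a a.2 (mem_multiIdxEQ.2 h), h⟩, fun h => h.2⟩
    rw [h, Finset.sum_filter, ← Finset.sum_coe_sort B]
  ext a b
  change ∑ α ∈ multiIdxEQ d (∑ i, (a : Fin d → ℕ) i), ∑ β ∈ multiIdxEQ d (∑ i, (b : Fin d → ℕ) i),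
      wronskianCoeff f r α β * (moment x (fun i => Q i (frameIdx hB a)) α *
        moment x (fun i => Q i (frameIdx hC b)) β) = _
  simp only [key hB' a, key hC' b, Matrix.mul_apply, transpose_apply, Finset.sum_mul]
  rw [Finset.sum_comm (s := Finset.univ) (t := Finset.univ) (f := fun β α => _)]
  refine Finset.sum_congr rfl fun α _ => ?_
  simp only [gradedMoment, of_apply]
  split_ifs with hα
  · refine Finset.sum_congr rfl fun β _ => ?_
    have h1 := mem_multiIdxLE.1 (hB α.2)
    have h2 := mem_multiIdxLE.1 (hC β.2)
    rw [wronskianBlock_apply hf α β (by omega)]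
    split_ifs
    · ring
    · simp
  · simp

theorem multiIdxEQ_subset_of_mem_multiIdxLE {k : ℕ} :
    ∀ α ∈ multiIdxLE d k, multiIdxEQ d (∑ i, α i) ⊆ multiIdxLE d k := fun _ hα =>
  multiIdxEQ_subset_multiIdxLE (mem_multiIdxLE.1 hα)

namespace IsGradedFrame

theorem mul_transpose (h : IsGradedFrame x Q) : Q * Qᵀ = 1 :=
  mul_transpose_eq_one_of_card (by simpa using h.card_eq) h.orthogonal

/-- The moments of members of degree above `k` vanish, so the Gram matrix of the Vandermonde matrix
is `Hᵀ H` with `H` the moments of degree at most `k`. This `H` is block triangular by degree and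
shares its diagonal blocks with the graded moments. -/
theorem det_gradedMoment_sq (h : IsGradedFrame x Q) (hr : 1 ≤ r) {k : ℕ} (hk : k ≤ r - 1) :
    (gradedMoment x Q (multiIdxLE_mono hk)).det * (gradedMoment x Q (multiIdxLE_mono hk)).det =
      ((vandermondeMat x (multiIdxLE d k))ᵀ * vandermondeMat x (multiIdxLE d k)).det := by
  set V := vandermondeMat x (multiIdxLE d k)
  let H : Matrix (multiIdxLE d k) (multiIdxLE d k) ℝ :=
    Matrix.of fun a α => moment x (fun i => Q i (frameIdx (multiIdxLE_mono hk) a)) α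
  have hVV : Vᵀ * V = Hᵀ * H := by
    have h1 : Vᵀ * V = (Qᵀ * V)ᵀ * (Qᵀ * V) := by
      rw [transpose_mul, transpose_transpose, Matrix.mul_assoc, ← Matrix.mul_assoc Q, h.mul_transpose,
        Matrix.one_mul]
    rw [h1]
    ext α β
    simp only [Matrix.mul_apply (M := (Qᵀ * V)ᵀ), Matrix.mul_apply (M := Hᵀ), transpose_apply]
    refine (Fintype.sum_of_injective (frameIdx (multiIdxLE_mono hk)) (frameIdx_injective _) _ _ ?_ ?_).symm
    · intro a ha
      rw [mem_range_frameIdx hr hk] at ha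
      rw [moment_col, h.moment_eq_zero a α ((mem_multiIdxLE.1 α.2).trans_lt (not_le.1 ha)), zero_mul]
    · intro a
      rfl
  let deg : multiIdxLE d k → ℕ := fun α => ∑ i, (α : Fin d → ℕ) i
  have hH : H.BlockTriangular deg := fun a α hlt => h.moment_eq_zero _ _ hlt
  have hG : (gradedMoment x Q (multiIdxLE_mono hk)).BlockTriangular deg := fun a α hlt => if_neg hlt.ne
  have hdet : (gradedMoment x Q (multiIdxLE_mono hk)).det = H.det := by
    rw [hH.det, hG.det]
    refine Finset.prod_congr rfl fun s _ => congrArg Matrix.det ?_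
    ext a α
    exact if_pos (α.2.trans a.2.symm)
  rw [hdet, hVV, det_mul, det_transpose]

/-- The leading coefficients of the kernel matrix for degrees at most `k`. -/
theorem det_frameLimit_submatrix (h : IsGradedFrame x Q) {f : ℝ → ℝ} (hf : HasSmoothnessOrder f r)
    {k : ℕ} (hk : k ≤ r - 1) :
    ((frameLimit f r x Q).submatrix (frameIdx (multiIdxLE_mono hk))
        (frameIdx (multiIdxLE_mono hk))).det =
      ((vandermondeMat x (multiIdxLE d k))ᵀ * vandermondeMat x (multiIdxLE d k)).det *
        (wronskianMat (radialKernel d f) k).det := by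
  rw [frameLimit_submatrix hf x Q _ _ multiIdxEQ_subset_of_mem_multiIdxLE
    multiIdxEQ_subset_of_mem_multiIdxLE, det_mul, det_mul, det_transpose,
    ← h.det_gradedMoment_sq hf.pos hk, wronskianMat]
  ring

variable {f : ℝ → ℝ}

theorem hasLead_inl_inl (h : IsGradedFrame x Q) (hf : HasSmoothnessOrder f r)
    (a b : multiIdxLE d (r - 1)) :
    HasLead (fun ε => (Qᵀ * kernelMat f x ε * Q) (Sum.inl a) (Sum.inl b))
      (∑ i, (a : Fin d → ℕ) i + ∑ i, (b : Fin d → ℕ) i) (gradedForm f r x Q a b) := by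
  simp only [conj_apply_eq_sum]
  have ha := mem_multiIdxLE.1 a.2
  have hb := mem_multiIdxLE.1 b.2
  exact hasLead_bilin_of_add_le hf x (h.moment_eq_zero (Sum.inl a)) (h.moment_eq_zero (Sum.inl b))
    (by omega)

/-- Only the order of the mixed entries is ever used. It reaches `2r - 1`, where the distance term
leads, exactly for members of degree `r - 1`. -/
theorem exists_hasLead_inl_inr (h : IsGradedFrame x Q) (hf : HasSmoothnessOrder f r)
    (a : multiIdxLE d (r - 1)) (b : Fin N) :
    ∃ c, HasLead (fun ε => (Qᵀ * kernelMat f x ε * Q) (Sum.inl a) (Sum.inr b))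
      (∑ i, (a : Fin d → ℕ) i + r) c := by
  simp only [conj_apply_eq_sum]
  have ha := mem_multiIdxLE.1 a.2
  rcases Nat.lt_or_ge (2 * r - 2) (∑ i, (a : Fin d → ℕ) i + r) with h1 | h1
  · have h2 : ∑ i, (a : Fin d → ℕ) i + r = 2 * r - 1 := by omega
    rw [h2]
    exact ⟨_, hasLead_bilin_of_le_add hf x (h.moment_eq_zero (Sum.inl a))
      (h.moment_eq_zero (Sum.inr b)) h2.ge⟩
  · exact ⟨_, hasLead_bilin_of_add_le hf x (h.moment_eq_zero (Sum.inl a))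
      (h.moment_eq_zero (Sum.inr b)) h1⟩

theorem conj_kernelMat_symm (ε : ℝ) (a b : multiIdxLE d (r - 1) ⊕ Fin N) :
    (Qᵀ * kernelMat f x ε * Q) a b = (Qᵀ * kernelMat f x ε * Q) b a := by
  have hK : (kernelMat f x ε)ᵀ = kernelMat f x ε := kernelMat_isHermitian f x ε
  rw [← transpose_apply (Qᵀ * kernelMat f x ε * Q), transpose_mul, transpose_mul, hK,
    transpose_transpose, Matrix.mul_assoc]

theorem hasLead_inr_inr (h : IsGradedFrame x Q) (hf : HasSmoothnessOrder f r) (a b : Fin N) :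
    HasLead (fun ε => (Qᵀ * kernelMat f x ε * Q) (Sum.inr a) (Sum.inr b)) (2 * r - 1)
      ((scaledDeriv f (2 * r - 1) • ((Q.submatrix id Sum.inr)ᵀ * distMat x (2 * r - 1) *
        Q.submatrix id Sum.inr)) a b) := by
  rw [Matrix.smul_apply, conj_apply_eq_sum]
  simp only [conj_apply_eq_sum]
  exact hasLead_bilin_of_le_add hf x (h.moment_eq_zero (Sum.inr a)) (h.moment_eq_zero (Sum.inr b))
    (show 2 * r - 1 ≤ r + r by omega)

/-- The leading term of the determinant of the kernel matrix. -/
theorem hasLead_det (h : IsGradedFrame x Q) (hf : HasSmoothnessOrder f r) :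
    HasLead (fun ε => (kernelMat f x ε).det) (2 * totalDegreeSum (r - 1) d + (2 * r - 1) * N)
      ((wronskianMat (radialKernel d f) (r - 1)).det *
        ((vandermondeMat x (multiIdxLE d (r - 1)))ᵀ * vandermondeMat x (multiIdxLE d (r - 1))).det *
        (scaledDeriv f (2 * r - 1) • ((Q.submatrix id Sum.inr)ᵀ * distMat x (2 * r - 1) *
          Q.submatrix id Sum.inr)).det) := by
  have hr := hf.pos
  choose X hX using fun (a : Fin N) (b : multiIdxLE d (r - 1)) => h.exists_hasLead_inl_inr hf b a
  -- The odd order `2r - 1` of the last block is split unevenly, `r` for rows and `r - 1` for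
  -- columns. The upper right block is then one order too small to be seen, so the leading matrix is
  -- block triangular and the constants `X` drop out of its determinant.
  have hlead : ∀ a b, HasLead (fun ε => (Qᵀ * kernelMat f x ε * Q) a b)
      (frameDeg a + Sum.elim (fun α : multiIdxLE d (r - 1) => ∑ i, (α : Fin d → ℕ) i)
        (fun _ : Fin N => r - 1) b)
      (fromBlocks (gradedForm f r x Q) 0 (Matrix.of X)
        (scaledDeriv f (2 * r - 1) • ((Q.submatrix id Sum.inr)ᵀ * distMat x (2 * r - 1) *
          Q.submatrix id Sum.inr)) a b) := by
    rintro (a | a) (b | b)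
    · exact h.hasLead_inl_inl hf a b
    · obtain ⟨c, hc⟩ := h.exists_hasLead_inl_inr hf a b
      exact hc.lower (show ∑ i, (a : Fin d → ℕ) i + (r - 1) < _ by omega)
    · simp only [conj_kernelMat_symm _ (Sum.inr a)]
      have := hX a b
      rw [add_comm] at this
      exact this
    · have := h.hasLead_inr_inr hf a b
      have h2 : 2 * r - 1 = r + (r - 1) := by omega
      rw [fromBlocks_apply₂₂]
      simp only [Sum.elim_inr, frameDeg]
      rw [← h2]
      exact this
  have hdet := HasLead.det hlead
  have h1 : (gradedForm f r x Q).det = (wronskianMat (radialKernel d f) (r - 1)).det *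
      ((vandermondeMat x (multiIdxLE d (r - 1)))ᵀ * vandermondeMat x (multiIdxLE d (r - 1))).det := by
    rw [mul_comm, ← h.det_frameLimit_submatrix hf le_rfl]
    rfl
  rw [det_fromBlocks_zero₁₂, h1] at hdet
  convert hdet using 1
  · ext ε
    exact (det_conj_of_mul_eq_one h.orthogonal h.mul_transpose).symm
  · simp only [Fintype.sum_sum_type, frameDeg, Sum.elim_inl, Sum.elim_inr, Finset.sum_const,
      Finset.card_univ, Fintype.card_fin, smul_eq_mul, totalDegreeSum]
    rw [Finset.sum_coe_sort (multiIdxLE d (r - 1)) fun α => ∑ i, α i]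
    obtain ⟨r', rfl⟩ := Nat.exists_eq_add_of_le' hr
    simp only [Nat.add_sub_cancel, show 2 * (r' + 1) - 1 = 2 * r' + 1 by omega]
    ring

end IsGradedFrame

end GradedForm


/-! ### Variational bounds for the eigenvalues -/

section Bounds

open Matrix

/-- A variational bound for the eigenvalues of a symmetric matrix with orthonormal eigenvectors
`U`: if few members of an orthonormal basis `Q` are discarded, the entries of the compression to the
span of the others bound the later eigenvalues. -/
theorem eigenvalue_le_sum_abs {n : ℕ} {ι : Type*} [Fintype ι] [DecidableEq ι]
    {A U : Matrix (Fin n) (Fin n) ℝ} {μ : Fin n → ℝ} (hμ : Antitone μ) (hU : Uᵀ * U = 1)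
    (hAU : A * U = U * diagonal μ) {Q : Matrix (Fin n) ι ℝ} (hQ : Q * Qᵀ = 1)
    (s : Finset ι) (k : Fin n) (hk : sᶜ.card ≤ k) :
    μ k ≤ ∑ a ∈ s, ∑ b ∈ s, |(Qᵀ * A * Q) a b| := by
  let E : (↥(Finset.Iic k) → ℝ) →ₗ[ℝ] (Fin n → ℝ) :=
    { toFun := fun w j => if h : j ∈ Finset.Iic k then w ⟨j, h⟩ else 0
      map_add' := fun w w' => by
        ext j
        by_cases h : j ∈ Finset.Iic k
        · simp only [Pi.add_apply, dif_pos h]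
        · simp only [Pi.add_apply, dif_neg h, add_zero]
      map_smul' := fun t w => by
        ext j
        by_cases h : j ∈ Finset.Iic k
        · simp only [Pi.smul_apply, dif_pos h, RingHom.id_apply]
        · simp only [Pi.smul_apply, dif_neg h, smul_zero] }
  let T : (↥(Finset.Iic k) → ℝ) →ₗ[ℝ] (↥sᶜ → ℝ) :=
    (LinearMap.funLeft ℝ ℝ (Subtype.val : ↥sᶜ → ι)) ∘ₗ (Qᵀ * U).mulVecLin ∘ₗ E
  -- Among the first `k + 1` eigenvectors there are more unknowns than discarded members, so some
  -- nonzero combination is orthogonal to all of the latter.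
  have hT : LinearMap.ker T ≠ ⊥ := by
    apply LinearMap.ker_ne_bot_of_finrank_lt
    rw [Module.finrank_fintype_fun_eq_card, Module.finrank_fintype_fun_eq_card, Fintype.card_coe,
      Fintype.card_coe, Fin.card_Iic]
    omega
  obtain ⟨w, hw, hw0⟩ := (Submodule.ne_bot_iff _).1 hT
  have hz : ∀ j, k < j → E w j = 0 := by
    intro j hj
    exact dif_neg (by simpa using hj)
  set z := E w
  have hz0 : z ≠ 0 := by
    intro h
    refine hw0 (funext fun j => ?_)
    have h1 : z j = w j := dif_pos j.2
    rw [← h1, h]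
    rfl
  set c := (Qᵀ * U) *ᵥ z with hc
  have hcs : ∀ a ∉ s, c a = 0 := by
    intro a ha
    exact congrFun (LinearMap.mem_ker.1 hw) ⟨a, by simpa using ha⟩
  have hcc : c ⬝ᵥ c = z ⬝ᵥ z := by
    rw [hc, dotProduct_mulVec, vecMul_mulVec, transpose_mul, transpose_transpose,
      Matrix.mul_assoc, ← Matrix.mul_assoc Q, hQ, Matrix.one_mul, hU, Matrix.vecMul_one]
  have hcA : c ⬝ᵥ ((Qᵀ * A * Q) *ᵥ c) = ∑ j, μ j * z j ^ 2 := by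
    have h1 : (Qᵀ * U)ᵀ * (Qᵀ * A * Q * (Qᵀ * U)) = diagonal μ := by
      calc (Qᵀ * U)ᵀ * (Qᵀ * A * Q * (Qᵀ * U)) = Uᵀ * (Q * Qᵀ) * A * (Q * Qᵀ) * U := by
            simp only [transpose_mul, transpose_transpose, Matrix.mul_assoc]
        _ = Uᵀ * (A * U) := by rw [hQ, Matrix.mul_one, Matrix.mul_one, Matrix.mul_assoc]
        _ = diagonal μ := by rw [hAU, ← Matrix.mul_assoc, hU, Matrix.one_mul]
    rw [hc, mulVec_mulVec, dotProduct_mulVec, vecMul_mulVec, h1]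
    simp only [dotProduct, vecMul_diagonal]
    exact Finset.sum_congr rfl fun j _ => by ring
  have hpos : 0 < z ⬝ᵥ z :=
    lt_of_le_of_ne (Finset.sum_nonneg fun _ _ => mul_self_nonneg _)
      fun h => hz0 (dotProduct_self_eq_zero.1 h.symm)
  have hlow : μ k * (z ⬝ᵥ z) ≤ ∑ j, μ j * z j ^ 2 := by
    rw [dotProduct, Finset.mul_sum]
    refine Finset.sum_le_sum fun j _ => ?_
    rcases lt_or_ge k j with h | h
    · simp [hz j h]
    · rw [← sq]
      exact mul_le_mul_of_nonneg_right (hμ h) (sq_nonneg _)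
  have hle : ∀ a, c a ^ 2 ≤ c ⬝ᵥ c := fun a => by
    rw [dotProduct, sq]
    exact Finset.single_le_sum (f := fun a => c a * c a) (fun b _ => mul_self_nonneg _)
      (Finset.mem_univ a)
  have hup : c ⬝ᵥ ((Qᵀ * A * Q) *ᵥ c) ≤ (∑ a ∈ s, ∑ b ∈ s, |(Qᵀ * A * Q) a b|) * (c ⬝ᵥ c) := by
    have h1 : c ⬝ᵥ ((Qᵀ * A * Q) *ᵥ c) = ∑ a ∈ s, ∑ b ∈ s, c a * ((Qᵀ * A * Q) a b * c b) := by
      simp only [dotProduct, mulVec, Finset.mul_sum]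
      rw [← Finset.sum_subset (Finset.subset_univ s)]
      · refine Finset.sum_congr rfl fun a _ => ?_
        rw [← Finset.sum_subset (Finset.subset_univ s)]
        intro b _ hb
        simp [hcs b hb]
      · intro a _ ha
        simp [hcs a ha]
    rw [h1, Finset.sum_mul]
    refine Finset.sum_le_sum fun a _ => ?_
    rw [Finset.sum_mul]
    refine Finset.sum_le_sum fun b _ => ?_
    calc c a * ((Qᵀ * A * Q) a b * c b) = (Qᵀ * A * Q) a b * (c a * c b) := by ring
      _ ≤ |(Qᵀ * A * Q) a b| * |c a * c b| := (le_abs_self _).trans (abs_mul _ _).le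
      _ ≤ _ := by
        refine mul_le_mul_of_nonneg_left ?_ (abs_nonneg _)
        rw [abs_le]
        constructor <;> nlinarith [hle a, hle b, sq_nonneg (c a + c b), sq_nonneg (c a - c b)]
  rw [hcA, hcc] at hup
  exact le_of_mul_le_mul_right (hlow.trans hup) hpos

theorem card_frameDeg_lt {d r N s : ℕ} (hs : s ≤ r) :
    (Finset.univ.filter fun a : multiIdxLE d (r - 1) ⊕ Fin N => frameDeg a < s).card =
      (multiIdxLT d s).card := by
  symm
  refine Finset.card_bij (fun α hα => Sum.inl ⟨α, mem_multiIdxLE.2 ?_⟩) ?_ ?_ ?_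
  · have := mem_multiIdxLT.1 hα
    omega
  · intro α hα
    exact Finset.mem_filter.2 ⟨Finset.mem_univ _, mem_multiIdxLT.1 hα⟩
  · intro α _ β _ h
    exact Subtype.mk.inj (Sum.inl_injective h)
  · rintro (a | a) ha
    · exact ⟨a, mem_multiIdxLT.2 (Finset.mem_filter.1 ha).2, rfl⟩
    · have : r < s := (Finset.mem_filter.1 ha).2
      omega

namespace IsGradedFrame

variable {d n r N : ℕ} {x : Fin n → EuclideanSpace ℝ (Fin d)}
  {Q : Matrix (Fin n) (multiIdxLE d (r - 1) ⊕ Fin N) ℝ} {f : ℝ → ℝ}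

theorem isBigO_conj (h : IsGradedFrame x Q) (hf : HasSmoothnessOrder f r) {s : ℕ}
    {a b : multiIdxLE d (r - 1) ⊕ Fin N} (ha : s ≤ frameDeg a) (hb : s ≤ frameDeg b) :
    (fun ε => (Qᵀ * kernelMat f x ε * Q) a b) =O[𝓝 0] fun ε : ℝ => ε ^ min (2 * s) (2 * r - 1) := by
  have key : ∀ {F : ℝ → ℝ} {m : ℕ} {c : ℝ}, HasLead F m c → min (2 * s) (2 * r - 1) ≤ m →
      F =O[𝓝 0] fun ε : ℝ => ε ^ min (2 * s) (2 * r - 1) := fun hF hm =>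
    hF.isBigO.trans (isBigO_pow_pow_nhds_zero hm)
  rcases a with a | a <;> rcases b with b | b
  · exact key (h.hasLead_inl_inl hf a b) (by simp only [frameDeg, Sum.elim_inl] at ha hb; omega)
  · obtain ⟨c, hc⟩ := h.exists_hasLead_inl_inr hf a b
    exact key hc (by simp only [frameDeg, Sum.elim_inl, Sum.elim_inr] at ha hb; omega)
  · obtain ⟨c, hc⟩ := h.exists_hasLead_inl_inr hf b a
    simp only [conj_kernelMat_symm _ (Sum.inr a)]
    exact key hc (by simp only [frameDeg, Sum.elim_inl, Sum.elim_inr] at ha hb; omega)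
  · exact key (h.hasLead_inr_inr hf a b) (by omega)

/-- Discarding the members of degree less than `s` leaves a compression of the required order;
nonnegativity turns the upper bound into a bound of the modulus. The filter is kept general to serve
both the sorted eigenvalues and the analytic branches. -/
theorem eigenvalue_isBigO (h : IsGradedFrame x Q) (hf : HasSmoothnessOrder f r) {l : Filter ℝ}
    (hl : l ≤ 𝓝 0) {lam : Fin n → ℝ → ℝ} {k : Fin n} {s : ℕ} (hs : s ≤ r)
    (hk : (multiIdxLT d s).card ≤ k)
    (hU : ∀ᶠ ε in l, ∃ U : Matrix (Fin n) (Fin n) ℝ, Uᵀ * U = 1 ∧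
      kernelMat f x ε * U = U * diagonal fun k => lam k ε)
    (hanti : ∀ᶠ ε in l, Antitone fun k => lam k ε) (hnn : ∀ᶠ ε in l, 0 ≤ lam k ε) :
    lam k =O[l] fun ε : ℝ => ε ^ min (2 * s) (2 * r - 1) := by
  set T := Finset.univ.filter fun a : multiIdxLE d (r - 1) ⊕ Fin N => s ≤ frameDeg a
  have hT : Tᶜ.card ≤ k := by
    have : Tᶜ = Finset.univ.filter fun a : multiIdxLE d (r - 1) ⊕ Fin N => frameDeg a < s := by
      ext a
      simp [T]
    rw [this, card_frameDeg_lt hs]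
    exact hk
  have h1 : (fun ε => ∑ a ∈ T, ∑ b ∈ T, |(Qᵀ * kernelMat f x ε * Q) a b|) =O[l]
      fun ε : ℝ => ε ^ min (2 * s) (2 * r - 1) := by
    refine IsBigO.fun_sum fun a ha => IsBigO.fun_sum fun b hb => ?_
    exact ((h.isBigO_conj hf (Finset.mem_filter.1 ha).2 (Finset.mem_filter.1 hb).2).mono hl).abs_left
  refine IsBigO.trans (IsBigO.of_bound 1 ?_) h1
  filter_upwards [hU, hanti, hnn] with ε ⟨U, hU1, hU2⟩ h2 h3
  rw [one_mul, Real.norm_of_nonneg h3]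
  exact (eigenvalue_le_sum_abs h2 hU1 hU2 h.mul_transpose T k hT).trans (le_abs_self _)

end IsGradedFrame

theorem exists_orthogonal_kernelEigenvalue {d n : ℕ} (f : ℝ → ℝ)
    (x : Fin n → EuclideanSpace ℝ (Fin d)) (ε : ℝ) :
    ∃ U : Matrix (Fin n) (Fin n) ℝ, Uᵀ * U = 1 ∧
      kernelMat f x ε * U = U * diagonal fun k => kernelEigenvalue f x k ε := by
  have hA := kernelMat_isHermitian f x ε
  let e : Fin n ≃ Fin n := (finCongr (Fintype.card_fin n).symm).trans
    (Fintype.equivOfCardEq (Fintype.card_fin _))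
  refine ⟨Matrix.of fun i k => hA.eigenvectorBasis (e k) i, ?_, ?_⟩
  · ext a c
    have h := (orthonormal_iff_ite.1 hA.eigenvectorBasis.orthonormal) (e c) (e a)
    simp only [PiLp.inner_apply, RCLike.inner_apply, conj_trivial] at h
    simp only [Matrix.mul_apply, transpose_apply, of_apply, one_apply]
    rw [h]
    simp [eq_comm]
  · ext i k
    have h := congrFun (hA.mulVec_eigenvectorBasis (e k)) i
    rw [mul_diagonal]
    have hlam : hA.eigenvalues (e k) = kernelEigenvalue f x k ε := by
      simp [IsHermitian.eigenvalues, kernelEigenvalue, e]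
    rw [hlam] at h
    refine Eq.trans h ?_
    rw [Pi.smul_apply, smul_eq_mul, mul_comm]
    rfl

theorem antitone_kernelEigenvalue {d n : ℕ} (f : ℝ → ℝ)
    (x : Fin n → EuclideanSpace ℝ (Fin d)) (ε : ℝ) :
    Antitone fun k => kernelEigenvalue f x k ε := fun _ _ h =>
  (kernelMat_isHermitian f x ε).eigenvalues₀_antitone h

theorem eigenvalue_nonneg_of_posSemidef {n : ℕ} {A U : Matrix (Fin n) (Fin n) ℝ} {μ : Fin n → ℝ}
    (hA : A.PosSemidef) (hU : Uᵀ * U = 1) (hAU : A * U = U * diagonal μ) (k : Fin n) : 0 ≤ μ k := by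
  have h : (Uᵀ * A * U) k k = μ k := by
    rw [Matrix.mul_assoc, hAU, ← Matrix.mul_assoc, hU, Matrix.one_mul, diagonal_apply_eq]
  rw [← h]
  have := (hA.conjTranspose_mul_mul_same U).diag_nonneg (i := k)
  simpa using this

end Bounds


/-! ### Analytic eigenvalue decompositions and the positions of the groups -/

section LimitingVectors

open Matrix

theorem exists_eq_vecMulVec_of_rank_one {n : ℕ} {P : Matrix (Fin n) (Fin n) ℝ} (hs : Pᵀ = P)
    (hi : P * P = P) (hr : P.rank = 1) : ∃ u : Fin n → ℝ, P = vecMulVec u u ∧ u ⬝ᵥ u = 1 := by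
  obtain ⟨⟨v, w0, hw0⟩, hv0, hv⟩ := finrank_eq_one_iff'.1 hr
  have hv0' : v ≠ 0 := fun h => hv0 (Subtype.ext h)
  have hPv : P *ᵥ v = v := by
    rw [← hw0, mulVecLin_apply, mulVec_mulVec, hi]
  have hpos : 0 < v ⬝ᵥ v := lt_of_le_of_ne (Finset.sum_nonneg fun _ _ => mul_self_nonneg _)
    fun h => hv0' (dotProduct_self_eq_zero.1 h.symm)
  set t := (√(v ⬝ᵥ v))⁻¹
  have ht : t * (t * (v ⬝ᵥ v)) = 1 := by
    have h1 : √(v ⬝ᵥ v) ≠ 0 := (Real.sqrt_pos.2 hpos).ne'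
    have h2 := Real.mul_self_sqrt hpos.le
    simp only [t]
    field_simp
    nlinarith
  set u := t • v with hu
  have huu : u ⬝ᵥ u = 1 := by
    rw [hu, smul_dotProduct, dotProduct_smul, smul_eq_mul, smul_eq_mul, ht]
  have ht0 : t ≠ 0 := by
    intro h
    simp [h] at ht
  choose c hc using fun j => hv ⟨P *ᵥ Pi.single j 1, ⟨_, rfl⟩⟩
  have hP : P = vecMulVec u fun j => c j / t := by
    ext i j
    have h := congrFun (congrArg Subtype.val (hc j)) i
    simp only [mulVec_single_one] at h
    rw [vecMulVec_apply, hu, Pi.smul_apply, smul_eq_mul]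
    have h' : c j * v i = P i j := h
    rw [← h']
    field_simp
  have hPu : P *ᵥ u = u := by rw [hu, mulVec_smul, hPv]
  have hcu : (fun j => c j / t) = u := by
    have h := hPu
    rw [← hs, hP, transpose_vecMulVec, vecMulVec_mulVec, huu] at h
    simpa using h
  rw [hcu] at hP
  exact ⟨u, hP, huu⟩

theorem orthonormal_of_vecMulVec {n : ℕ} {P : Fin n → Matrix (Fin n) (Fin n) ℝ}
    {u : Fin n → Fin n → ℝ} (hu : ∀ k, P k = vecMulVec (u k) (u k)) (huu : ∀ k, u k ⬝ᵥ u k = 1)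
    (ho : ∀ k l, k ≠ l → P k * P l = 0) :
    (Matrix.of fun i k => u k i)ᵀ * (Matrix.of fun i k => u k i) = 1 := by
  ext k l
  change u k ⬝ᵥ u l = _
  by_cases h : k = l
  · subst h
    rw [huu, one_apply_eq]
  · rw [one_apply_ne h]
    have h1 := congrArg (fun M => u k ⬝ᵥ (M *ᵥ u l)) (ho k l h)
    simp only [← mulVec_mulVec, hu, vecMulVec_mulVec, huu, zero_mulVec, dotProduct_zero] at h1
    simpa [huu, dotProduct_smul] using h1

namespace IsAnalyticEVD

variable {n : ℕ} {A : ℝ → Matrix (Fin n) (Fin n) ℝ} {lam : Fin n → ℝ → ℝ}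
  {P : Fin n → ℝ → Matrix (Fin n) (Fin n) ℝ} {p : Fin n → Fin n → ℝ}

theorem eventually_exists_orthogonal (h : IsAnalyticEVD A lam P p) :
    ∀ᶠ ε in 𝓝 (0 : ℝ), ∃ U : Matrix (Fin n) (Fin n) ℝ, Uᵀ * U = 1 ∧
      A ε * U = U * diagonal (fun k => lam k ε) ∧
      ∀ k, P k ε = vecMulVec (fun i => U i k) fun i => U i k := by
  filter_upwards [h.symm, h.idem, h.rank_one, h.orthogonal, h.evd] with ε h1 h2 h3 h4 h5
  choose u hu huu using fun k => exists_eq_vecMulVec_of_rank_one (h1 k) (h2 k) (h3 k)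
  have hU := orthonormal_of_vecMulVec hu huu h4
  refine ⟨Matrix.of fun i k => u k i, hU, ?_, hu⟩
  ext i k
  rw [mul_diagonal, h5]
  change ((∑ k, lam k ε • P k ε) *ᵥ u k) i = u k i * lam k ε
  have hPu : ∀ l, P l ε *ᵥ u k = if l = k then u k else 0 := by
    intro l
    have h6 : u l ⬝ᵥ u k = (1 : Matrix (Fin n) (Fin n) ℝ) l k := by
      rw [← hU]
      rfl
    rw [hu, vecMulVec_mulVec, h6]
    split_ifs with hlk
    · subst hlk
      simp
    · simp [one_apply_ne hlk]
  rw [sum_mulVec]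
  simp only [smul_mulVec, hPu]
  rw [Finset.sum_apply, Finset.sum_eq_single k (fun l _ hl => by simp [hl]) (by simp)]
  simp [mul_comm]

theorem eventually_det (h : IsAnalyticEVD A lam P p) :
    ∀ᶠ ε in 𝓝 (0 : ℝ), ∀ z : ℝ, (z • (1 : Matrix (Fin n) (Fin n) ℝ) - A ε).det =
      ∏ k, (z - lam k ε) := by
  filter_upwards [h.eventually_exists_orthogonal] with ε ⟨U, hU, hAU, _⟩ z
  have hU' := mul_transpose_eq_one_of_card rfl hU
  have h1 : Uᵀ * (z • (1 : Matrix (Fin n) (Fin n) ℝ) - A ε) * U =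
      diagonal fun k => z - lam k ε := by
    rw [Matrix.mul_sub, Matrix.sub_mul, Matrix.mul_smul, Matrix.mul_one, Matrix.smul_mul,
      Matrix.mul_assoc Uᵀ, hAU, ← Matrix.mul_assoc, hU, Matrix.one_mul]
    ext i j
    by_cases hij : i = j
    · subst hij
      simp
    · simp [hij]
  rw [← det_conj_of_mul_eq_one hU hU', h1, det_diagonal]

theorem limit_orthonormal (h : IsAnalyticEVD A lam P p) :
    (Matrix.of fun i k => p k i)ᵀ * (Matrix.of fun i k => p k i) = 1 := by
  refine orthonormal_of_vecMulVec h.limit (fun k => ?_) h.orthogonal.self_of_nhds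
  have h1 := h.idem.self_of_nhds k
  have h2 := h.rank_one.self_of_nhds k
  obtain ⟨u, hu, huu⟩ := exists_eq_vecMulVec_of_rank_one (h.symm.self_of_nhds k) h1 h2
  -- The trace of a rank-one projector is `1`, which forces the limiting vector to have unit length.
  have h3 := congrArg Matrix.trace (h.limit k)
  rw [hu, trace_vecMulVec, trace_vecMulVec, huu] at h3
  exact h3.symm

end IsAnalyticEVD

/-- An analytic function that is not locally zero has an exact order of vanishing. A one-sided bound
already rules out an order below `m`, so it yields a two-sided expansion. -/
theorem hasLead_of_analyticAt {F : ℝ → ℝ} (hF : AnalyticAt ℝ F 0) {m : ℕ}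
    (hO : F =O[𝓝[>] 0] fun ε : ℝ => ε ^ m) : ∃ c, HasLead F m c := by
  by_cases h0 : ∀ᶠ ε in 𝓝 (0 : ℝ), F ε = 0
  · refine ⟨0, HasLead.zero.congr ?_⟩
    filter_upwards [h0] with ε hε
    exact hε.symm
  obtain ⟨k, g, hg, hg0, hFg⟩ :=
    (hF.exists_eventuallyEq_pow_smul_nonzero_iff).2 h0
  simp only [sub_zero, smul_eq_mul] at hFg
  have hlead : HasLead F k (g 0) := by
    have h1 : (fun ε => g ε - g 0) =O[𝓝 0] fun ε : ℝ => ε := by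
      simpa using hg.differentiableAt.isBigO_sub
    have h2 := (isBigO_refl (fun ε : ℝ => ε ^ k) (𝓝 0)).mul h1
    refine h2.congr' ?_ (Eventually.of_forall fun ε => (pow_succ ε k).symm)
    filter_upwards [hFg] with ε hε
    rw [hε]
    ring
  rcases lt_trichotomy k m with hkm | rfl | hkm
  · exfalso
    have h1 : Tendsto (fun t : ℝ => F t / t ^ k) (𝓝[>] 0) (𝓝 0) := by
      have h2 : (fun t : ℝ => t ^ m) =o[𝓝[>] 0] fun t : ℝ => t ^ k :=
        (isLittleO_pow_pow hkm).mono nhdsWithin_le_nhds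
      exact (hO.trans_isLittleO h2).tendsto_div_nhds_zero
    exact hg0 (tendsto_nhds_unique hlead.tendsto_div h1)
  · exact ⟨_, hlead⟩
  · exact ⟨0, hlead.lower hkm⟩

/-- The set `{g < s}` is an initial segment. This translates the cardinalities that delimit the
groups into degrees of frame members. -/
theorem Monotone.lt_card_filter_lt_iff {n : ℕ} {g : Fin n → ℕ} (hg : Monotone g) (k : Fin n)
    (s : ℕ) : (k : ℕ) < (Finset.univ.filter fun j => g j < s).card ↔ g k < s := by
  constructor
  · intro h
    by_contra! hk
    have h1 : (Finset.univ.filter fun j => g j < s) ⊆ Finset.Iio k := fun j hj => by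
      have h2 := (Finset.mem_filter.1 hj).2
      rw [Finset.mem_Iio]
      by_contra! h3
      exact absurd (hk.trans (hg h3)) (not_le.2 h2)
    have h2 := Finset.card_le_card h1
    rw [Fin.card_Iio] at h2
    omega
  · intro h
    have h1 : Finset.Iic k ⊆ Finset.univ.filter fun j => g j < s := fun j hj =>
      Finset.mem_filter.2 ⟨Finset.mem_univ _, (hg (Finset.mem_Iic.1 hj)).trans_lt h⟩
    have h2 := Finset.card_le_card h1
    rw [Fin.card_Iic] at h2
    omega

section Groups

variable {d n r N : ℕ} {σ : Fin n ≃ multiIdxLE d (r - 1) ⊕ Fin N}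

theorem lt_card_multiIdxLT_iff (hσ : Monotone (frameDeg ∘ σ)) (k : Fin n)
    {s : ℕ} (hs : s ≤ r) :
    (k : ℕ) < (multiIdxLT d s).card ↔ frameDeg (σ k) < s := by
  rw [← card_frameDeg_lt (N := N) hs]
  refine Iff.trans ?_ (hσ.lt_card_filter_lt_iff k s)
  have h : (Finset.univ.filter fun a : multiIdxLE d (r - 1) ⊕ Fin N => frameDeg a < s) =
      (Finset.univ.filter fun j => (frameDeg ∘ σ) j < s).map σ.toEmbedding := by
    ext a
    simp [Finset.mem_map_equiv]
  rw [h, Finset.card_map]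

theorem mem_evGroup_iff (hσ : Monotone (frameDeg ∘ σ)) (k : Fin n)
    {s : ℕ} (hs : s < r) : k ∈ evGroup d n s ↔ frameDeg (σ k) = s := by
  have h1 := lt_card_multiIdxLT_iff hσ k hs.le
  have h2 := lt_card_multiIdxLT_iff hσ k (s := s + 1) hs
  have h3 : k ∈ evGroup d n s ↔
      (multiIdxLT d s).card ≤ k ∧ (k : ℕ) < (multiIdxLT d (s + 1)).card :=
    Finset.mem_filter.trans (and_iff_right (Finset.mem_univ _))
  rw [h3, h2, ← not_lt, h1]
  omega

theorem frameDeg_le (hr : 1 ≤ r) (a : multiIdxLE d (r - 1) ⊕ Fin N) : frameDeg a ≤ r := by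
  rcases a with a | a
  · exact (degree_lt hr a).le
  · exact le_rfl

theorem mem_evLastGroup_iff (hσ : Monotone (frameDeg ∘ σ)) (k : Fin n)
    (hr : 1 ≤ r) : k ∈ evLastGroup d n r ↔ frameDeg (σ k) = r := by
  have h1 := lt_card_multiIdxLT_iff hσ k le_rfl
  have h2 := frameDeg_le hr (σ k)
  simp only [evLastGroup, Finset.mem_filter, Finset.mem_univ, true_and]
  rw [← not_lt, h1]
  omega

end Groups

end LimitingVectors


/-! ### Consequences of the pencil identity -/

section Pencil

open Matrix

variable {ι τ : Type*} [Fintype ι] [DecidableEq ι] [Fintype τ] [DecidableEq τ]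
  {A : ℝ → Matrix ι ι ℝ} {L : Matrix ι ι ℝ} {e : ι → ℕ}

/-- Capping the exponents at `t` makes the leading coefficients beyond level `t` vanish; there the
pencil is `z` times the identity, and the powers of `z` cancel from both sides. -/
theorem det_pencil_submatrix_eq_prod {lam : ι → ℝ → ℝ} {main : ι → ℝ}
    (hA : ∀ a b, HasLead (fun η => A η a b) (e a + e b) (L a b))
    (hlam : ∀ a, HasLead (lam a) (2 * e a) (main a))
    (hdet : ∀ᶠ η in 𝓝 (0 : ℝ), ∀ z : ℝ, (z • (1 : Matrix ι ι ℝ) - A η).det = ∏ a, (z - lam a η))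
    {t : ℕ} {j : τ → ι} (hj : Function.Injective j) (hrange : ∀ a, a ∈ Set.range j ↔ e a ≤ t)
    {z : ℝ} (hz : z ≠ 0) :
    (diagonal (fun a => if e (j a) = t then z else 0) - L.submatrix j j).det =
      ∏ a, ((if e (j a) = t then z else 0) - main (j a)) := by
  have h := det_pencil_eq_prod (A := A)
    (L := Matrix.of fun a b => if e a ≤ t ∧ e b ≤ t then L a b else 0) (lam := lam)
    (main := fun a => if e a ≤ t then main a else 0) (e := fun a => min (e a) t) (t := t)
    (fun a => min_le_right _ _)
    (by
      intro a b
      rw [of_apply]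
      split_ifs with h
      · rw [min_eq_left h.1, min_eq_left h.2]
        exact hA a b
      · exact (hA a b).lower (by omega))
    (by
      intro a
      split_ifs with h
      · rw [min_eq_left h]
        exact hlam a
      · exact (hlam a).lower (by omega)) hdet z
  rw [twoBlockTriangular_det _ (fun a => e a ≤ t)
    (by
      intro a ha b hb
      have hab : a ≠ b := fun h => ha (h ▸ hb)
      simp [hab, ha]),
    ← Fintype.prod_subtype_mul_prod_subtype (fun a => e a ≤ t)] at h
  have h2 : (toSquareBlockProp (z • diagonal (fun a => if min (e a) t = t then (1 : ℝ) else 0) -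
      Matrix.of fun a b => if e a ≤ t ∧ e b ≤ t then L a b else 0) fun a => ¬e a ≤ t) =
      diagonal fun _ => z := by
    ext ⟨a, ha⟩ ⟨b, hb⟩
    have h3 : min (e a) t = t := by omega
    by_cases hab : a = b
    · subst hab
      simpa [toSquareBlockProp, ha] using fun h : e a < t => absurd h.le ha
    · simp [toSquareBlockProp, ha, hab]
  have h4 : (∏ a : {a // ¬e a ≤ t}, ((if min (e a) t = t then z else 0) -
      if e (a : ι) ≤ t then main a else 0)) = ∏ _a : {a // ¬e a ≤ t}, z := by
    refine Finset.prod_congr rfl fun a _ => ?_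
    have h3 : min (e a) t = t := by have := a.2; omega
    rw [if_pos h3, if_neg a.2, sub_zero]
  rw [h2, det_diagonal, h4] at h
  have h5 := mul_right_cancel₀ (Finset.prod_ne_zero_iff.2 fun _ _ => hz) h
  let φ : τ ≃ {a // e a ≤ t} := (Equiv.ofInjective j hj).trans (Equiv.subtypeEquivRight hrange)
  rw [← Equiv.prod_comp φ, ← det_submatrix_equiv_self φ] at h5
  have h6 : ∀ a : τ, ((φ a : {a // e a ≤ t}) : ι) = j a := fun a => rfl
  have h7 : ∀ a : τ, e (j a) ≤ t := fun a => (hrange _).1 ⟨a, rfl⟩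
  have h8 : ∀ a : τ, (min (e (j a)) t = t) = (e (j a) = t) := fun a => by
    rw [min_eq_left (h7 a)]
  convert h5 using 2
  · ext a b
    simp only [Matrix.sub_apply, submatrix_apply, toSquareBlockProp_def, of_apply, h6, h7,
      Matrix.smul_apply, diagonal_apply, hj.eq_iff, h8, if_true, and_self, smul_eq_mul]
    split_ifs <;> simp
  · simp only [h6, h7, h8, if_true]

/-- At a level `t` that no exponent attains, `z` disappears from the truncated pencil. -/
theorem det_submatrix_eq_prod {lam : ι → ℝ → ℝ} {main : ι → ℝ}
    (hA : ∀ a b, HasLead (fun η => A η a b) (e a + e b) (L a b))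
    (hlam : ∀ a, HasLead (lam a) (2 * e a) (main a))
    (hdet : ∀ᶠ η in 𝓝 (0 : ℝ), ∀ z : ℝ, (z • (1 : Matrix ι ι ℝ) - A η).det = ∏ a, (z - lam a η))
    {t : ℕ} {j : τ → ι} (hj : Function.Injective j) (hrange : ∀ a, a ∈ Set.range j ↔ e a < t)
    (ht : ∀ a, e a ≠ t) : (L.submatrix j j).det = ∏ a, main (j a) := by
  have h := det_pencil_submatrix_eq_prod hA hlam hdet (t := t) hj
    (fun a => (hrange a).trans ⟨le_of_lt, fun h => lt_of_le_of_ne h (ht a)⟩) one_ne_zero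
  simp only [ht, if_false, diagonal_zero, zero_sub, det_neg, Finset.prod_neg,
    Finset.card_univ] at h
  exact mul_left_cancel₀ (pow_ne_zero _ (by norm_num)) h

/-- At an attained level the truncated pencil has `z` only in its last diagonal block. Its
determinant factors through the Schur complement, and the remaining factor `det L_{jj}` cancels
against the main terms of lower level. -/
theorem charpoly_schur_roots {κ : Type*} [Fintype κ] [DecidableEq κ] {lam : ι → ℝ → ℝ}
    {main : ι → ℝ} (hA : ∀ a b, HasLead (fun η => A η a b) (e a + e b) (L a b))
    (hlam : ∀ a, HasLead (lam a) (2 * e a) (main a))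
    (hdet : ∀ᶠ η in 𝓝 (0 : ℝ), ∀ z : ℝ, (z • (1 : Matrix ι ι ℝ) - A η).det = ∏ a, (z - lam a η))
    {t : ℕ} {j : τ → ι} (hj : Function.Injective j) (hrange : ∀ a, a ∈ Set.range j ↔ e a < t)
    {i : κ → ι} (hi : Function.Injective i) (hrange' : ∀ a, a ∈ Set.range i ↔ e a = t)
    (hL : (L.submatrix j j).det ≠ 0) (hL' : (L.submatrix j j).det = ∏ a, main (j a)) :
    (L.submatrix i i - L.submatrix i j * (L.submatrix j j)⁻¹ * L.submatrix j i).charpoly.roots =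
      Finset.univ.val.map fun a => main (i a) := by
  set S := L.submatrix i i - L.submatrix i j * (L.submatrix j j)⁻¹ * L.submatrix j i
  have hejt : ∀ a, e (j a) ≠ t := fun a => ((hrange _).1 ⟨a, rfl⟩).ne
  have heit : ∀ a, e (i a) = t := fun a => (hrange' _).1 ⟨a, rfl⟩
  have key : ∀ z : ℝ, z ≠ 0 → (z • (1 : Matrix κ κ ℝ) - S).det = ∏ a, (z - main (i a)) := by
    intro z hz
    have hij : Function.Injective (Sum.elim j i) := by
      refine hj.sumElim hi fun a b hab => hejt a ?_
      rw [hab, heit]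
    have h := det_pencil_submatrix_eq_prod hA hlam hdet (t := t) hij
      (fun a => by
        rw [Set.Sum.elim_range, Set.mem_union, hrange, hrange', ← le_iff_lt_or_eq]) hz
    have hM : diagonal (fun a => if e (Sum.elim j i a) = t then z else 0) -
        L.submatrix (Sum.elim j i) (Sum.elim j i) =
        fromBlocks (-L.submatrix j j) (-L.submatrix j i) (-L.submatrix i j)
          (z • (1 : Matrix κ κ ℝ) - L.submatrix i i) := by
      ext (a | a) (b | b)
      · simp [diagonal_apply, hejt]
      · simp
      · simp
      · simp [diagonal_apply, one_apply, heit]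
    have : Invertible (-L.submatrix j j) := by
      refine ((Matrix.isUnit_iff_isUnit_det _).2 ?_).invertible
      rw [det_neg]
      exact (isUnit_iff_ne_zero.2 (mul_ne_zero (pow_ne_zero _ (by norm_num)) hL))
    rw [hM, det_fromBlocks₁₁, Fintype.prod_sum_type] at h
    simp only [Sum.elim_inl, Sum.elim_inr, hejt, heit, if_true, if_false, zero_sub, Finset.prod_neg,
      Finset.card_univ, ← hL', det_neg] at h
    have h1 := mul_left_cancel₀ (mul_ne_zero (pow_ne_zero _ (by norm_num)) hL) h
    rw [← h1, invOf_eq_nonsing_inv]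
    congr 1
    have hinv : (-L.submatrix j j)⁻¹ = -(L.submatrix j j)⁻¹ := by
      refine inv_eq_left_inv ?_
      rw [neg_mul_neg, nonsing_inv_mul _ (isUnit_iff_ne_zero.2 hL)]
    rw [hinv]
    simp only [S, Matrix.neg_mul, Matrix.mul_neg, neg_neg]
    abel
  have hpoly : S.charpoly = (Finset.univ.val.map fun a => Polynomial.X -
      Polynomial.C (main (i a))).prod := by
    -- The value `z = 0` was excluded by the cancellation of powers of `z`; infinitely many others
    -- suffice.
    refine Polynomial.eq_of_infinite_eval_eq _ _
      (Set.Infinite.mono ?_ (Set.finite_singleton (0 : ℝ)).infinite_compl)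
    intro z hz
    have h1 := key z hz
    rw [Set.mem_ofPred_eq, eval_charpoly, ← Finset.prod_eq_multiset_prod, Polynomial.eval_prod]
    simp only [Polynomial.eval_sub, Polynomial.eval_X, Polynomial.eval_C]
    rw [← h1]
    congr 2
    ext a b
    simp [diagonal_apply, one_apply]
  have h2 := Polynomial.roots_multiset_prod_X_sub_C (Finset.univ.val.map fun a => main (i a))
  rw [hpoly, ← h2, Multiset.map_map]
  rfl

omit [DecidableEq ι] in
/-- The low components of a limit of eigenvectors vanish when the eigenvalues are of high order. -/
theorem limit_eigenvector_apply_eq_zero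
    (hA : ∀ a b, HasLead (fun η => A η a b) (e a + e b) (L a b)) {t m : ℕ}
    {j : τ → ι} (hj : Function.Injective j) (hrange : ∀ a, a ∈ Set.range j ↔ e a ≤ t)
    (hL : (L.submatrix j j).det ≠ 0) {μ : ℝ → ℝ} {μ₀ : ℝ} (hμ : HasLead μ (2 * m) μ₀) (hm : t < m)
    {v : ℝ → ι → ℝ} {v₀ : ι → ℝ} (hv : ∀ a, Tendsto (fun η => v η a) (𝓝[>] 0) (𝓝 (v₀ a)))
    (heig : ∀ᶠ η in 𝓝[>] (0 : ℝ), A η *ᵥ v η = μ η • v η) (b : τ) : v₀ (j b) = 0 := by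
  have hpow : ∀ k : ℕ, 0 < k → Tendsto (fun η : ℝ => η ^ k) (𝓝[>] 0) (𝓝 0) := by
    intro k hk
    have h := ((continuous_pow k).tendsto (0 : ℝ)).mono_left (nhdsWithin_le_nhds (s := Set.Ioi 0))
    rwa [zero_pow hk.ne'] at h
  have hej : ∀ a, e (j a) ≤ t := fun a => (hrange _).1 ⟨a, rfl⟩
  -- The low block of the eigenvalue equation, rescaled by row and column to converge to an
  -- invertible matrix. The high components and the eigenvalue go to the right side `ρ`, which tends
  -- to zero because of the remaining positive powers of `η`.
  let M : ℝ → Matrix τ τ ℝ := fun η => Matrix.of fun a c => A η (j a) (j c) / η ^ (e (j a) + e (j c))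
  have hM : Tendsto M (𝓝[>] 0) (𝓝 (L.submatrix j j)) :=
    tendsto_pi_nhds.2 fun a => tendsto_pi_nhds.2 fun c => (hA (j a) (j c)).tendsto_div
  have hMdet : Tendsto (fun η => (M η).det) (𝓝[>] 0) (𝓝 (L.submatrix j j).det) :=
    (Continuous.matrix_det continuous_id).continuousAt.tendsto.comp hM
  have hMadj : ∀ a c, Tendsto (fun η => (M η).adjugate a c) (𝓝[>] 0)
      (𝓝 ((L.submatrix j j).adjugate a c)) := fun a c =>
    ((Continuous.matrix_adjugate continuous_id).matrix_elem a c).continuousAt.tendsto.comp hM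
  let ρ : ℝ → τ → ℝ := fun η c => μ η / η ^ (2 * m) * η ^ (2 * m - e (j b) - e (j c)) * v η (j c) -
    ∑ a, if e a ≤ t then 0 else A η (j c) a / η ^ (e (j c) + e a) * η ^ (e a - e (j b)) * v η a
  have hρ : ∀ c, Tendsto (fun η => ρ η c) (𝓝[>] 0) (𝓝 0) := by
    intro c
    have h1 := (hμ.tendsto_div.mul (hpow (2 * m - e (j b) - e (j c))
      (by have := hej b; have := hej c; omega))).mul (hv (j c))
    have h2 : Tendsto (fun η => ∑ a, if e a ≤ t then 0 else
        A η (j c) a / η ^ (e (j c) + e a) * η ^ (e a - e (j b)) * v η a) (𝓝[>] 0)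
        (𝓝 (∑ a : ι, 0)) := by
      refine tendsto_finsetSum _ fun a _ => ?_
      split_ifs with h
      · exact tendsto_const_nhds
      · have h3 := ((hA (j c) a).tendsto_div.mul (hpow (e a - e (j b))
          (by have := hej b; omega))).mul (hv a)
        simpa using h3
    simpa [ρ] using h1.sub h2
  have heq : ∀ᶠ η in 𝓝[>] (0 : ℝ), (M η).det * v η (j b) = ∑ c, (M η).adjugate b c * ρ η c := by
    filter_upwards [heig, self_mem_nhdsWithin] with η h1 h2
    have hη : η ≠ 0 := ne_of_gt h2
    -- The scaling is normalized so that `u b = v η (j b)`. Other components of `u` may be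
    -- unbounded, so the limit is taken in Cramer's identity `det M * u b = ∑ adj M * ρ` and not in
    -- `u` itself.
    let u : τ → ℝ := fun c => η ^ e (j c) * v η (j c) / η ^ e (j b)
    have hMu : M η *ᵥ u = ρ η := by
      funext c
      have h3 := congrFun h1 (j c)
      simp only [mulVec, dotProduct, Pi.smul_apply, smul_eq_mul] at h3
      have h4 : ∑ a, A η (j c) a * v η a = (∑ a, A η (j c) (j a) * v η (j a)) +
          ∑ a, if e a ≤ t then 0 else A η (j c) a * v η a := by
        rw [Fintype.sum_of_injective j hj (fun a => A η (j c) (j a) * v η (j a))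
          (fun a => if e a ≤ t then A η (j c) a * v η a else 0)
          (fun a ha => if_neg (by rwa [← hrange])) (fun a => by rw [if_pos (hej a)]),
          ← Finset.sum_add_distrib]
        exact Finset.sum_congr rfl fun a _ => by split_ifs <;> simp
      rw [h4] at h3
      have h5 : (M η *ᵥ u) c = (∑ a, A η (j c) (j a) * v η (j a)) / η ^ (e (j c) + e (j b)) := by
        simp only [mulVec, dotProduct, M, u, of_apply]
        rw [Finset.sum_div]
        refine Finset.sum_congr rfl fun a _ => ?_
        rw [pow_add, pow_add]
        field_simp
      have h6 : (∑ a, if e a ≤ t then 0 else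
          A η (j c) a / η ^ (e (j c) + e a) * η ^ (e a - e (j b)) * v η a) =
          (∑ a, if e a ≤ t then 0 else A η (j c) a * v η a) / η ^ (e (j c) + e (j b)) := by
        rw [Finset.sum_div]
        refine Finset.sum_congr rfl fun a _ => ?_
        split_ifs with h
        · simp
        · have h7 : e a = e a - e (j b) + e (j b) := by have := hej b; omega
          have h8 : η ^ (e (j c) + e a) = η ^ (e (j c) + e (j b)) * η ^ (e a - e (j b)) := by
            rw [← pow_add]
            congr 1
            omega
          rw [h8]
          field_simp
      have h9 : μ η / η ^ (2 * m) * η ^ (2 * m - e (j b) - e (j c)) * v η (j c) =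
          μ η * v η (j c) / η ^ (e (j c) + e (j b)) := by
        have h8 : η ^ (2 * m) = η ^ (e (j c) + e (j b)) * η ^ (2 * m - e (j b) - e (j c)) := by
          rw [← pow_add]
          congr 1
          have := hej b
          have := hej c
          omega
        rw [h8]
        field_simp
      simp only [ρ]
      rw [h5, h6, h9, ← h3]
      ring
    have h3 := congrArg (fun w => ((M η).adjugate *ᵥ w) b) hMu
    simp only [mulVec_mulVec, adjugate_mul, smul_mulVec, one_mulVec, Pi.smul_apply,
      smul_eq_mul] at h3
    have hub : u b = v η (j b) := by
      simp only [u]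
      field_simp
    rw [hub] at h3
    rw [h3]
    rfl
  have hl := hMdet.mul (hv (j b))
  have hr : Tendsto (fun η => ∑ c, (M η).adjugate b c * ρ η c) (𝓝[>] 0) (𝓝 (∑ c : τ, 0)) :=
    tendsto_finsetSum _ fun c _ => by simpa using (hMadj b c).mul (hρ c)
  have := tendsto_nhds_unique (hl.congr' heq) hr
  rw [Finset.sum_const_zero] at this
  exact (mul_eq_zero.1 this).resolve_left hL

/-- A block triangular orthogonal matrix is block diagonal. -/
theorem orthogonal_apply_eq_zero_of_block {T : Matrix ι ι ℝ} (hT : Tᵀ * T = 1) (p : ι → Prop)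
    (h0 : ∀ a b, p a → ¬p b → T a b = 0) {a b : ι} (ha : ¬p a) (hb : p b) : T a b = 0 := by
  classical
  have hT' : T * Tᵀ = 1 := mul_eq_one_comm.1 hT
  have hrow : ∀ a, ∑ b, T a b ^ 2 = 1 := fun a => by
    have h := congrFun (congrFun hT' a) a
    rw [Matrix.mul_apply, one_apply_eq] at h
    simpa [sq] using h
  have hcol : ∀ b, ∑ a, T a b ^ 2 = 1 := fun b => by
    have h := congrFun (congrFun hT b) b
    rw [Matrix.mul_apply, one_apply_eq] at h
    simpa [sq] using h
  set s := Finset.univ.filter p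
  have h1 : ∑ a ∈ s, ∑ b ∈ s, T a b ^ 2 = s.card := by
    rw [Finset.card_eq_sum_ones, Nat.cast_sum]
    refine Finset.sum_congr rfl fun a ha => ?_
    rw [Nat.cast_one, ← hrow a]
    refine Finset.sum_subset (Finset.subset_univ _) fun b _ hb => ?_
    rw [h0 a b (Finset.mem_filter.1 ha).2 (by simpa [s] using hb), sq, mul_zero]
  have h2 : ∑ b ∈ s, ∑ a, T a b ^ 2 = s.card := by
    rw [Finset.card_eq_sum_ones, Nat.cast_sum]
    exact Finset.sum_congr rfl fun b _ => by rw [hcol b, Nat.cast_one]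
  -- The rows and the columns of the block have the same total square sum; since its rows have
  -- nothing outside the block, neither have its columns.
  have h3 : ∑ b ∈ s, ∑ a ∈ sᶜ, T a b ^ 2 = 0 := by
    have h4 : ∑ b ∈ s, ∑ a, T a b ^ 2 =
        ∑ b ∈ s, ∑ a ∈ s, T a b ^ 2 + ∑ b ∈ s, ∑ a ∈ sᶜ, T a b ^ 2 := by
      rw [← Finset.sum_add_distrib]
      exact Finset.sum_congr rfl fun b _ => (Finset.sum_add_sum_compl s _).symm
    rw [Finset.sum_comm (s := s) (t := s), h1, h2] at h4
    linarith
  have h5 := (Finset.sum_eq_zero_iff_of_nonneg fun b _ =>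
    Finset.sum_nonneg fun a _ => sq_nonneg (T a b)).1 h3 b (by simpa [s] using hb)
  have h6 := (Finset.sum_eq_zero_iff_of_nonneg fun a _ => sq_nonneg (T a b)).1 h5 a
    (by simpa [s] using ha)
  exact pow_eq_zero_iff (two_ne_zero) |>.1 h6

end Pencil


/-! ### Asymptotics of the spectrum of kernel matrices -/

section KernelSpectrum

open Matrix

theorem HasLead.apply_zero {F : ℝ → ℝ} {m : ℕ} {c : ℝ} (h : HasLead F m c) : F 0 = 0 ^ m * c := by
  obtain ⟨C, hC⟩ := IsBigO.bound h
  have h1 := hC.self_of_nhds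
  simp only [ne_eq, Nat.add_eq_zero_iff, one_ne_zero, and_false, not_false_eq_true, zero_pow,
    norm_zero, mul_zero, norm_le_zero_iff, sub_eq_zero] at h1
  exact h1

theorem HasLead.comp_pow_four {F : ℝ → ℝ} {m : ℕ} {c : ℝ} (h : HasLead F m c) :
    HasLead (fun t => F (t ^ 4)) (4 * m) c := by
  have h1 := h.comp_sq.comp_sq
  convert h1 using 1
  · ext t
    rw [← pow_mul]
  · omega

theorem det_transpose_mul_self_ne_zero {n : ℕ} {κ : Type*} [Fintype κ] [DecidableEq κ]
    {V : Matrix (Fin n) κ ℝ} (h : V.rank = Fintype.card κ) : (Vᵀ * V).det ≠ 0 := by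
  intro h0
  obtain ⟨y, hy, hy0⟩ := exists_mulVec_eq_zero_iff.2 h0
  have hy1 : V *ᵥ y = 0 := by
    refine dotProduct_self_eq_zero.1 ?_
    rw [dotProduct_mulVec, vecMul_mulVec, ← mulVec_transpose, transpose_mul, transpose_transpose,
      hy0, zero_dotProduct]
  have h1 := LinearMap.finrank_range_add_finrank_ker V.mulVecLin
  rw [Module.finrank_fintype_fun_eq_card, show Module.finrank ℝ (LinearMap.range V.mulVecLin) =
    V.rank from rfl, h, Nat.add_eq_left, Submodule.finrank_eq_zero, LinearMap.ker_eq_bot'] at h1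
  exact hy (h1 y hy1)

variable {d n r N : ℕ} {x : Fin n → EuclideanSpace ℝ (Fin d)}
  {Q : Matrix (Fin n) (multiIdxLE d (r - 1) ⊕ Fin N) ℝ} {f : ℝ → ℝ}

/-- Half the order in `η` of the diagonal entries of the kernel matrix `K_(η ^ 4)` in a frame. -/
def frameExp : multiIdxLE d (r - 1) ⊕ Fin N → ℕ :=
  Sum.elim (fun α => 4 * ∑ i, (α : Fin d → ℕ) i) fun _ => 4 * r - 2

theorem frameExp_lt_iff (hr : 1 ≤ r) {s : ℕ} (a : multiIdxLE d (r - 1) ⊕ Fin N) :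
    frameExp a < 4 * s + 1 ↔ frameDeg a ≤ s := by
  rcases a with a | a <;> simp only [frameExp, frameDeg, Sum.elim_inl, Sum.elim_inr] <;> omega

theorem frameExp_eq_iff (hr : 1 ≤ r) {s : ℕ} (hs : s ≤ r - 1)
    (a : multiIdxLE d (r - 1) ⊕ Fin N) : frameExp a = 4 * s ↔ frameDeg a = s := by
  rcases a with a | a <;> simp only [frameExp, frameDeg, Sum.elim_inl, Sum.elim_inr] <;> omega

/-- This free level just above each group is the reason for the fourth power. Squaring would already
make all half orders integral, but `2s + 1` would then meet the last group for `s = r - 1`. -/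
theorem frameExp_ne (hr : 1 ≤ r) (s : ℕ) (a : multiIdxLE d (r - 1) ⊕ Fin N) :
    frameExp a ≠ 4 * s + 1 := by
  rcases a with a | a <;> simp only [frameExp, Sum.elim_inl, Sum.elim_inr] <;> omega

/-- With half the order `2r - 1` assigned to each last member, the mixed entries are of higher order
than required, so the limit form is block diagonal. -/
theorem IsGradedFrame.hasLead_conj (h : IsGradedFrame x Q) (hf : HasSmoothnessOrder f r)
    (a b : multiIdxLE d (r - 1) ⊕ Fin N) :
    HasLead (fun η => (Qᵀ * kernelMat f x (η ^ 4) * Q) a b) (frameExp a + frameExp b)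
      (frameLimit f r x Q a b) := by
  have hr := hf.pos
  rcases a with a | a <;> rcases b with b | b
  · have := (h.hasLead_inl_inl hf a b).comp_pow_four
    rw [mul_add] at this
    exact this
  · obtain ⟨c, hc⟩ := h.exists_hasLead_inl_inr hf a b
    exact hc.comp_pow_four.lower (by simp only [frameExp, Sum.elim_inl, Sum.elim_inr]; omega)
  · obtain ⟨c, hc⟩ := h.exists_hasLead_inl_inr hf b a
    simp only [conj_kernelMat_symm _ (Sum.inr a)]
    exact hc.comp_pow_four.lower (by simp only [frameExp, Sum.elim_inl, Sum.elim_inr]; omega)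
  · have := (h.hasLead_inr_inr hf a b).comp_pow_four
    rw [show 4 * (2 * r - 1) = 4 * r - 2 + (4 * r - 2) by omega] at this
    exact this

/-- The data of the analytic case: an analytic eigenvalue decomposition of the kernel matrix, the
main terms of the eigenvalues, and an arrangement of the members of a frame by their degree. -/
structure KernelEVD (f : ℝ → ℝ) (r : ℕ) (x : Fin n → EuclideanSpace ℝ (Fin d))
    (lam : Fin n → ℝ → ℝ) (P : Fin n → ℝ → Matrix (Fin n) (Fin n) ℝ) (p : Fin n → Fin n → ℝ)
    (σ : Fin n ≃ multiIdxLE d (r - 1) ⊕ Fin N) (main : Fin n → ℝ) : Prop where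
  smooth : HasSmoothnessOrder f r
  evd : IsAnalyticEVD (kernelMat f x) lam P p
  monotone : Monotone (frameDeg ∘ σ)
  hasLead : ∀ k, HasLead (lam k) (min (2 * frameDeg (σ k)) (2 * r - 1)) (main k)

theorem exists_kernelEVD (hf : HasSmoothnessOrder f r)
    (hn : n = (multiIdxLE d (r - 1)).card + N)
    (hpsd : ∃ ε₀ : ℝ, 0 < ε₀ ∧ ∀ ε ∈ Set.Icc 0 ε₀, (kernelMat f x ε).PosSemidef)
    {lam : Fin n → ℝ → ℝ} {P : Fin n → ℝ → Matrix (Fin n) (Fin n) ℝ} {p : Fin n → Fin n → ℝ}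
    (hE : IsAnalyticEVD (kernelMat f x) lam P p) :
    ∃ (σ : Fin n ≃ multiIdxLE d (r - 1) ⊕ Fin N) (main : Fin n → ℝ),
      KernelEVD f r x lam P p σ main := by
  obtain ⟨Q, hQ⟩ := exists_isGradedFrame hf.pos x hn
  obtain ⟨σ, hσ⟩ := exists_equiv_monotone (ι := multiIdxLE d (r - 1) ⊕ Fin N) (n := n)
    (by simp [hn]) frameDeg
  obtain ⟨ε₀, hε₀, hpsd⟩ := hpsd
  have key : ∀ k, ∃ c, HasLead (lam k) (min (2 * frameDeg (σ k)) (2 * r - 1)) c := by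
    intro k
    refine hasLead_of_analyticAt (hE.analytic_lam k) ?_
    have hU : ∀ᶠ ε in 𝓝[>] (0 : ℝ), ∃ U : Matrix (Fin n) (Fin n) ℝ, Uᵀ * U = 1 ∧
        kernelMat f x ε * U = U * diagonal fun k => lam k ε :=
      (hE.eventually_exists_orthogonal.filter_mono nhdsWithin_le_nhds).mono
        fun ε ⟨U, h1, h2, _⟩ => ⟨U, h1, h2⟩
    have hk := frameDeg_le hf.pos (σ k)
    refine hQ.eigenvalue_isBigO hf nhdsWithin_le_nhds hk ?_ hU hE.ordered ?_
    · rw [← not_lt, lt_card_multiIdxLT_iff hσ k hk]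
      exact lt_irrefl _
    · filter_upwards [hU, Ioc_mem_nhdsGT hε₀] with ε ⟨U, h1, h2⟩ h3
      exact eigenvalue_nonneg_of_posSemidef (hpsd ε ⟨h3.1.le, h3.2⟩) h1 h2 k
  choose main hmain using key
  exact ⟨σ, main, hf, hE, hσ, hmain⟩

namespace KernelEVD

variable {lam : Fin n → ℝ → ℝ} {P : Fin n → ℝ → Matrix (Fin n) (Fin n) ℝ} {p : Fin n → Fin n → ℝ}
  {σ : Fin n ≃ multiIdxLE d (r - 1) ⊕ Fin N} {main : Fin n → ℝ}

theorem hasLead_pow_four (h : KernelEVD f r x lam P p σ main)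
    (a : multiIdxLE d (r - 1) ⊕ Fin N) :
    HasLead (fun η => lam (σ.symm a) (η ^ 4)) (2 * frameExp a) (main (σ.symm a)) := by
  have hr := h.smooth.pos
  have h1 := (h.hasLead (σ.symm a)).comp_pow_four
  rw [Equiv.apply_symm_apply] at h1
  convert h1 using 1
  rcases a with a | a
  · have := degree_lt hr a
    simp only [frameExp, frameDeg, Sum.elim_inl]
    omega
  · simp only [frameExp, frameDeg, Sum.elim_inr]
    omega

theorem eventually_pow_four {p : ℝ → Prop} (h : ∀ᶠ ε in 𝓝 (0 : ℝ), p ε) :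
    ∀ᶠ η in 𝓝 (0 : ℝ), p (η ^ 4) := by
  have h0 : Tendsto (fun t : ℝ => t ^ 4) (𝓝 0) (𝓝 0) := by
    simpa using (continuous_pow 4).tendsto (0 : ℝ)
  exact h0.eventually h

theorem eventually_det (h : KernelEVD f r x lam P p σ main) (hQ : IsGradedFrame x Q) :
    ∀ᶠ η in 𝓝 (0 : ℝ), ∀ z : ℝ, (z • (1 : Matrix (multiIdxLE d (r - 1) ⊕ Fin N) _ ℝ) -
      Qᵀ * kernelMat f x (η ^ 4) * Q).det = ∏ a, (z - lam (σ.symm a) (η ^ 4)) := by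
  filter_upwards [eventually_pow_four h.evd.eventually_det] with η hη z
  rw [Equiv.prod_comp σ.symm fun k => z - lam k (η ^ 4), ← hη z,
    ← det_conj_of_mul_eq_one hQ.orthogonal hQ.mul_transpose (N := z • 1 - kernelMat f x (η ^ 4))]
  rw [Matrix.mul_sub, Matrix.sub_mul, Matrix.mul_smul, Matrix.mul_one, Matrix.smul_mul,
    hQ.orthogonal]

theorem det_frameLimit_eq_prod (h : KernelEVD f r x lam P p σ main) (hQ : IsGradedFrame x Q)
    {s : ℕ} (hs : s ≤ r - 1) :
    ((frameLimit f r x Q).submatrix (frameIdx (multiIdxLE_mono hs))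
        (frameIdx (multiIdxLE_mono hs))).det =
      ∏ a : multiIdxLE d s, main (σ.symm (frameIdx (multiIdxLE_mono hs) a)) :=
  det_submatrix_eq_prod (lam := fun a η => lam (σ.symm a) (η ^ 4))
    (main := fun a => main (σ.symm a)) (hQ.hasLead_conj h.smooth) h.hasLead_pow_four
    (h.eventually_det hQ) (t := 4 * s + 1) (frameIdx_injective _)
    (fun a => (mem_range_frameIdx h.smooth.pos hs a).trans (frameExp_lt_iff h.smooth.pos a).symm)
    (frameExp_ne h.smooth.pos s)

theorem map_main_eq {κ : Type*} [Fintype κ] {i : κ → multiIdxLE d (r - 1) ⊕ Fin N}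
    (hi : Function.Injective i) {G : Finset (Fin n)} (hG : ∀ k, k ∈ G ↔ σ k ∈ Set.range i)
    (main : Fin n → ℝ) : G.val.map main = Finset.univ.val.map fun a => main (σ.symm (i a)) := by
  have h : G = Finset.univ.map ⟨fun a => σ.symm (i a), σ.symm.injective.comp hi⟩ := by
    ext k
    rw [hG]
    simp [Equiv.symm_apply_eq]
  rw [h, Finset.map_val, Multiset.map_map]
  rfl

theorem prod_main_eq {κ : Type*} [Fintype κ] {i : κ → multiIdxLE d (r - 1) ⊕ Fin N}
    (hi : Function.Injective i) {G : Finset (Fin n)} (hG : ∀ k, k ∈ G ↔ σ k ∈ Set.range i)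
    (main : Fin n → ℝ) : ∏ k ∈ G, main k = ∏ a, main (σ.symm (i a)) :=
  congrArg Multiset.prod (map_main_eq hi hG main)

theorem prod_main_le (h : KernelEVD f r x lam P p σ main) (hQ : IsGradedFrame x Q)
    {s : ℕ} (hs : s ≤ r - 1) :
    ∏ k ∈ Finset.univ.filter (fun k => frameDeg (σ k) ≤ s), main k =
      ((vandermondeMat x (multiIdxLE d s))ᵀ * vandermondeMat x (multiIdxLE d s)).det *
        (wronskianMat (radialKernel d f) s).det := by
  rw [← hQ.det_frameLimit_submatrix h.smooth hs, h.det_frameLimit_eq_prod hQ hs]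
  refine prod_main_eq (frameIdx_injective _) (fun k => ?_) main
  rw [mem_range_frameIdx h.smooth.pos hs]
  simp

theorem prod_main_evGroup (h : KernelEVD f r x lam P p σ main) {s : ℕ} (hs1 : 1 ≤ s)
    (hs : s ≤ r - 1) :
    ∏ k ∈ Finset.univ.filter (fun k => frameDeg (σ k) ≤ s), main k =
      (∏ k ∈ Finset.univ.filter (fun k => frameDeg (σ k) ≤ s - 1), main k) *
        ∏ k ∈ evGroup d n s, main k := by
  rw [← Finset.prod_union]
  · refine Finset.prod_congr ?_ fun _ _ => rfl
    ext k
    have hr := h.smooth.pos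
    rw [Finset.mem_union, mem_evGroup_iff h.monotone k (show s < r by omega)]
    simp
    omega
  · rw [Finset.disjoint_left]
    intro k hk hk'
    have hr := h.smooth.pos
    rw [mem_evGroup_iff h.monotone k (show s < r by omega)] at hk'
    have := (Finset.mem_filter.1 hk).2
    omega

theorem det_gramian_ne_zero {s : ℕ}
    (hV : (vandermondeMat x (multiIdxLE d s)).rank = (multiIdxLE d s).card) :
    ((vandermondeMat x (multiIdxLE d s))ᵀ * vandermondeMat x (multiIdxLE d s)).det ≠ 0 :=
  det_transpose_mul_self_ne_zero (by rw [hV, Fintype.card_coe])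

theorem prod_main_evGroup_eq_div (h : KernelEVD f r x lam P p σ main) (hQ : IsGradedFrame x Q)
    {s : ℕ} (hs1 : 1 ≤ s) (hs : s ≤ r - 1) (hW : (wronskianMat (radialKernel d f) (s - 1)).det ≠ 0)
    (hV : (vandermondeMat x (multiIdxLE d (s - 1))).rank = (multiIdxLE d (s - 1)).card) :
    ∏ k ∈ evGroup d n s, main k =
      (((vandermondeMat x (multiIdxLE d s))ᵀ * vandermondeMat x (multiIdxLE d s)).det *
        (wronskianMat (radialKernel d f) s).det) /
      (((vandermondeMat x (multiIdxLE d (s - 1)))ᵀ * vandermondeMat x (multiIdxLE d (s - 1))).det *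
        (wronskianMat (radialKernel d f) (s - 1)).det) := by
  rw [eq_div_iff (mul_ne_zero (det_gramian_ne_zero hV) hW), ← h.prod_main_le hQ hs,
    ← h.prod_main_le hQ (show s - 1 ≤ r - 1 by omega), h.prod_main_evGroup hs1 hs, mul_comm]

/-- Only one frame member has degree zero, and all other eigenvalues vanish at `ε = 0`; the
remaining one equals the trace of the constant matrix `K_0`. -/
theorem main_evGroup_zero (h : KernelEVD f r x lam P p σ main) {k : Fin n}
    (hk : k ∈ evGroup d n 0) : main k = n * f 0 := by
  have hr := h.smooth.pos
  rw [mem_evGroup_iff h.monotone k hr] at hk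
  have hlam : ∀ l, l ≠ k → lam l 0 = 0 := by
    intro l hl
    have h0 : frameDeg (σ l) ≠ 0 := by
      intro h0
      refine hl (σ.injective ?_)
      have key : ∀ a b : multiIdxLE d (r - 1) ⊕ Fin N, frameDeg a = 0 → frameDeg b = 0 → a = b := by
        rintro (a | a) (b | b) ha hb
        · simp only [frameDeg, Sum.elim_inl, Finset.sum_eq_zero_iff, Finset.mem_univ,
            true_imp_iff] at ha hb
          exact congrArg Sum.inl (Subtype.ext (funext fun i => (ha i).trans (hb i).symm))
        all_goals
          simp only [frameDeg, Sum.elim_inr] at ha hb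
          omega
      exact key _ _ h0 hk
    rw [(h.hasLead l).apply_zero, zero_pow (by omega), zero_mul]
  have hk0 : lam k 0 = main k := by
    rw [(h.hasLead k).apply_zero, hk]
    simp
  have htr := congrArg Matrix.trace h.evd.evd.self_of_nhds
  have hp : ∀ l, (P l 0).trace = 1 := by
    intro l
    rw [h.evd.limit, trace_vecMulVec]
    have := congrFun (congrFun h.evd.limit_orthonormal l) l
    rw [one_apply_eq] at this
    exact this
  rw [trace_sum] at htr
  simp only [trace_smul, hp] at htr
  rw [Finset.sum_eq_single k (fun l _ hl => by simp [hlam l hl]) (by simp), hk0] at htr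
  simp only [trace, diag_apply, kernelMat, of_apply, sub_self, norm_zero, mul_zero, Finset.sum_const,
    Finset.card_univ, Fintype.card_fin, nsmul_eq_mul, smul_eq_mul, mul_one] at htr
  exact htr.symm

end KernelEVD

end KernelSpectrum


/-! ### Main terms and limiting eigenspaces of the groups -/

section KernelSpectrum

open Matrix

variable {d n r N : ℕ} {x : Fin n → EuclideanSpace ℝ (Fin d)}
  {Q : Matrix (Fin n) (multiIdxLE d (r - 1) ⊕ Fin N) ℝ} {f : ℝ → ℝ}

/-- Schur complements are compatible with a block diagonal congruence; the invertible factor `G` of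
the eliminated block cancels. Hence the Schur complement of the leading form is a congruence of that
of the Wronskian. -/
theorem schur_conj_eq {κ τ : Type*} [Fintype κ] [Fintype τ] [DecidableEq τ] {M : Matrix κ κ ℝ}
    {G W : Matrix τ τ ℝ} (B : Matrix κ κ ℝ) (C : Matrix κ τ ℝ) (D : Matrix τ κ ℝ)
    (hG : G.det ≠ 0) :
    M * B * Mᵀ - M * C * Gᵀ * (G * W * Gᵀ)⁻¹ * (G * D * Mᵀ) = M * (B - C * W⁻¹ * D) * Mᵀ := by
  have hG1 : G⁻¹ * G = 1 := nonsing_inv_mul _ (isUnit_iff_ne_zero.2 hG)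
  have hG2 : Gᵀ * Gᵀ⁻¹ = 1 := mul_nonsing_inv _ (by
    rw [det_transpose]
    exact isUnit_iff_ne_zero.2 hG)
  have h : M * C * Gᵀ * (G * W * Gᵀ)⁻¹ * (G * D * Mᵀ) = M * (C * W⁻¹ * D) * Mᵀ := by
    rw [Matrix.mul_inv_rev, Matrix.mul_inv_rev]
    calc M * C * Gᵀ * (Gᵀ⁻¹ * (W⁻¹ * G⁻¹)) * (G * D * Mᵀ)
        = M * C * (Gᵀ * Gᵀ⁻¹) * W⁻¹ * (G⁻¹ * G) * D * Mᵀ := by simp only [Matrix.mul_assoc]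
      _ = _ := by rw [hG1, hG2]; simp only [Matrix.mul_assoc, Matrix.mul_one]
  rw [h, Matrix.mul_sub, Matrix.sub_mul]

theorem gradedMoment_multiIdxEQ {s : ℕ} (hs : s ≤ r - 1) :
    gradedMoment x Q (multiIdxEQ_subset_multiIdxLE hs) =
      (Q.submatrix id (frameIdx (multiIdxEQ_subset_multiIdxLE hs)))ᵀ *
        vandermondeMat x (multiIdxEQ d s) := by
  ext a α
  rw [gradedMoment, of_apply, if_pos ((mem_multiIdxEQ.1 α.2).trans (mem_multiIdxEQ.1 a.2).symm)]
  rfl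

theorem multiIdxEQ_subset_of_mem_multiIdxEQ {k : ℕ} :
    ∀ α ∈ multiIdxEQ d k, multiIdxEQ d (∑ i, α i) ⊆ multiIdxEQ d k := fun _ hα => by
  rw [mem_multiIdxEQ.1 hα]

namespace KernelEVD

variable {lam : Fin n → ℝ → ℝ} {P : Fin n → ℝ → Matrix (Fin n) (Fin n) ℝ} {p : Fin n → Fin n → ℝ}
  {σ : Fin n ≃ multiIdxLE d (r - 1) ⊕ Fin N} {main : Fin n → ℝ}

theorem det_frameLimit_ne_zero (h : KernelEVD f r x lam P p σ main) (hQ : IsGradedFrame x Q)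
    {s : ℕ} (hs : s ≤ r - 1) (hW : (wronskianMat (radialKernel d f) s).det ≠ 0)
    (hV : (vandermondeMat x (multiIdxLE d s)).rank = (multiIdxLE d s).card) :
    ((frameLimit f r x Q).submatrix (frameIdx (multiIdxLE_mono hs))
      (frameIdx (multiIdxLE_mono hs))).det ≠ 0 := by
  rw [hQ.det_frameLimit_submatrix h.smooth hs]
  exact mul_ne_zero (det_gramian_ne_zero hV) hW

theorem map_main_evGroup (h : KernelEVD f r x lam P p σ main) (hQ : IsGradedFrame x Q)
    {s : ℕ} (hs1 : 1 ≤ s) (hs : s ≤ r - 1) (hW : (wronskianMat (radialKernel d f) (s - 1)).det ≠ 0)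
    (hV : (vandermondeMat x (multiIdxLE d (s - 1))).rank = (multiIdxLE d (s - 1)).card) :
    (evGroup d n s).val.map main =
      ((Q.submatrix id (frameIdx (multiIdxEQ_subset_multiIdxLE hs)))ᵀ *
        vandermondeMat x (multiIdxEQ d s) * wronskianSchur (radialKernel d f) s *
        (vandermondeMat x (multiIdxEQ d s))ᵀ *
        Q.submatrix id (frameIdx (multiIdxEQ_subset_multiIdxLE hs))).charpoly.roots := by
  have hr := h.smooth.pos
  have hs' : s - 1 ≤ r - 1 := by omega
  rw [map_main_eq (i := frameIdx (multiIdxEQ_subset_multiIdxLE hs)) (frameIdx_injective _)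
    (fun k => by
      rw [mem_evGroup_iff h.monotone k (show s < r by omega),
        mem_range_frameIdx_multiIdxEQ hr hs]) main,
    ← charpoly_schur_roots (lam := fun a η => lam (σ.symm a) (η ^ 4))
      (main := fun a => main (σ.symm a)) (hQ.hasLead_conj h.smooth) h.hasLead_pow_four
      (h.eventually_det hQ) (t := 4 * s)
      (j := frameIdx (multiIdxLE_mono hs')) (frameIdx_injective _)
      (fun a => by
        rw [mem_range_frameIdx hr hs', ← frameExp_lt_iff hr]
        rcases a with a | a <;> simp only [frameExp, Sum.elim_inl, Sum.elim_inr] <;> omega)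
      (frameIdx_injective _)
      (fun a => (mem_range_frameIdx_multiIdxEQ hr hs a).trans (frameExp_eq_iff hr hs a).symm)
      (h.det_frameLimit_ne_zero hQ hs' hW hV) (h.det_frameLimit_eq_prod hQ hs')]
  have hG : (gradedMoment x Q (multiIdxLE_mono hs')).det ≠ 0 := by
    have := det_gramian_ne_zero hV
    rw [← hQ.det_gradedMoment_sq hr hs'] at this
    exact left_ne_zero_of_mul this
  rw [frameLimit_submatrix h.smooth x Q _ _ multiIdxEQ_subset_of_mem_multiIdxEQ
      multiIdxEQ_subset_of_mem_multiIdxEQ,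
    frameLimit_submatrix h.smooth x Q _ _ multiIdxEQ_subset_of_mem_multiIdxEQ
      multiIdxEQ_subset_of_mem_multiIdxLE,
    frameLimit_submatrix h.smooth x Q _ _ multiIdxEQ_subset_of_mem_multiIdxLE
      multiIdxEQ_subset_of_mem_multiIdxLE,
    frameLimit_submatrix h.smooth x Q _ _ multiIdxEQ_subset_of_mem_multiIdxLE
      multiIdxEQ_subset_of_mem_multiIdxEQ, schur_conj_eq _ _ _ hG, gradedMoment_multiIdxEQ hs]
  simp only [transpose_mul, transpose_transpose, Matrix.mul_assoc, wronskianSchur, wronskianMat]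

theorem map_main_evLastGroup (h : KernelEVD f r x lam P p σ main) (hQ : IsGradedFrame x Q)
    (hW : (wronskianMat (radialKernel d f) (r - 1)).det ≠ 0)
    (hV : (vandermondeMat x (multiIdxLE d (r - 1))).rank = (multiIdxLE d (r - 1)).card) :
    (evLastGroup d n r).val.map main =
      (scaledDeriv f (2 * r - 1) • ((Q.submatrix id Sum.inr)ᵀ * distMat x (2 * r - 1) *
        Q.submatrix id Sum.inr)).charpoly.roots := by
  have hr := h.smooth.pos
  have hrange : ∀ a : multiIdxLE d (r - 1) ⊕ Fin N, a ∈ Set.range Sum.inr ↔ frameDeg a = r := by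
    rintro (a | a)
    · have := degree_lt hr a
      simp only [Set.mem_range, reduceCtorEq, exists_false, frameDeg, Sum.elim_inl, false_iff]
      omega
    · simp [frameDeg]
  have hroots := charpoly_schur_roots (lam := fun a η => lam (σ.symm a) (η ^ 4))
      (main := fun a => main (σ.symm a)) (hQ.hasLead_conj h.smooth) h.hasLead_pow_four
      (h.eventually_det hQ) (t := 4 * r - 2)
      (j := frameIdx (multiIdxLE_mono le_rfl)) (frameIdx_injective _)
      (fun a => by
        rw [mem_range_frameIdx hr le_rfl, ← frameExp_lt_iff hr]
        rcases a with a | a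
        · have := degree_lt hr a
          simp only [frameExp, Sum.elim_inl]
          omega
        · simp only [frameExp, Sum.elim_inr]
          omega)
      (i := Sum.inr) Sum.inr_injective
      (fun a => by
        rw [hrange]
        rcases a with a | a
        · have := degree_lt hr a
          simp only [frameExp, frameDeg, Sum.elim_inl]
          omega
        · simp [frameExp, frameDeg])
      (h.det_frameLimit_ne_zero hQ le_rfl hW hV) (h.det_frameLimit_eq_prod hQ le_rfl)
  rw [map_main_eq (i := Sum.inr) Sum.inr_injective
    (fun k => by rw [mem_evLastGroup_iff h.monotone k hr, hrange]) main, ← hroots]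
  -- The limit form is block diagonal, so the Schur complement for the last group is the distance
  -- block itself.
  have h0 : (frameLimit f r x Q).submatrix Sum.inr (frameIdx (multiIdxLE_mono le_rfl)) = 0 := rfl
  rw [h0, Matrix.zero_mul, Matrix.zero_mul, sub_zero]
  rfl

/-- The limiting eigenvectors in a graded frame. -/
def limitMat (Q : Matrix (Fin n) (multiIdxLE d (r - 1) ⊕ Fin N) ℝ) (p : Fin n → Fin n → ℝ)
    (σ : Fin n ≃ multiIdxLE d (r - 1) ⊕ Fin N) :
    Matrix (multiIdxLE d (r - 1) ⊕ Fin N) (multiIdxLE d (r - 1) ⊕ Fin N) ℝ :=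
  Matrix.of fun a b => (Qᵀ *ᵥ p (σ.symm b)) a

theorem limitMat_orthogonal (h : KernelEVD f r x lam P p σ main) (hQ : IsGradedFrame x Q) :
    (limitMat Q p σ)ᵀ * limitMat Q p σ = 1 := by
  set U : Matrix (Fin n) (Fin n) ℝ := Matrix.of fun i k => p k i
  have hU : Uᵀ * U = 1 := h.evd.limit_orthonormal
  have hT : limitMat Q p σ = (Qᵀ * U).submatrix id σ.symm := rfl
  rw [hT, transpose_submatrix, submatrix_mul _ _ σ.symm id σ.symm Function.bijective_id |>.symm,
    transpose_mul, transpose_transpose, Matrix.mul_assoc, ← Matrix.mul_assoc Q, hQ.mul_transpose,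
    Matrix.one_mul, hU, submatrix_one_equiv]

theorem limitMat_apply_eq_zero (h : KernelEVD f r x lam P p σ main) (hQ : IsGradedFrame x Q)
    {s : ℕ} (hs : s ≤ r - 1)
    (hL : ((frameLimit f r x Q).submatrix (frameIdx (multiIdxLE_mono hs))
      (frameIdx (multiIdxLE_mono hs))).det ≠ 0)
    {a b : multiIdxLE d (r - 1) ⊕ Fin N} (ha : frameDeg a ≤ s) (hb : ¬frameDeg b ≤ s) :
    limitMat Q p σ a b = 0 := by
  have hr := h.smooth.pos
  obtain ⟨a, rfl⟩ := (mem_range_frameIdx hr hs a).2 ha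
  set k := σ.symm b
  have hP0 : P k 0 *ᵥ p k = p k := by
    have h1 := congrFun (congrFun h.evd.limit_orthonormal k) k
    rw [one_apply_eq] at h1
    have h2 : p k ⬝ᵥ p k = 1 := h1
    rw [h.evd.limit, vecMulVec_mulVec, h2]
    simp
  -- The vectors `P_k(ε) p_k` are eigenvectors for small `ε` that vary continuously and tend to
  -- `p_k`, so no analytic choice of eigenvectors is needed.
  have hcont : Tendsto (fun η : ℝ => Qᵀ *ᵥ (P k (η ^ 4) *ᵥ p k)) (𝓝[>] 0) (𝓝 (Qᵀ *ᵥ p k)) := by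
    have h1 : ContinuousAt (fun ε => P k ε) 0 :=
      continuousAt_pi.2 fun i => continuousAt_pi.2 fun j => (h.evd.analytic_proj k i j).continuousAt
    have h2 : Tendsto (fun η : ℝ => η ^ 4) (𝓝[>] 0) (𝓝 0) := by
      have := ((continuous_pow 4).tendsto (0 : ℝ)).mono_left
        (nhdsWithin_le_nhds (s := Set.Ioi 0))
      simpa using this
    have h3 := h1.tendsto.comp h2
    have h4 : Continuous fun M : Matrix (Fin n) (Fin n) ℝ => Qᵀ *ᵥ (M *ᵥ p k) :=
      continuous_const.matrix_mulVec (continuous_id.matrix_mulVec continuous_const)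
    have h5 := (h4.tendsto (P k 0)).comp h3
    rwa [hP0] at h5
  refine limit_eigenvector_apply_eq_zero (hQ.hasLead_conj h.smooth) (t := 4 * s + 1)
    (m := frameExp b) (frameIdx_injective _)
    (fun a => (mem_range_frameIdx hr hs a).trans
      ((frameExp_lt_iff hr a).symm.trans
        ⟨le_of_lt, fun h => lt_of_le_of_ne h (frameExp_ne hr s a)⟩))
    hL (h.hasLead_pow_four b) ?_ (v := fun η => Qᵀ *ᵥ (P k (η ^ 4) *ᵥ p k)) (v₀ := Qᵀ *ᵥ p k)
    (fun a => (tendsto_pi_nhds.1 hcont) a) ?_ a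
  · have h1 := (frameExp_lt_iff hr b).not.2 hb
    have h2 := frameExp_ne hr s b
    omega
  · filter_upwards [(eventually_pow_four h.evd.eventually_exists_orthogonal).filter_mono
      nhdsWithin_le_nhds] with η ⟨U, hU, hKU, hPU⟩
    have h1 : kernelMat f x (η ^ 4) *ᵥ (P k (η ^ 4) *ᵥ p k) =
        lam k (η ^ 4) • (P k (η ^ 4) *ᵥ p k) := by
      rw [hPU k, vecMulVec_mulVec]
      have h2 : kernelMat f x (η ^ 4) *ᵥ (fun i => U i k) = lam k (η ^ 4) • fun i => U i k := by
        funext i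
        have h3 := congrFun (congrFun hKU i) k
        rw [mul_diagonal, mul_comm] at h3
        exact h3
      simp only [op_smul_eq_smul]
      rw [mulVec_smul, h2, smul_comm]
    rw [mulVec_mulVec, Matrix.mul_assoc, hQ.mul_transpose, Matrix.mul_one, ← mulVec_mulVec, h1,
      mulVec_smul]

/-- Both families are orthonormal bases. A matrix of inner products that is zero off the block
expands each limiting vector of the group in the columns of the block and, conversely, each such
column in these vectors. -/
theorem span_limit_eq (h : KernelEVD f r x lam P p σ main) (hQ : IsGradedFrame x Q)
    {κ : Type*} {i : κ → multiIdxLE d (r - 1) ⊕ Fin N}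
    {G : Finset (Fin n)} (hG : ∀ k, k ∈ G ↔ σ k ∈ Set.range i)
    (h1 : ∀ a b, a ∈ Set.range i → b ∉ Set.range i → limitMat Q p σ a b = 0)
    (h2 : ∀ a b, a ∉ Set.range i → b ∈ Set.range i → limitMat Q p σ a b = 0) :
    Submodule.span ℝ (p '' (G : Set (Fin n))) =
      Submodule.span ℝ (Set.range (Q.submatrix id i)ᵀ) := by
  have hcol : ∀ {κ' : Type} [Fintype κ'] (M : Matrix (Fin n) κ' ℝ) (y : κ' → ℝ),
      M *ᵥ y = ∑ a, y a • fun i => M i a := by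
    intro κ' _ M y
    funext i
    rw [Finset.sum_apply]
    exact Finset.sum_congr rfl fun a _ => mul_comm _ _
  refine le_antisymm (Submodule.span_le.2 ?_) (Submodule.span_le.2 ?_)
  · rintro _ ⟨k, hk, rfl⟩
    have hp : p k = Q *ᵥ (Qᵀ *ᵥ p k) := by
      rw [mulVec_mulVec, hQ.mul_transpose, one_mulVec]
    rw [hp, hcol]
    refine Submodule.sum_mem _ fun a _ => ?_
    by_cases ha : a ∈ Set.range i
    · obtain ⟨c, rfl⟩ := ha
      exact Submodule.smul_mem _ _ (Submodule.subset_span ⟨c, rfl⟩)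
    · have h3 := h2 a (σ k) ha ((hG k).1 hk)
      rw [limitMat, of_apply, Equiv.symm_apply_apply] at h3
      rw [h3, zero_smul]
      exact Submodule.zero_mem _
  · rintro _ ⟨c, rfl⟩
    set U : Matrix (Fin n) (Fin n) ℝ := Matrix.of fun i k => p k i
    have hU : U * Uᵀ = 1 := mul_transpose_eq_one_of_card rfl h.evd.limit_orthonormal
    have hq : (Q.submatrix id i)ᵀ c = U *ᵥ (Uᵀ *ᵥ (Q.submatrix id i)ᵀ c) := by
      rw [mulVec_mulVec, hU, one_mulVec]
    rw [hq, hcol]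
    refine Submodule.sum_mem _ fun k _ => ?_
    by_cases hk : σ k ∈ Set.range i
    · exact Submodule.smul_mem _ _ (Submodule.subset_span ⟨k, (hG k).2 hk, rfl⟩)
    · have h3 := h1 (i c) (σ k) ⟨c, rfl⟩ hk
      rw [limitMat, of_apply, Equiv.symm_apply_apply] at h3
      have h4 : (Uᵀ *ᵥ (Q.submatrix id i)ᵀ c) k = 0 := by
        rw [← h3]
        exact dotProduct_comm _ _
      rw [h4, zero_smul]
      exact Submodule.zero_mem _

theorem span_limit_evGroup (h : KernelEVD f r x lam P p σ main) (hQ : IsGradedFrame x Q)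
    {s : ℕ} (hs : s ≤ r - 1) (hW : (wronskianMat (radialKernel d f) s).det ≠ 0)
    (hV : (vandermondeMat x (multiIdxLE d s)).rank = (multiIdxLE d s).card) :
    Submodule.span ℝ (p '' (evGroup d n s : Set (Fin n))) =
      Submodule.span ℝ (Set.range (Q.submatrix id
        (frameIdx (multiIdxEQ_subset_multiIdxLE hs)))ᵀ) := by
  have hr := h.smooth.pos
  have hL := h.det_frameLimit_ne_zero hQ hs hW hV
  have hup : ∀ a b, frameDeg a ≤ s → ¬frameDeg b ≤ s → limitMat Q p σ a b = 0 := fun a b =>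
    h.limitMat_apply_eq_zero hQ hs hL
  -- Nonsingularity is assumed at level `s` only. The leading determinant there is a product of main
  -- terms that contains the one at level `s - 1` as a factor, so that one is nonzero too.
  have hlow : ∀ a b, frameDeg a < s → ¬frameDeg b < s → limitMat Q p σ a b = 0 := by
    intro a b ha hb
    have hs' : s - 1 ≤ r - 1 := by omega
    refine h.limitMat_apply_eq_zero hQ hs' ?_ (by omega) (by omega)
    rw [hQ.det_frameLimit_submatrix h.smooth hs, ← h.prod_main_le hQ hs,
      h.prod_main_evGroup (by omega) hs, h.prod_main_le hQ hs',
      ← hQ.det_frameLimit_submatrix h.smooth hs'] at hL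
    exact left_ne_zero_of_mul hL
  have hT := h.limitMat_orthogonal hQ
  refine h.span_limit_eq hQ (fun k => ?_) ?_ ?_
  · rw [mem_evGroup_iff h.monotone k (show s < r by omega), mem_range_frameIdx_multiIdxEQ hr hs]
  · intro a b ha hb
    rw [mem_range_frameIdx_multiIdxEQ hr hs] at ha hb
    rcases lt_or_gt_of_ne hb with hb | hb
    · exact orthogonal_apply_eq_zero_of_block hT (fun a => frameDeg a < s) hlow (by omega) hb
    · exact hup a b ha.le (by omega)
  · intro a b ha hb
    rw [mem_range_frameIdx_multiIdxEQ hr hs] at ha hb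
    rcases lt_or_gt_of_ne ha with ha | ha
    · exact hlow a b ha (by omega)
    · exact orthogonal_apply_eq_zero_of_block hT (fun a => frameDeg a ≤ s) hup (by omega) hb.le

theorem span_limit_evLastGroup (h : KernelEVD f r x lam P p σ main) (hQ : IsGradedFrame x Q)
    (hW : (wronskianMat (radialKernel d f) (r - 1)).det ≠ 0)
    (hV : (vandermondeMat x (multiIdxLE d (r - 1))).rank = (multiIdxLE d (r - 1)).card) :
    Submodule.span ℝ (p '' (evLastGroup d n r : Set (Fin n))) =
      Submodule.span ℝ (Set.range (Q.submatrix id Sum.inr)ᵀ) := by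
  have hr := h.smooth.pos
  have hL := h.det_frameLimit_ne_zero hQ le_rfl hW hV
  have hrange : ∀ a : multiIdxLE d (r - 1) ⊕ Fin N,
      a ∈ Set.range Sum.inr ↔ ¬frameDeg a ≤ r - 1 := by
    rintro (a | a)
    · have := mem_multiIdxLE.1 a.2
      simp only [Set.mem_range, reduceCtorEq, exists_false, frameDeg, Sum.elim_inl, false_iff]
      omega
    · simp only [Set.mem_range, Sum.inr.injEq, exists_eq, frameDeg, Sum.elim_inr, true_iff]
      omega
  have hup : ∀ a b, frameDeg a ≤ r - 1 → ¬frameDeg b ≤ r - 1 → limitMat Q p σ a b = 0 :=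
    fun a b => h.limitMat_apply_eq_zero hQ le_rfl hL
  refine h.span_limit_eq hQ (fun k => ?_) ?_ ?_
  · have := frameDeg_le hr (σ k)
    rw [mem_evLastGroup_iff h.monotone k hr, hrange]
    omega
  · intro a b ha hb
    rw [hrange] at ha hb
    exact orthogonal_apply_eq_zero_of_block (h.limitMat_orthogonal hQ)
      (fun a => frameDeg a ≤ r - 1) hup ha (not_not.1 hb)
  · intro a b ha hb
    rw [hrange] at ha hb
    exact hup a b (not_not.1 ha) hb

end KernelEVD

end KernelSpectrum



/-! ### Assembly of the theorem -/

theorem IsGradedFrame.kernelEigenvalue_isBigO {d n r N : ℕ} {x : Fin n → EuclideanSpace ℝ (Fin d)}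
    {Q : Matrix (Fin n) (multiIdxLE d (r - 1) ⊕ Fin N) ℝ} {f : ℝ → ℝ} (hQ : IsGradedFrame x Q)
    (hf : HasSmoothnessOrder f r)
    (hpsd : ∃ ε₀ : ℝ, 0 < ε₀ ∧ ∀ ε ∈ Set.Icc 0 ε₀, (kernelMat f x ε).PosSemidef) {s : ℕ}
    (hs : s ≤ r) {k : Fin n} (hk : (multiIdxLT d s).card ≤ k) :
    kernelEigenvalue f x k =O[𝓝[≥] 0] fun ε : ℝ => ε ^ min (2 * s) (2 * r - 1) := by
  obtain ⟨ε₀, hε₀, hpsd⟩ := hpsd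
  refine hQ.eigenvalue_isBigO hf nhdsWithin_le_nhds hs hk
    (Eventually.of_forall (exists_orthogonal_kernelEigenvalue f x))
    (Eventually.of_forall (antitone_kernelEigenvalue f x)) ?_
  filter_upwards [Icc_mem_nhdsGE hε₀] with ε hε
  obtain ⟨U, h1, h2⟩ := exists_orthogonal_kernelEigenvalue f x ε
  exact eigenvalue_nonneg_of_posSemidef (hpsd ε hε) h1 h2 k

theorem fromCols_submatrix_frameIdx {d n r N s : ℕ} (Qthin : Matrix (Fin n) (multiIdxLE d (r - 1)) ℝ)
    (Qperp : Matrix (Fin n) (Fin N) ℝ) (hs : s ≤ r - 1) :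
    (Matrix.fromCols Qthin Qperp).submatrix id (frameIdx (multiIdxEQ_subset_multiIdxLE hs)) =
      degreeCols Qthin s hs := rfl

theorem mainTheorem8 (d r n N : ℕ) (f : ℝ → ℝ) (hf : HasSmoothnessOrder f r)
    (x : Fin n → EuclideanSpace ℝ (Fin d)) (hn : n = (multiIdxLE d (r - 1)).card + N) :
    -- 1. determinant: `det K_ε = ε^{2M(r-1,d)+(2r-1)N} (k + O(ε))`, with both expressions of `k`
    (∃ k : ℝ,
      ((fun ε : ℝ => (kernelMat f x ε).det -
          ε ^ (2 * totalDegreeSum (r - 1) d + (2 * r - 1) * N) * k)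
        =O[𝓝 0] fun ε : ℝ => ε ^ (2 * totalDegreeSum (r - 1) d + (2 * r - 1) * N + 1)) ∧
      k = (-1) ^ (multiIdxLE d (r - 1)).card * (wronskianMat (radialKernel d f) (r - 1)).det *
        (Matrix.fromBlocks (scaledDeriv f (2 * r - 1) • distMat x (2 * r - 1))
          (vandermondeMat x (multiIdxLE d (r - 1)))
          (vandermondeMat x (multiIdxLE d (r - 1))).transpose 0).det ∧
      ∀ Qperp : Matrix (Fin n) (Fin N) ℝ, Qperp.transpose * Qperp = 1 →
        Qperp.transpose * vandermondeMat x (multiIdxLE d (r - 1)) = 0 →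
        k = (wronskianMat (radialKernel d f) (r - 1)).det *
          ((vandermondeMat x (multiIdxLE d (r - 1))).transpose *
            vandermondeMat x (multiIdxLE d (r - 1))).det *
          (scaledDeriv f (2 * r - 1) •
            (Qperp.transpose * distMat x (2 * r - 1) * Qperp)).det) ∧
    -- the positive semidefinite case
    ((∃ ε₀ : ℝ, 0 < ε₀ ∧ ∀ ε ∈ Set.Icc 0 ε₀, (kernelMat f x ε).PosSemidef) →
      -- 2. orders of the eigenvalues
      (∀ s < r, ∀ k ∈ evGroup d n s,
        kernelEigenvalue f x k =O[𝓝[≥] 0] fun ε : ℝ => ε ^ (2 * s)) ∧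
      (∀ k ∈ evLastGroup d n r,
        kernelEigenvalue f x k =O[𝓝[≥] 0] fun ε : ℝ => ε ^ (2 * r - 1)) ∧
      -- the analytic case
      ((∀ i j, AnalyticAt ℝ (fun ε => kernelMat f x ε i j) 0) →
        (∃ lam P p, IsAnalyticEVD (kernelMat f x) lam P p) ∧
        ∀ lam P p, IsAnalyticEVD (kernelMat f x) lam P p →
          ∃ main : Fin n → ℝ,
            -- 3. `main k` is the main term of the `k`-th eigenvalue
            (∀ s < r, ∀ k ∈ evGroup d n s,
              (fun ε : ℝ => lam k ε - ε ^ (2 * s) * main k)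
                =O[𝓝 0] fun ε : ℝ => ε ^ (2 * s + 1)) ∧
            (∀ k ∈ evLastGroup d n r,
              (fun ε : ℝ => lam k ε - ε ^ (2 * r - 1) * main k)
                =O[𝓝 0] fun ε : ℝ => ε ^ (2 * r - 1 + 1)) ∧
            (∀ k ∈ evGroup d n 0, main k = n * radialKernel d f 0 0) ∧
            (∀ s, 1 ≤ s → s < r → (wronskianMat (radialKernel d f) (s - 1)).det ≠ 0 →
              (vandermondeMat x (multiIdxLE d (s - 1))).rank = (multiIdxLE d (s - 1)).card →
              ∏ k ∈ evGroup d n s, main k =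
                (((vandermondeMat x (multiIdxLE d s)).transpose *
                    vandermondeMat x (multiIdxLE d s)).det *
                  (wronskianMat (radialKernel d f) s).det) /
                (((vandermondeMat x (multiIdxLE d (s - 1))).transpose *
                    vandermondeMat x (multiIdxLE d (s - 1))).det *
                  (wronskianMat (radialKernel d f) (s - 1)).det)) ∧
            ∀ ord, IsGradedOrdering d ord →
              ∀ (Qthin : Matrix (Fin n) (multiIdxLE d (r - 1)) ℝ) (Qperp : Matrix (Fin n) (Fin N) ℝ)
                (R : Matrix (multiIdxLE d (r - 1)) (multiIdxLE d (r - 1)) ℝ),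
              IsFullQR x ord Qthin Qperp R →
              -- main terms of the groups `1 ≤ s ≤ r - 1`
              (∀ s, 1 ≤ s → ∀ hs : s ≤ r - 1,
                (wronskianMat (radialKernel d f) (s - 1)).det ≠ 0 →
                (vandermondeMat x (multiIdxLE d (s - 1))).rank = (multiIdxLE d (s - 1)).card →
                (evGroup d n s).val.map main =
                  ((degreeCols Qthin s hs).transpose * vandermondeMat x (multiIdxEQ d s) *
                    wronskianSchur (radialKernel d f) s *
                    (vandermondeMat x (multiIdxEQ d s)).transpose *
                    degreeCols Qthin s hs).charpoly.roots) ∧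
              -- main terms of the last group
              ((wronskianMat (radialKernel d f) (r - 1)).det ≠ 0 →
                (vandermondeMat x (multiIdxLE d (r - 1))).rank = (multiIdxLE d (r - 1)).card →
                (evLastGroup d n r).val.map main =
                  (scaledDeriv f (2 * r - 1) •
                    (Qperp.transpose * distMat x (2 * r - 1) * Qperp)).charpoly.roots) ∧
              -- 4. limiting eigenvectors of the groups `0 ≤ s ≤ r - 1`
              (∀ s, ∀ hs : s ≤ r - 1, (wronskianMat (radialKernel d f) s).det ≠ 0 →
                (vandermondeMat x (multiIdxLE d s)).rank = (multiIdxLE d s).card →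
                Submodule.span ℝ (p '' (evGroup d n s : Set (Fin n))) =
                  Submodule.span ℝ (Set.range (degreeCols Qthin s hs).transpose)) ∧
              -- limiting eigenvectors of the last group
              ((wronskianMat (radialKernel d f) (r - 1)).det ≠ 0 →
                (vandermondeMat x (multiIdxLE d (r - 1))).rank = (multiIdxLE d (r - 1)).card →
                Submodule.span ℝ (p '' (evLastGroup d n r : Set (Fin n))) =
                  Submodule.span ℝ (Set.range Qperp.transpose)))) := by
  have hr := hf.pos
  obtain ⟨Q, hQ⟩ := exists_isGradedFrame hr x hn
  refine ⟨?_, fun hpsd => ?_⟩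
  · have hbord : ∀ Qp : Matrix (Fin n) (Fin N) ℝ, Qp.transpose * Qp = 1 →
        Qp.transpose * vandermondeMat x (multiIdxLE d (r - 1)) = 0 →
        (-1) ^ (multiIdxLE d (r - 1)).card * (wronskianMat (radialKernel d f) (r - 1)).det *
          (Matrix.fromBlocks (scaledDeriv f (2 * r - 1) • distMat x (2 * r - 1))
            (vandermondeMat x (multiIdxLE d (r - 1)))
            (vandermondeMat x (multiIdxLE d (r - 1))).transpose 0).det =
        (wronskianMat (radialKernel d f) (r - 1)).det *
          ((vandermondeMat x (multiIdxLE d (r - 1))).transpose *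
            vandermondeMat x (multiIdxLE d (r - 1))).det *
          (scaledDeriv f (2 * r - 1) •
            (Qp.transpose * distMat x (2 * r - 1) * Qp)).det := by
      intro Qp hQp hQV
      obtain ⟨Q1, hQ1⟩ := exists_orthogonal_completion (κ := multiIdxLE d (r - 1))
        (by simpa using hn) Qp hQp
      have h := det_fromBlocks_bordered (scaledDeriv f (2 * r - 1) • distMat x (2 * r - 1))
        (vandermondeMat x (multiIdxLE d (r - 1))) Q1 Qp (by simpa using hn) hQ1 hQV
      rw [Fintype.card_coe, Matrix.mul_smul, Matrix.smul_mul] at h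
      rw [mul_right_comm, h]
      ring
    have hlead := hQ.hasLead_det hf
    have hQp : (Q.submatrix id Sum.inr).transpose * Q.submatrix id Sum.inr = 1 := by
      ext a b
      have := congrFun (congrFun hQ.orthogonal (Sum.inr a)) (Sum.inr b)
      rw [Matrix.one_apply] at this
      simp only [Sum.inr.injEq] at this
      rw [Matrix.one_apply]
      exact this
    have hQV : (Q.submatrix id Sum.inr).transpose * vandermondeMat x (multiIdxLE d (r - 1)) = 0 := by
      ext a α
      exact hQ.moment_eq_zero (Sum.inr a) α (degree_lt hr α)
    -- The bordered form does not involve the auxiliary frame, so the same constant serves every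
    -- admissible `Qperp`.
    rw [← hbord _ hQp hQV] at hlead
    exact ⟨_, hlead, rfl, hbord⟩
  · refine ⟨?_, ?_, fun han => ⟨?_, fun lam P p hE => ?_⟩⟩
    · intro s hs k hk
      have h := hQ.kernelEigenvalue_isBigO hf hpsd hs.le (Finset.mem_filter.1 hk).2.1
      rwa [min_eq_left (by omega)] at h
    · intro k hk
      have h := hQ.kernelEigenvalue_isBigO hf hpsd le_rfl (Finset.mem_filter.1 hk).2
      rwa [min_eq_right (by omega)] at h
    · exact exists_isAnalyticEVD han fun ε => kernelMat_isHermitian f x ε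
    · obtain ⟨σ, main, h⟩ := exists_kernelEVD hf hn hpsd hE
      refine ⟨main, ?_, ?_, ?_, ?_, ?_⟩
      · intro s hs k hk
        have h1 := h.hasLead k
        rwa [(mem_evGroup_iff h.monotone k hs).1 hk, min_eq_left (by omega)] at h1
      · intro k hk
        have h1 := h.hasLead k
        rwa [(mem_evLastGroup_iff h.monotone k hr).1 hk, min_eq_right (by omega)] at h1
      · intro k hk
        rw [h.main_evGroup_zero hk, radialKernel, sub_zero, norm_zero]
      · intro s hs1 hs hW hV
        exact h.prod_main_evGroup_eq_div hQ hs1 (by omega) hW hV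
      · intro ord ho Qthin Qperp R hQR
        -- The main terms were fixed independently of any frame; the given QR factorization now
        -- replaces the auxiliary one.
        have hQ' := hQR.isGradedFrame hr ho
        have hperp : (Matrix.fromCols Qthin Qperp).submatrix id Sum.inr = Qperp := rfl
        refine ⟨fun s hs1 hs hW hV => ?_, fun hW hV => ?_, fun s hs hW hV => ?_, fun hW hV => ?_⟩
        · have h1 := h.map_main_evGroup hQ' hs1 hs hW hV
          rwa [fromCols_submatrix_frameIdx] at h1
        · have h1 := h.map_main_evLastGroup hQ' hW hV
          rwa [hperp] at h1
        · have h1 := h.span_limit_evGroup hQ' hs hW hV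
          rwa [fromCols_submatrix_frameIdx] at h1
        · have h1 := h.span_limit_evLastGroup hQ' hW hV
          rwa [hperp] at h1
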